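/- Let either $d\ge 3$ and $0\le\gamma\le 1$, or $d=2$ and $0\le\gamma<\tfrac12$. For a set $F\subset\mathbb R$ and $\delta>0$ let $N(F,\delta)$ denote the minimal number of compact intervals of length $\delta$ needed to cover $F$. Let $E\subset[1,2]$ satisfy $$\mathcal A:=\sup_{0<\delta<1}\ \sup_{\delta\le|I|\le1}\Big(\frac{\delta}{|I|}\Big)^{\gamma}N(E\cap I,\delta)<\infty ,$$ where the second supremum is over all intervals $I$ of length $|I|\in[\delta,1]$. Let $\sigma$ be the normalized surface measure on the unit sphere of $\mathbb R^d$, and put $$A_tf(x)=\int f(x-ty)\,d\sigma(y),\qquad M_Ef(x)=\sup_{t\in E}|A_tf(x)| ,$$ $$p_4=\frac{d^2+2\gamma-1}{d^2-d},\qquad q_4=\frac{d^2+2\gamma-1}{d-1}.$$ Then $M_E$ maps the Lorentz space $L^{p_4,1}(\mathbb R^d)$ to $L^{q_4,\infty}(\mathbb R^d)$: for every measurable $f:\mathbb R^d\to\mathbb C$ with $\|f\|_{L^{p_4,1}}<\infty$, the integrals $A_tf(x)$, $t\in E$, converge absolutely for almost every $x$, the function $M_Ef$ is Lebesgue measurable,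 and $$\|M_Ef\|_{L^{q_4,\infty}}\le C\,\|f\|_{L^{p_4,1}},$$ where $C$ depends only on $d$, $\gamma$ and (an upper bound for) $\mathcal A$. Here $\|f\|_{L^{p,1}}=p\int_0^\infty|\{|f|>s\}|^{1/p}\,ds$ and $\|g\|_{L^{q,\infty}}=\sup_{s>0}s\,|\{|g|>s\}|^{1/q}$. -/

import Mathlib

open MeasureTheory Set
open scoped NNReal ENNReal

noncomputable section

namespace SphericalMax

/-- `N(E, δ)`: the minimal number of compact intervals of length `δ` needed to cover `E`
(it is `∞` if no finite number suffices). -/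
def intervalCount (E : Set ℝ) (δ : ℝ) : ℕ∞ :=
  ⨅ (s : Finset ℝ) (_ : E ⊆ ⋃ a ∈ s, Icc a (a + δ)), (s.card : ℕ∞)

/-- `sup_{0 < δ < 1} sup_{δ ≤ |I| ≤ 1} (δ / |I|) ^ γ * N(E ∩ I, δ)`, where `I = [a, a + ℓ]` runs over
the intervals of length `ℓ ∈ [δ, 1]`. Taking `I` closed is no restriction, as `N(E ∩ I, δ)` is
monotone in `I` and an interval has the same length as its closure. -/
def assouadSup (γ : ℝ) (E : Set ℝ) : ℝ≥0∞ :=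
  ⨆ (δ : ℝ) (_ : δ ∈ Ioo (0 : ℝ) 1) (a : ℝ) (ℓ : ℝ) (_ : ℓ ∈ Icc δ 1),
    ENNReal.ofReal ((δ / ℓ) ^ γ) * (intervalCount (E ∩ Icc a (a + ℓ)) δ : ℝ≥0∞)

/-- The surface measure of the unit sphere of `ℝ^d`, normalized to total mass one. -/
def sphereMeasure (d : ℕ) : Measure (Metric.sphere (0 : EuclideanSpace ℝ (Fin d)) 1) :=
  ((volume : Measure (EuclideanSpace ℝ (Fin d))).toSphere univ)⁻¹ •
    (volume : Measure (EuclideanSpace ℝ (Fin d))).toSphere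

/-- The spherical mean `A_t f(x) = ∫ f(x - t y) dσ(y)`. -/
def sphericalMean {d : ℕ} (t : ℝ) (f : EuclideanSpace ℝ (Fin d) → ℂ)
    (x : EuclideanSpace ℝ (Fin d)) : ℂ :=
  ∫ y, f (x - t • (y : EuclideanSpace ℝ (Fin d))) ∂(sphereMeasure d)

/-- The maximal function `M_E f(x) = sup_{t ∈ E} |A_t f(x)|`, with values in `[0, ∞]`. -/
def maximalFunction {d : ℕ} (E : Set ℝ) (f : EuclideanSpace ℝ (Fin d) → ℂ)
    (x : EuclideanSpace ℝ (Fin d)) : ℝ≥0∞ :=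
  ⨆ t ∈ E, ‖sphericalMean t f x‖ₑ

/-- The Lorentz norm of `L^{p,1}`, through the distribution function:
`‖f‖_{p,1} = p ∫_0^∞ μ {|f| > s} ^ (1/p) ds = ∫_0^∞ t ^ (1/p) f^*(t) dt/t`. -/
def lorentzNormOne {α F : Type*} [MeasurableSpace α] [ENorm F] (p : ℝ) (f : α → F)
    (μ : Measure α) : ℝ≥0∞ :=
  ENNReal.ofReal p * ∫⁻ s in Ioi (0 : ℝ), (μ {x | ENNReal.ofReal s < ‖f x‖ₑ}) ^ (1 / p)

/-- The Lorentz (weak `L^q`) quasinorm of `L^{q,∞}`: `sup_{s > 0} s * μ {|g| > s} ^ (1/q)`. -/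
def lorentzNormTop {α F : Type*} [MeasurableSpace α] [ENorm F] (q : ℝ) (g : α → F)
    (μ : Measure α) : ℝ≥0∞ :=
  ⨆ (s : ℝ) (_ : 0 < s), ENNReal.ofReal s * (μ {x | ENNReal.ofReal s < ‖g x‖ₑ}) ^ (1 / q)

/-- `p_4 = (d² + 2γ - 1) / (d² - d)`. -/
def p4 (d : ℕ) (γ : ℝ) : ℝ := ((d : ℝ) ^ 2 + 2 * γ - 1) / ((d : ℝ) ^ 2 - d)

/-- `q_4 = (d² + 2γ - 1) / (d - 1)`. -/
def q4 (d : ℕ) (γ : ℝ) : ℝ := ((d : ℝ) ^ 2 + 2 * γ - 1) / ((d : ℝ) - 1)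

end SphericalMax

end

/-! The core is a dual, linearized estimate (`exists_restricted_bound`). Choosing for each point a
radius that nearly attains the supremum reduces the weak type bound to a sum, over a finite T ⊆ E,
of ∫_{G t} |A_t f|, with disjoint sets G t of total measure at most W and a continuous f with |f| ≤
1 and ∫ |f| ≤ V. The target is a multiple of V^{1/p4} W^{1-1/q4}.

Frequencies are cut by a compactly supported radial mollifier. The part below frequency 2^J has a
kernel of size 2^J on a fixed ball and contributes at most a multiple of 2^J V W. The piece of
frequency 1/δ is treated by T T* over the grid δℤ of radii: for two radii t, t' the composed kernel
is O(δ^{-1} (1 + |t-t'|/δ)^{-(d-1)/2}) (`exists_kernel_bound`), while the composed multiplier is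
O(δ^{d-1}). The hypothesis on E says that a grid point has O(r^γ) relevant neighbours within r steps
(`card_grid_le`). Using the kernel for far pairs and the L² bound for near pairs, and optimizing the
threshold (`sum_min_le`), gives δ^a H up to a constant, where H = V^{1/2} W^{1-θ/2}, θ =
(d-1)/(d-1+2γ) and a = (dθ-1)/2 (`exists_level_bound`). Here a > 0 exactly when 2γ < (d-1)², which
is where d = 2 forces γ < 1/2. So the high frequencies sum to O(2^{-aJ} H), and choosing J to
balance this against 2^J V W is Bourgain's interpolation argument (`le_of_forall_dyadic_bound`). It
loses no logarithm, and its outcome is of restricted weak type.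

The rest is measure theory. The dual bound passes to open sets by inner regularity. If g is a
countable sum of multiples of indicators of open sets, its spherical means are lower semicontinuous,
so the superlevel sets of its maximal function are open and their compact subsets need only finitely
many radii; an uncountable E does no harm. Any nonnegative function lies below such a sum, through
its dyadic superlevel sets and outer regularity. The resulting bound for upper integrals
(`RestrictedWeakType.weak_type`) needs no measurability. It gives absolute convergence off a null
set and, by approximation with continuous functions, continuity of t ↦ A_t f(x) on E for almost
every x; hence the supremum may be taken over a countable dense subset of E, and M_E f is
measurable. -/

namespace SphericalMax

/-! ### The sphere measure: rotation invariance and caps. -/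

section Sphere

open Metric Pointwise

variable {d : ℕ}

local notation "𝔼" => EuclideanSpace ℝ (Fin d)

instance [NeZero d] : IsProbabilityMeasure (sphereMeasure d) := by
  have : Nontrivial 𝔼 := Module.nontrivial_of_finrank_pos (R := ℝ)
    (by simpa using Nat.pos_of_ne_zero (NeZero.ne d))
  refine ⟨?_⟩
  rw [sphereMeasure, Measure.smul_apply, smul_eq_mul]
  refine ENNReal.inv_mul_cancel ?_ (measure_ne_top _ _)
  rw [Ne, Measure.measure_univ_eq_zero]
  exact Measure.toSphere_ne_zero _

/-- The self-map of the unit sphere induced by a linear isometry. -/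
noncomputable def sphereIsometry (L : 𝔼 ≃ₗᵢ[ℝ] 𝔼) (y : sphere (0 : 𝔼) 1) : sphere (0 : 𝔼) 1 :=
  ⟨L y, by simp⟩

/-- The sphere measure of a set is a multiple of the volume of the cone over it, and taking cones
commutes with linear isometries, which preserve volume. -/
lemma measurePreserving_sphereIsometry (L : 𝔼 ≃ₗᵢ[ℝ] 𝔼) :
    MeasurePreserving (sphereIsometry L) (sphereMeasure d) (sphereMeasure d) := by
  have hc : Continuous (sphereIsometry L) := by
    unfold sphereIsometry
    fun_prop
  refine ⟨hc.measurable, ?_⟩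
  rw [sphereMeasure, Measure.map_smul]
  congr 1
  ext s hs
  rw [Measure.map_apply hc.measurable hs, Measure.toSphere_apply' _ (hc.measurable hs),
    Measure.toSphere_apply' _ hs]
  congr 1
  have h : (Ioo (0 : ℝ) 1 • ((↑) '' (sphereIsometry L ⁻¹' s)) : Set 𝔼)
      = L ⁻¹' (Ioo (0 : ℝ) 1 • ((↑) '' s)) := by
    ext x
    simp only [Set.mem_smul, mem_image, mem_preimage, Subtype.exists, exists_and_right,
      exists_eq_right]
    constructor
    · rintro ⟨r, hr, y, ⟨hy, hys⟩, rfl⟩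
      exact ⟨r, hr, L y, ⟨by simpa using hy, hys⟩, by simp⟩
    · rintro ⟨r, hr, y, ⟨hy, hys⟩, hx⟩
      refine ⟨r, hr, L.symm y, ⟨by simpa using hy, ?_⟩, ?_⟩
      · simpa [sphereIsometry] using hys
      · rw [← map_smul, hx]; simp
  rw [h]
  exact L.measurePreserving.measure_preimage_equiv (f := L.toMeasurableEquiv) _

lemma integral_sphere_comp_isometry {F : Type*} [NormedAddCommGroup F] [NormedSpace ℝ F]
    (L : 𝔼 ≃ₗᵢ[ℝ] 𝔼) (g : 𝔼 → F) :
    ∫ y, g (L (y : 𝔼)) ∂(sphereMeasure d) = ∫ y, g (y : 𝔼) ∂(sphereMeasure d) := by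
  have hinj : Function.Injective (sphereIsometry L) := by
    intro a b h
    have := congrArg Subtype.val h
    exact Subtype.ext (L.injective this)
  have hc : Continuous (sphereIsometry L) := by
    unfold sphereIsometry
    fun_prop
  have hemb : MeasurableEmbedding (sphereIsometry L) :=
    (hc.isClosedEmbedding hinj).measurableEmbedding
  exact (measurePreserving_sphereIsometry L).integral_comp hemb (fun y => g (y : 𝔼))

/-- The spherical measure of a cap of radius `r` is at most a constant times `r ^ (d - 1)`. -/
lemma sphereMeasure_ball_le [NeZero d] (w : 𝔼) {r : ℝ} (hr : 0 < r) :
    (sphereMeasure d).real {y | dist (y : 𝔼) w < r} ≤ 2 ^ d * r ^ (d - 1) := by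
  have hd : d ≠ 0 := NeZero.ne d
  rcases le_or_gt 1 r with h1 | h1
  · exact measureReal_le_one.trans (one_le_mul_of_one_le_of_one_le (one_le_pow₀ one_le_two)
      (one_le_pow₀ h1))
  set s : Set (sphere (0 : 𝔼) 1) := {y | dist (y : 𝔼) w < r}
  have hs : MeasurableSet s := (isOpen_lt (by fun_prop) continuous_const).measurableSet
  set C : Set 𝔼 := Ioo (0 : ℝ) 1 • ((↑) '' s) with hC
  have hCball : C ⊆ ball 0 1 := by
    rintro _ ⟨ρ, hρ, _, ⟨y, -, rfl⟩, rfl⟩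
    simpa [norm_smul, abs_of_pos hρ.1] using hρ.2
  have hCfin : volume C ≠ ∞ := (measure_mono hCball |>.trans_lt measure_ball_lt_top).ne
  have hB : 0 < volume.real (ball (0 : 𝔼) 1) :=
    ENNReal.toReal_pos (measure_ball_pos _ _ one_pos).ne' measure_ball_lt_top.ne
  have hσ : (sphereMeasure d).real s * volume.real (ball (0 : 𝔼) 1) = volume.real C := by
    rw [sphereMeasure, measureReal_ennreal_smul_apply, Measure.real, Measure.toSphere_apply' _ hs,
      Measure.toSphere_apply_univ, ENNReal.toReal_mul, ENNReal.toReal_inv, ENNReal.toReal_mul]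
    simp only [finrank_euclideanSpace, Fintype.card_fin, ENNReal.toReal_natCast]
    have : (d : ℝ) ≠ 0 := by exact_mod_cast hd
    change _ * (_ * volume.real C) * _ = _
    change ((d : ℝ) * volume.real (ball (0 : 𝔼) 1))⁻¹ * _ * _ = _
    field_simp
  -- A cone over a cap is too long to fit in a small ball, but its outer shell of thickness r does.
  -- Comparing volumes gives |C| ≤ (1-r)^d |C| + (2r)^d |B|, and 1 - (1-r)^d ≥ r turns this into a
  -- bound with one power of r less.
  have hsub : C \ ((1 - r) • C) ⊆ ball w (2 * r) := by
    rintro x ⟨hx, hx'⟩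
    obtain ⟨ρ, hρ, _, ⟨y, hy, rfl⟩, rfl⟩ := hx
    simp only at hx' ⊢
    have hρr : 1 - r ≤ ρ := by
      by_contra! h
      refine hx' ⟨(ρ / (1 - r)) • (y : 𝔼), ?_, ?_⟩
      · have h0 : 0 < 1 - r := by linarith
        exact ⟨ρ / (1 - r), ⟨div_pos hρ.1 h0, (div_lt_one h0).2 h⟩, _, ⟨y, hy, rfl⟩, rfl⟩
      · have h0 : (1 - r) ≠ 0 := by linarith
        simp only [smul_smul]
        congr 1
        field_simp
    rw [mem_ball]
    have h1 : dist (ρ • (y : 𝔼)) y ≤ r := by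
      have : ρ • (y : 𝔼) - y = (ρ - 1) • (y : 𝔼) := by rw [sub_smul, one_smul]
      rw [dist_eq_norm, this, norm_smul, norm_eq_of_mem_sphere, mul_one, Real.norm_eq_abs,
        abs_le]
      constructor <;> linarith [hρ.2]
    have h2 : dist (y : 𝔼) w < r := hy
    linarith [dist_triangle (ρ • (y : 𝔼)) y w]
  have hsm : volume.real ((1 - r) • C) = (1 - r) ^ d * volume.real C := by
    rw [Measure.real, Measure.addHaar_smul, ENNReal.toReal_mul, finrank_euclideanSpace,
      Fintype.card_fin, ENNReal.toReal_ofReal (abs_nonneg _),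
      abs_of_nonneg (pow_nonneg (by linarith) _)]
    rfl
  have hbw : volume.real (ball w (2 * r)) = (2 * r) ^ d * volume.real (ball (0 : 𝔼) 1) := by
    rw [Measure.real, Measure.addHaar_ball _ _ (by linarith), ENNReal.toReal_mul,
      finrank_euclideanSpace, Fintype.card_fin, ENNReal.toReal_ofReal (by positivity)]
    rfl
  have hle : volume.real C ≤ (1 - r) ^ d * volume.real C +
      (2 * r) ^ d * volume.real (ball (0 : 𝔼) 1) := by
    rw [← hsm, ← hbw]
    have hfin' : volume ((1 - r) • C) ≠ ∞ := by
      rw [Measure.addHaar_smul]; exact ENNReal.mul_ne_top ENNReal.ofReal_ne_top hCfin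
    calc volume.real C ≤ volume.real ((1 - r) • C ∪ ball w (2 * r)) := by
          refine measureReal_mono ?_ (measure_union_ne_top hfin' measure_ball_lt_top.ne)
          intro x hx
          by_cases h : x ∈ (1 - r) • C
          · exact Or.inl h
          · exact Or.inr (hsub ⟨hx, h⟩)
      _ ≤ _ := measureReal_union_le _ _
  have hpow : (1 - r) ^ d ≤ 1 - r := by
    simpa using pow_le_pow_of_le_one (by linarith : 0 ≤ 1 - r) (by linarith) (Nat.one_le_iff_ne_zero.2 hd)
  have hfinal : r * (sphereMeasure d).real s ≤ (2 * r) ^ d := by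
    refine le_of_mul_le_mul_right ?_ hB
    rw [mul_assoc, hσ]
    nlinarith [measureReal_nonneg (μ := volume) (s := C)]
  obtain ⟨k, rfl⟩ := Nat.exists_eq_succ_of_ne_zero hd
  refine le_of_mul_le_mul_left (hfinal.trans_eq ?_) hr
  rw [Nat.succ_sub_one, mul_pow, pow_succ r k]
  ring

end Sphere
end SphericalMax

namespace SphericalMax

/-! ### Decay of the Fourier transform of the sphere measure. -/

section Bessel

open Metric

variable {d : ℕ}

local notation "𝔼" => EuclideanSpace ℝ (Fin d)

lemma abs_coord_le_one (y : sphere (0 : 𝔼) 1) (k : Fin d) : |(y : 𝔼) k| ≤ 1 := by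
  simpa using PiLp.norm_apply_le (y : 𝔼) k

variable [NeZero d]

lemma integrable_sphere_of_continuous {F : Type*} [NormedAddCommGroup F]
    {g : sphere (0 : 𝔼) 1 → F} (hg : Continuous g) : Integrable g (sphereMeasure d) :=
  hg.integrable_of_hasCompactSupport (HasCompactSupport.of_compactSpace g)

lemma hasDerivAt_integral_sphere {F F' : ℝ → sphere (0 : 𝔼) 1 → ℝ} {C : ℝ}
    (hF : ∀ t, Continuous (F t)) (hF' : ∀ t, Continuous (F' t))
    (hC : ∀ t y, |F' t y| ≤ C) (hd : ∀ t y, HasDerivAt (fun s => F s y) (F' t y) t) (t : ℝ) :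
    HasDerivAt (fun s => ∫ y, F s y ∂(sphereMeasure d)) (∫ y, F' t y ∂(sphereMeasure d)) t := by
  refine (hasDerivAt_integral_of_dominated_loc_of_deriv_le (s := univ) Filter.univ_mem
    (Filter.Eventually.of_forall fun s => (hF s).aestronglyMeasurable)
    (integrable_sphere_of_continuous (hF t)) (hF' t).aestronglyMeasurable
    (bound := fun _ => C) (Filter.Eventually.of_forall fun y s _ => hC s y)
    (integrable_const C) (Filter.Eventually.of_forall fun y s _ => hd s y)).2

variable (d) in
/-- The profile of the Fourier transform of the spherical measure. -/
noncomputable def sphereProfile (r : ℝ) : ℝ :=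
  ∫ y : sphere (0 : 𝔼) 1, Real.cos (r * (y : 𝔼) 0) ∂(sphereMeasure d)

variable (d) in
/-- The derivative of `sphereProfile`. -/
noncomputable def sphereProfileDeriv (r : ℝ) : ℝ :=
  ∫ y : sphere (0 : 𝔼) 1, -((y : 𝔼) 0 * Real.sin (r * (y : 𝔼) 0)) ∂(sphereMeasure d)

variable (d) in
/-- The second derivative of `sphereProfile`. -/
noncomputable def sphereProfileDeriv2 (r : ℝ) : ℝ :=
  ∫ y : sphere (0 : 𝔼) 1, -((y : 𝔼) 0 ^ 2 * Real.cos (r * (y : 𝔼) 0)) ∂(sphereMeasure d)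

lemma hasDerivAt_sphereProfile (r : ℝ) :
    HasDerivAt (sphereProfile d) (sphereProfileDeriv d r) r := by
  refine hasDerivAt_integral_sphere (C := 1)
    (F := fun r (y : sphere (0 : 𝔼) 1) => Real.cos (r * (y : 𝔼) 0))
    (F' := fun r (y : sphere (0 : 𝔼) 1) => -((y : 𝔼) 0 * Real.sin (r * (y : 𝔼) 0)))
    (fun t => by fun_prop) (fun t => by fun_prop) ?_ ?_ r
  · intro t y
    rw [abs_neg, abs_mul]
    exact mul_le_one₀ (abs_coord_le_one y 0) (abs_nonneg _) (Real.abs_sin_le_one _)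
  · intro t y
    refine HasDerivAt.congr_deriv ((hasDerivAt_id t).mul_const ((y : 𝔼) 0)).cos ?_
    simp only [id]; ring

lemma hasDerivAt_sphereProfileDeriv (r : ℝ) :
    HasDerivAt (sphereProfileDeriv d) (sphereProfileDeriv2 d r) r := by
  refine hasDerivAt_integral_sphere (C := 1)
    (F := fun r (y : sphere (0 : 𝔼) 1) => -((y : 𝔼) 0 * Real.sin (r * (y : 𝔼) 0)))
    (F' := fun r (y : sphere (0 : 𝔼) 1) => -((y : 𝔼) 0 ^ 2 * Real.cos (r * (y : 𝔼) 0)))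
    (fun t => by fun_prop) (fun t => by fun_prop) ?_ ?_ r
  · intro t y
    rw [abs_neg, abs_mul, abs_pow]
    exact mul_le_one₀ (pow_le_one₀ (abs_nonneg _) (abs_coord_le_one y 0)) (abs_nonneg _)
      (Real.abs_cos_le_one _)
  · intro t y
    refine HasDerivAt.congr_deriv (((hasDerivAt_id t).mul_const ((y : 𝔼) 0)).sin.const_mul ((y : 𝔼) 0)).neg ?_
    simp only [id]; ring

lemma continuous_sphereProfile : Continuous (sphereProfile d) :=
  continuous_iff_continuousAt.2 fun r => (hasDerivAt_sphereProfile r).continuousAt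

lemma continuous_sphereProfileDeriv : Continuous (sphereProfileDeriv d) :=
  continuous_iff_continuousAt.2 fun r => (hasDerivAt_sphereProfileDeriv r).continuousAt

lemma abs_integral_sphere_le_one {g : sphere (0 : 𝔼) 1 → ℝ} (hg : ∀ y, |g y| ≤ 1) :
    |∫ y, g y ∂(sphereMeasure d)| ≤ 1 := by
  simpa using norm_integral_le_of_norm_le_const (μ := sphereMeasure d) (f := g) (C := 1)
    (Filter.Eventually.of_forall hg)

lemma abs_sphereProfile_le_one (r : ℝ) : |sphereProfile d r| ≤ 1 :=
  abs_integral_sphere_le_one fun _ => Real.abs_cos_le_one _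

lemma abs_sphereProfileDeriv_le_one (r : ℝ) : |sphereProfileDeriv d r| ≤ 1 := by
  refine abs_integral_sphere_le_one fun y => ?_
  rw [abs_neg, abs_mul]
  exact mul_le_one₀ (abs_coord_le_one y 0) (abs_nonneg _) (Real.abs_sin_le_one _)

/-- Integration by parts on the sphere, from invariance under reflections. -/
lemma integral_sphere_coord_sq_mul_cos {k : Fin d} (hk : k ≠ 0) (r : ℝ) :
    r * ∫ y : sphere (0 : 𝔼) 1, (y : 𝔼) k ^ 2 * Real.cos (r * (y : 𝔼) 0) ∂(sphereMeasure d)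
      = - sphereProfileDeriv d r := by
  -- `F φ` is the pullback of y_k sin(r y_0) under the reflection in the line at angle φ/2 of the
  -- (0,k)-plane, so its integral does not depend on φ. The identity is the vanishing of the
  -- derivative at φ = 0.
  set F : ℝ → sphere (0 : 𝔼) 1 → ℝ := fun φ y =>
    (Real.sin φ * (y : 𝔼) 0 - Real.cos φ * (y : 𝔼) k) *
      Real.sin (r * (Real.cos φ * (y : 𝔼) 0 + Real.sin φ * (y : 𝔼) k)) with hF
  set F' : ℝ → sphere (0 : 𝔼) 1 → ℝ := fun φ y =>
    (Real.cos φ * (y : 𝔼) 0 + Real.sin φ * (y : 𝔼) k) *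
      Real.sin (r * (Real.cos φ * (y : 𝔼) 0 + Real.sin φ * (y : 𝔼) k)) +
    (Real.sin φ * (y : 𝔼) 0 - Real.cos φ * (y : 𝔼) k) *
      (Real.cos (r * (Real.cos φ * (y : 𝔼) 0 + Real.sin φ * (y : 𝔼) k)) *
        (r * (-Real.sin φ * (y : 𝔼) 0 + Real.cos φ * (y : 𝔼) k))) with hF'
  have hcomb : ∀ (a c : ℝ) (y : sphere (0 : 𝔼) 1) (_ : |a| ≤ 1) (_ : |c| ≤ 1),
      |a * (y : 𝔼) 0 + c * (y : 𝔼) k| ≤ 2 := by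
    intro a c y ha hc
    have h0 := mul_le_one₀ ha (abs_nonneg _) (abs_coord_le_one y 0)
    have h1 := mul_le_one₀ hc (abs_nonneg _) (abs_coord_le_one y k)
    rw [← abs_mul] at h0 h1
    linarith [abs_add_le (a * (y : 𝔼) 0) (c * (y : 𝔼) k)]
  have hder : ∀ φ, HasDerivAt (fun s => ∫ y, F s y ∂(sphereMeasure d))
      (∫ y, F' φ y ∂(sphereMeasure d)) φ := by
    refine hasDerivAt_integral_sphere (C := 2 * 1 + 2 * (1 * (|r| * 2)))
      (fun t => by fun_prop) (fun t => by fun_prop) ?_ ?_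
    · intro t y
      have e1 := hcomb _ _ y (Real.abs_cos_le_one t) (Real.abs_sin_le_one t)
      have e2 := hcomb (-Real.sin t) _ y (by simpa using Real.abs_sin_le_one t)
        (Real.abs_cos_le_one t)
      have e3 : |Real.sin t * (y : 𝔼) 0 - Real.cos t * (y : 𝔼) k| ≤ 2 := by
        rw [← abs_neg]; convert e2 using 2; ring
      simp only [hF']
      refine (abs_add_le _ _).trans (add_le_add ?_ ?_)
      · rw [abs_mul]
        exact mul_le_mul e1 (Real.abs_sin_le_one _) (abs_nonneg _) zero_le_two
      · rw [abs_mul, abs_mul, abs_mul r]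
        gcongr
        exact Real.abs_cos_le_one _
    · intro t y
      have hs := Real.hasDerivAt_sin t
      have hc := Real.hasDerivAt_cos t
      have h1 := (hs.mul_const ((y : 𝔼) 0)).sub (hc.mul_const ((y : 𝔼) k))
      have h2 := (((hc.mul_const ((y : 𝔼) 0)).add (hs.mul_const ((y : 𝔼) k))).const_mul r).sin
      refine HasDerivAt.congr_deriv (h1.mul h2) ?_
      simp only [hF', Pi.add_apply, Pi.sub_apply]
      ring
  have hconst : ∀ φ, ∫ y, F φ y ∂(sphereMeasure d) =
      ∫ y : sphere (0 : 𝔼) 1, (y : 𝔼) k * Real.sin (r * (y : 𝔼) 0) ∂(sphereMeasure d) := by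
    intro φ
    set u : 𝔼 := Real.cos (φ / 2) • EuclideanSpace.single 0 1 +
      Real.sin (φ / 2) • EuclideanSpace.single k 1 with hu
    have hu0 : u 0 = Real.cos (φ / 2) := by simp [hu, hk.symm]
    have huk : u k = Real.sin (φ / 2) := by simp [hu, hk]
    have hinner : ∀ v : 𝔼, inner ℝ u v = Real.cos (φ / 2) * v 0 + Real.sin (φ / 2) * v k := by
      intro v
      rw [hu, inner_add_left, inner_smul_left, inner_smul_left, EuclideanSpace.inner_single_left,
        EuclideanSpace.inner_single_left]
      simp
    have hnorm : ‖u‖ ^ 2 = 1 := by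
      rw [← real_inner_self_eq_norm_sq, hinner, hu0, huk]
      nlinarith [Real.sin_sq_add_cos_sq (φ / 2)]
    have hrefl : ∀ v : 𝔼, (ℝ ∙ u).reflection v =
        (2 * (Real.cos (φ / 2) * v 0 + Real.sin (φ / 2) * v k)) • u - v := by
      intro v
      rw [Submodule.reflection_singleton_apply, hinner]
      rw [mul_smul, two_smul ℝ, two_smul ℕ]
      simp [hnorm]
    have hcos : Real.cos φ = 2 * Real.cos (φ / 2) ^ 2 - 1 := by
      rw [← Real.cos_two_mul]; ring_nf
    have hsin : Real.sin φ = 2 * Real.sin (φ / 2) * Real.cos (φ / 2) := by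
      rw [← Real.sin_two_mul]; ring_nf
    have hsq := Real.sin_sq_add_cos_sq (φ / 2)
    rw [← integral_sphere_comp_isometry (ℝ ∙ u).reflection
      (fun y : 𝔼 => y k * Real.sin (r * y 0))]
    refine integral_congr_ae (Filter.Eventually.of_forall fun y => ?_)
    simp only [hF, hrefl, PiLp.sub_apply, PiLp.smul_apply, smul_eq_mul, hu0, huk]
    have e1 : Real.sin φ * (y : 𝔼) 0 - Real.cos φ * (y : 𝔼) k = 2 * (Real.cos (φ / 2) * (y : 𝔼) 0 +
        Real.sin (φ / 2) * (y : 𝔼) k) * Real.sin (φ / 2) - (y : 𝔼) k := by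
      rw [hcos, hsin]
      linear_combination (-(2 * (y : 𝔼) k)) * hsq
    have e2 : Real.cos φ * (y : 𝔼) 0 + Real.sin φ * (y : 𝔼) k = 2 * (Real.cos (φ / 2) * (y : 𝔼) 0 +
        Real.sin (φ / 2) * (y : 𝔼) k) * Real.cos (φ / 2) - (y : 𝔼) 0 := by
      rw [hcos, hsin]
      ring
    rw [e1, e2]
  have h0 := (hder 0).unique ((hasDerivAt_const (0 : ℝ)
    (∫ y : sphere (0 : 𝔼) 1, (y : 𝔼) k * Real.sin (r * (y : 𝔼) 0) ∂(sphereMeasure d))).congr_of_eventuallyEq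
    (Filter.Eventually.of_forall hconst))
  rw [← integral_const_mul, sphereProfileDeriv, ← sub_eq_zero, sub_neg_eq_add, ← integral_add
    (integrable_sphere_of_continuous (by fun_prop)) (integrable_sphere_of_continuous (by fun_prop)),
    ← neg_eq_zero, ← integral_neg, ← h0]
  refine integral_congr_ae (Filter.Eventually.of_forall fun y => ?_)
  simp only [hF', Real.cos_zero, Real.sin_zero]
  ring_nf

/-- Bessel's equation U'' + (d-1)U'/r + U = 0. On the sphere 1 - y_0² is the sum of the other y_k²,
and each of these contributes -U'/r by the preceding identity. -/
lemma sphereProfile_ode (r : ℝ) :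
    r * (sphereProfileDeriv2 d r + sphereProfile d r) = -((d : ℝ) - 1) * sphereProfileDeriv d r := by
  have hsum : sphereProfileDeriv2 d r + sphereProfile d r = ∑ k ∈ Finset.univ.erase (0 : Fin d),
      ∫ y : sphere (0 : 𝔼) 1, (y : 𝔼) k ^ 2 * Real.cos (r * (y : 𝔼) 0) ∂(sphereMeasure d) := by
    rw [← integral_finsetSum _ (fun k _ => integrable_sphere_of_continuous (by fun_prop)),
      sphereProfileDeriv2, sphereProfile, ← integral_add
      (integrable_sphere_of_continuous (by fun_prop)) (integrable_sphere_of_continuous (by fun_prop))]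
    refine integral_congr_ae (Filter.Eventually.of_forall fun y => ?_)
    have h1 : ∑ k, (y : 𝔼) k ^ 2 = 1 := by
      have := EuclideanSpace.real_norm_sq_eq (y : 𝔼)
      rw [← this, norm_eq_of_mem_sphere]; norm_num
    rw [← Finset.add_sum_erase _ _ (Finset.mem_univ (0 : Fin d))] at h1
    simp only
    rw [← Finset.sum_mul, eq_sub_of_add_eq' h1]
    ring
  rw [hsum, Finset.mul_sum, Finset.sum_congr rfl fun k hk =>
    integral_sphere_coord_sq_mul_cos (Finset.ne_of_mem_erase hk) r, Finset.sum_const,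
    Finset.card_erase_of_mem (Finset.mem_univ _), Finset.card_univ, Fintype.card_fin, nsmul_eq_mul,
    Nat.cast_sub (Nat.one_le_iff_ne_zero.2 (NeZero.ne d))]
  push_cast
  ring

/-- An energy argument replaces stationary phase. With b = (d-1)/2 the function r^b U solves an
oscillator equation perturbed by b(b-1)/r², and r^b z is its derivative; the energy `Q` therefore
changes by a relative amount O(r^{-2}), which is integrable at infinity. -/
lemma exists_sphereProfile_sq_bound : ∃ C : ℝ, 0 < C ∧ ∀ r, 0 ≤ r →
    r ^ (d - 1) * sphereProfile d r ^ 2 ≤ C ∧ r ^ (d - 1) * sphereProfileDeriv d r ^ 2 ≤ C := by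
  obtain ⟨n, hn⟩ : ∃ n, d = n + 1 := Nat.exists_eq_succ_of_ne_zero (NeZero.ne d)
  have hdn : (d : ℝ) - 1 = n := by rw [hn]; push_cast; ring
  have hdn' : d - 1 = n := by omega
  rw [hdn']
  set b : ℝ := n / 2 with hb
  set c : ℝ := |b * (b - 1)| with hc
  set z : ℝ → ℝ := fun r => sphereProfileDeriv d r + b * (sphereProfile d r / r) with hz
  set Q : ℝ → ℝ := fun r => r ^ n * (sphereProfile d r ^ 2 + z r ^ 2) with hQ
  have hzd : ∀ r, 0 < r → HasDerivAt z
      (-sphereProfile d r - b / r * z r + b * (b - 1) * sphereProfile d r / r ^ 2) r := by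
    intro r hr
    have h := (hasDerivAt_sphereProfileDeriv (d := d) r).add
      (((hasDerivAt_sphereProfile (d := d) r).div (hasDerivAt_id r) hr.ne').const_mul b)
    refine HasDerivAt.congr_deriv h ?_
    have ode := sphereProfile_ode (d := d) r
    rw [hdn] at ode
    have h2 : sphereProfileDeriv2 d r = -(n : ℝ) * sphereProfileDeriv d r / r - sphereProfile d r := by
      field_simp
      linarith
    simp only [hz, id, h2]
    have hn2 : (n : ℝ) = 2 * b := by rw [hb]; ring
    rw [hn2]
    field_simp
    ring
  have hQd : ∀ r, 0 < r → HasDerivAt Q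
      (r ^ n * (2 * (b * (b - 1)) * sphereProfile d r * z r / r ^ 2)) r := by
    intro r hr
    have h := (hasDerivAt_pow n r).mul (((hasDerivAt_sphereProfile (d := d) r).pow 2).add
      ((hzd r hr).pow 2))
    refine HasDerivAt.congr_deriv h ?_
    have hU : sphereProfileDeriv d r = z r - b * (sphereProfile d r / r) := by simp [hz]
    have hn2 : (n : ℝ) = 2 * b := by rw [hb]; ring
    have hp : (n : ℝ) * r ^ (n - 1) = 2 * b * (r ^ n / r) := by
      rcases Nat.eq_zero_or_pos n with h0 | h0
      · rw [← hn2, h0]; simp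
      · rw [← hn2]
        congr 1
        rw [eq_div_iff hr.ne', ← pow_succ, Nat.sub_add_cancel h0]
    simp only [Pi.add_apply, Pi.pow_apply, Nat.cast_ofNat]
    rw [hp, hU]
    field_simp
    ring
  -- The exponential is the integrating factor for |Q'| ≤ c Q / r²; it makes `H` nonincreasing on
  -- [1, ∞) and is at least 1, so `Q` stays below `H 1`.
  set H : ℝ → ℝ := fun r => Q r * Real.exp (c / r) with hH
  have hHd : ∀ r, 0 < r → HasDerivAt H
      (r ^ n * (2 * (b * (b - 1)) * sphereProfile d r * z r / r ^ 2) * Real.exp (c / r) +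
        Q r * (Real.exp (c / r) * (-c / r ^ 2))) r := by
    intro r hr
    have h := (hQd r hr).mul (((hasDerivAt_const r c).div (hasDerivAt_id r) hr.ne').exp)
    refine HasDerivAt.congr_deriv h ?_
    simp only [id, Pi.div_apply]
    ring
  have hanti : AntitoneOn H (Ici 1) := by
    refine antitoneOn_of_deriv_nonpos (convex_Ici 1)
      (fun r hr => (hHd r (zero_lt_one.trans_le hr)).continuousAt.continuousWithinAt) ?_ ?_
    · intro r hr
      rw [interior_Ici] at hr
      exact (hHd r (zero_lt_one.trans hr)).differentiableAt.differentiableWithinAt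
    · intro r hr
      rw [interior_Ici] at hr
      have hr0 : 0 < r := zero_lt_one.trans hr
      rw [(hHd r hr0).deriv]
      have key : 2 * (b * (b - 1)) * sphereProfile d r * z r ≤
          c * (sphereProfile d r ^ 2 + z r ^ 2) := by
        have h1 : b * (b - 1) ≤ c := le_abs_self _
        have h2 : -c ≤ b * (b - 1) := neg_abs_le _
        nlinarith [sq_nonneg (sphereProfile d r + z r), sq_nonneg (sphereProfile d r - z r)]
      have : r ^ n * (2 * (b * (b - 1)) * sphereProfile d r * z r / r ^ 2) * Real.exp (c / r) +
        Q r * (Real.exp (c / r) * (-c / r ^ 2)) = -(r ^ n * Real.exp (c / r) / r ^ 2 *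
          (c * (sphereProfile d r ^ 2 + z r ^ 2) - 2 * (b * (b - 1)) * sphereProfile d r * z r)) := by
        simp only [hQ]; ring
      rw [this, neg_nonpos]
      exact mul_nonneg (by positivity) (by linarith)
  set M : ℝ := H 1 with hM
  have hQM : ∀ r, 1 ≤ r → Q r ≤ M := by
    intro r hr
    have h1 := hanti (mem_Ici.2 le_rfl) (mem_Ici.2 hr) hr
    have hQ0 : 0 ≤ Q r := by simp only [hQ]; positivity
    refine le_trans ?_ h1
    simp only [hH]
    exact le_mul_of_one_le_right hQ0 (Real.one_le_exp (by positivity))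
  have hM0 : 0 ≤ M := by simp only [hM, hH, hQ]; positivity
  refine ⟨1 + 2 * M + 2 * b ^ 2 * M, by positivity, fun r hr => ?_⟩
  rcases le_or_gt r 1 with h1 | h1
  · have hrn : r ^ n ≤ 1 := pow_le_one₀ hr h1
    have hrn0 : 0 ≤ r ^ n := by positivity
    have hU : sphereProfile d r ^ 2 ≤ 1 := (sq_le_one_iff_abs_le_one _).2 (abs_sphereProfile_le_one r)
    have hU1 : sphereProfileDeriv d r ^ 2 ≤ 1 :=
      (sq_le_one_iff_abs_le_one _).2 (abs_sphereProfileDeriv_le_one r)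
    have : 0 ≤ 2 * M + 2 * b ^ 2 * M := by positivity
    constructor
    · nlinarith [mul_le_one₀ hrn (sq_nonneg _) hU]
    · nlinarith [mul_le_one₀ hrn (sq_nonneg _) hU1]
  · have hr0 : 0 < r := by linarith
    have hq := hQM r h1.le
    simp only [hQ] at hq
    have hrn0 : 0 ≤ r ^ n := by positivity
    have e1 : r ^ n * sphereProfile d r ^ 2 ≤ M := by nlinarith [mul_nonneg hrn0 (sq_nonneg (z r))]
    have e2 : r ^ n * z r ^ 2 ≤ M := by
      nlinarith [mul_nonneg hrn0 (sq_nonneg (sphereProfile d r))]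
    have : 0 ≤ 2 * b ^ 2 * M := by positivity
    refine ⟨by linarith, ?_⟩
    have hU : sphereProfileDeriv d r = z r - b * (sphereProfile d r / r) := by simp [hz]
    have hdiv : (sphereProfile d r / r) ^ 2 ≤ sphereProfile d r ^ 2 := by
      rw [div_pow]
      exact div_le_self (sq_nonneg _) (one_le_pow₀ h1.le)
    have h3 : sphereProfileDeriv d r ^ 2 ≤ 2 * z r ^ 2 + 2 * b ^ 2 * sphereProfile d r ^ 2 := by
      rw [hU]
      nlinarith [sq_nonneg (z r + b * (sphereProfile d r / r)),
        mul_le_mul_of_nonneg_left hdiv (sq_nonneg b)]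
    nlinarith [mul_le_mul_of_nonneg_left h3 hrn0, sq_nonneg b,
      mul_le_mul_of_nonneg_left e1 (sq_nonneg b)]

variable (d) in
lemma exists_sphereProfile_bound : ∃ C : ℝ, 0 < C ∧ ∀ r, 0 < r →
    |sphereProfile d r| ≤ C * r ^ (-(((d : ℝ) - 1) / 2)) ∧
    |sphereProfileDeriv d r| ≤ C * r ^ (-(((d : ℝ) - 1) / 2)) := by
  obtain ⟨C, hC, h⟩ := exists_sphereProfile_sq_bound (d := d)
  refine ⟨√C, Real.sqrt_pos.2 hC, fun r hr => ?_⟩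
  have key : ∀ x : ℝ, r ^ (d - 1) * x ^ 2 ≤ C → |x| ≤ √C * r ^ (-(((d : ℝ) - 1) / 2)) := by
    intro x hx
    refine abs_le_of_sq_le_sq ?_ (by positivity)
    have e : (r ^ (-(((d : ℝ) - 1) / 2))) ^ 2 = (r ^ (d - 1))⁻¹ := by
      rw [← Real.rpow_natCast, ← Real.rpow_mul hr.le, ← Real.rpow_natCast, ← Real.rpow_neg hr.le,
        Nat.cast_sub (Nat.one_le_iff_ne_zero.2 (NeZero.ne d))]
      congr 1
      push_cast
      ring
    rw [mul_pow, Real.sq_sqrt hC.le, e, ← div_eq_mul_inv, le_div_iff₀ (by positivity)]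
    linarith
  exact ⟨key _ (h r hr.le).1, key _ (h r hr.le).2⟩

open Real FourierTransform in
/-- The Fourier transform of the spherical measure. -/
lemma integral_sphere_fourierChar (ξ : 𝔼) (t : ℝ) :
    ∫ y : sphere (0 : 𝔼) 1, (𝐞 (inner ℝ (t • (y : 𝔼)) ξ) : ℂ) ∂(sphereMeasure d) =
      (sphereProfile d (2 * π * t * ‖ξ‖) : ℂ) := by
  set e : 𝔼 := EuclideanSpace.single 0 1 with he
  have hnorm : ‖(‖ξ‖ • e)‖ = ‖ξ‖ := by simp [norm_smul, he]
  -- Reflecting ξ onto the first axis reduces the phase to a multiple of the coordinate y_0; the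
  -- sine part then vanishes by oddness.
  set L := (ℝ ∙ (‖ξ‖ • e - ξ))ᗮ.reflection
  have hL : L (‖ξ‖ • e) = ξ := Submodule.reflection_sub hnorm
  rw [← integral_sphere_comp_isometry L (fun y : 𝔼 => (𝐞 (inner ℝ (t • y) ξ) : ℂ))]
  have hin : ∀ y : 𝔼, inner ℝ (t • L y) ξ = t * ‖ξ‖ * y 0 := by
    intro y
    nth_rewrite 1 [← hL]
    rw [inner_smul_left, L.inner_map_map, inner_smul_right, he, EuclideanSpace.inner_single_right]
    simp
    ring
  simp_rw [hin]
  have hsplit : ∀ s : ℝ, (𝐞 s : ℂ) = ((Real.cos (2 * π * s) : ℝ) : ℂ) +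
      ((Real.sin (2 * π * s) : ℝ) : ℂ) * Complex.I := by
    intro s
    rw [Real.fourierChar_apply, Complex.exp_mul_I]
    push_cast
    rfl
  simp_rw [hsplit]
  rw [integral_add (integrable_sphere_of_continuous (by fun_prop))
    (integrable_sphere_of_continuous (by fun_prop)), integral_mul_const, integral_complex_ofReal,
    integral_complex_ofReal]
  have hodd : ∫ y : sphere (0 : 𝔼) 1, Real.sin (2 * π * (t * ‖ξ‖ * (y : 𝔼) 0)) ∂(sphereMeasure d)
      = 0 := by
    have h := integral_sphere_comp_isometry (LinearIsometryEquiv.neg ℝ)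
      (fun y : 𝔼 => Real.sin (2 * π * (t * ‖ξ‖ * y 0)))
    simp only [LinearIsometryEquiv.coe_neg, PiLp.neg_apply, mul_neg, Real.sin_neg,
      integral_neg] at h
    linarith
  rw [hodd, sphereProfile]
  simp only [Complex.ofReal_zero, zero_mul, add_zero]
  congr 2
  ext y
  ring_nf

end Bessel
end SphericalMax

namespace SphericalMax

/-! ### Plancherel, and the T T* inequality for families of multipliers. -/

section Fourier

open Real FourierTransform SchwartzMap ComplexConjugate

variable {V : Type*} [NormedAddCommGroup V] [InnerProductSpace ℝ V] [MeasurableSpace V]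
  [BorelSpace V] [FiniteDimensional ℝ V]

lemma integral_fourier_mul_eq {f g : V → ℂ} (hf : Integrable f) (hg : Integrable g) :
    ∫ ξ, 𝓕 f ξ * g ξ = ∫ x, f x * 𝓕 g x := by
  have h := VectorFourier.integral_fourierIntegral_smul_eq_flip (L := innerₗ V) (μ := volume)
    (ν := volume) Real.continuous_fourierChar continuous_inner hf hg
  rw [flip_innerₗ] at h
  exact h

/-- The `L²` Fourier transform agrees with the Fourier integral of integrable functions. -/
lemma ae_eq_fourier_of_integrable_of_memLp {g : V → ℂ} (hg : Integrable g) (hg2 : MemLp g 2) :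
    𝓕 g =ᵐ[volume] (𝓕 (hg2.toLp g) : Lp (α := V) ℂ 2) := by
  have hcont : Continuous (𝓕 g) :=
    VectorFourier.fourierIntegral_continuous Real.continuous_fourierChar continuous_inner hg
  -- Both sides are tested against smooth functions of compact support; the multiplication formula
  -- moves either transform onto the test function.
  refine ae_eq_of_integral_contDiff_smul_eq hcont.locallyIntegrable
    ((Lp.memLp _).locallyIntegrable (by norm_num)) fun φ hφ hφc => ?_
  have hφ' : ContDiff ℝ ((⊤ : ℕ∞) : WithTop ℕ∞) (fun x => (φ x : ℂ)) := Complex.ofRealCLM.contDiff.comp hφ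
  have hφc' : HasCompactSupport (fun x => (φ x : ℂ)) := hφc.comp_left Complex.ofReal_zero
  set Φ : 𝓢(V, ℂ) := hφc'.toSchwartzMap hφ' with hΦ
  have h := congrArg (fun T => T Φ) (Lp.fourier_toTemperedDistribution_eq (hg2.toLp g))
  simp only [TemperedDistribution.fourier_apply, Lp.toTemperedDistribution_apply] at h
  have e1 : ∫ x, (𝓕 Φ) x • (hg2.toLp g) x = ∫ x, φ x • 𝓕 g x := by
    have e2 : ∫ x, (𝓕 Φ) x • (hg2.toLp g) x = ∫ x, 𝓕 (Φ : V → ℂ) x * g x := by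
      refine integral_congr_ae ?_
      filter_upwards [hg2.coeFn_toLp] with x hx
      rw [hx, SchwartzMap.fourier_coe]
      rfl
    rw [e2, integral_fourier_mul_eq Φ.integrable hg]
    rfl
  rw [← e1, h]
  rfl

lemma memLp_fourier {g : V → ℂ} (hg : Integrable g) (hg2 : MemLp g 2) : MemLp (𝓕 g) 2 :=
  (memLp_congr_ae (ae_eq_fourier_of_integrable_of_memLp hg hg2)).2 (Lp.memLp _)

lemma integral_norm_sq_fourier {g : V → ℂ} (hg : Integrable g) (hg2 : MemLp g 2) :
    ∫ ξ, ‖𝓕 g ξ‖ ^ 2 = ∫ x, ‖g x‖ ^ 2 := by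
  have key : ∀ {h : V → ℂ} (hh : MemLp h 2), ∫ x, ‖h x‖ ^ 2 = (eLpNorm h 2 volume).toReal ^ 2 := by
    intro h hh
    rw [hh.eLpNorm_eq_integral_rpow_norm two_ne_zero ENNReal.ofNat_ne_top,
      ENNReal.toReal_ofReal (by positivity)]
    simp only [ENNReal.toReal_ofNat, Real.rpow_two]
    rw [← Real.rpow_natCast, ← Real.rpow_mul (integral_nonneg fun x => by positivity)]
    norm_num
  rw [key (memLp_fourier hg hg2), key hg2, eLpNorm_congr_ae (ae_eq_fourier_of_integrable_of_memLp hg hg2)]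
  congr 1
  have h := Lp.norm_fourier_eq (hg2.toLp g)
  rw [Lp.norm_def, Lp.norm_toLp] at h
  exact h

lemma integral_fourierInv_mul_eq {f g : V → ℂ} (hf : Integrable f) (hg : Integrable g) :
    ∫ ξ, 𝓕⁻ f ξ * g ξ = ∫ x, f x * 𝓕⁻ g x := by
  have h1 : ∫ ξ, 𝓕⁻ f ξ * g ξ = ∫ ξ, 𝓕 f ξ * g (-ξ) := by
    rw [← integral_neg_eq_self (fun ξ => 𝓕 f ξ * g (-ξ))]
    simp [fourierInv_eq_fourier_neg]
  rw [h1, integral_fourier_mul_eq hf hg.comp_neg]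
  simp [fourierInv_eq_fourier_comp_neg]

lemma memLp_fourierInv {g : V → ℂ} (hg : Integrable g) (hg2 : MemLp g 2) : MemLp (𝓕⁻ g) 2 := by
  have : 𝓕⁻ g = 𝓕 g ∘ Neg.neg := by ext; simp [fourierInv_eq_fourier_neg]
  rw [this]
  exact (memLp_fourier hg hg2).comp_measurePreserving (Measure.measurePreserving_neg volume)

lemma integral_norm_sq_fourierInv {g : V → ℂ} (hg : Integrable g) (hg2 : MemLp g 2) :
    ∫ ξ, ‖𝓕⁻ g ξ‖ ^ 2 = ∫ x, ‖g x‖ ^ 2 := by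
  simp_rw [fourierInv_eq_fourier_neg]
  rw [integral_neg_eq_self (fun ξ => ‖𝓕 g ξ‖ ^ 2), integral_norm_sq_fourier hg hg2]

lemma norm_fourierInv_le (f : V → ℂ) (x : V) : ‖𝓕⁻ f x‖ ≤ ∫ ξ, ‖f ξ‖ := by
  rw [fourierInv_eq_fourier_neg]
  exact VectorFourier.norm_fourierIntegral_le_integral_norm _ _ _ _ _

lemma norm_fourier_le (f : V → ℂ) (x : V) : ‖𝓕 f x‖ ≤ ∫ ξ, ‖f ξ‖ :=
  VectorFourier.norm_fourierIntegral_le_integral_norm _ _ _ _ _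

lemma continuous_fourier {f : V → ℂ} (hf : Integrable f) : Continuous (𝓕 f) :=
  VectorFourier.fourierIntegral_continuous Real.continuous_fourierChar continuous_inner hf

lemma continuous_fourierInv {f : V → ℂ} (hf : Integrable f) : Continuous (𝓕⁻ f) := by
  have : 𝓕⁻ f = 𝓕 f ∘ Neg.neg := by ext; simp [fourierInv_eq_fourier_neg]
  rw [this]
  exact (continuous_fourier hf).comp continuous_neg

lemma conj_fourierInv (g : V → ℂ) (ξ : V) : conj (𝓕⁻ g ξ) = 𝓕 (fun x => conj (g x)) ξ := by
  rw [fourierInv_eq, fourier_eq, ← integral_conj]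
  congr with v
  simp [Circle.smul_def, AddChar.map_neg_eq_inv]

/-- A bilinear form with multiplier `ρ` is bounded on `L¹ × L¹` by the supremum of its kernel. -/
lemma norm_integral_mul_fourierInv_le {ρ g₁ g₂ : V → ℂ} (hρ : Integrable ρ) (hg₁ : Integrable g₁)
    (hg₂ : Integrable g₂) {K : ℝ} (hK : ∀ z, ‖𝓕⁻ ρ z‖ ≤ K) :
    ‖∫ ξ, ρ ξ * (𝓕⁻ g₁ ξ * conj (𝓕⁻ g₂ ξ))‖ ≤ K * (∫ x, ‖g₁ x‖) * ∫ x, ‖g₂ x‖ := by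
  have hint : Integrable (fun ξ => ρ ξ * conj (𝓕⁻ g₂ ξ)) := by
    refine hρ.mul_bdd (c := ∫ x, ‖g₂ x‖)
      (Complex.continuous_conj.comp (continuous_fourierInv hg₂)).aestronglyMeasurable ?_
    filter_upwards with ξ
    simpa using norm_fourierInv_le g₂ ξ
  have h1 : ∫ ξ, ρ ξ * (𝓕⁻ g₁ ξ * conj (𝓕⁻ g₂ ξ)) =
      ∫ x, g₁ x * 𝓕⁻ (fun ξ => ρ ξ * conj (𝓕⁻ g₂ ξ)) x := by
    rw [← integral_fourierInv_mul_eq hg₁ hint]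
    congr with ξ
    ring
  -- The function on the left is the convolution of conj g₂ with the kernel 𝓕⁻ ρ.
  have h2 : ∀ x, ‖𝓕⁻ (fun ξ => ρ ξ * conj (𝓕⁻ g₂ ξ)) x‖ ≤ K * ∫ y, ‖g₂ y‖ := by
    intro x
    have hρx : Integrable (fun ξ => 𝐞 (inner ℝ ξ x) • ρ ξ) := by
      refine hρ.mono ?_ (Filter.Eventually.of_forall fun ξ => by simp)
      exact (Real.continuous_fourierChar.comp (by fun_prop)).aestronglyMeasurable.smul hρ.1
    have e1 : 𝓕⁻ (fun ξ => ρ ξ * conj (𝓕⁻ g₂ ξ)) x =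
        ∫ y, conj (g₂ y) * 𝓕⁻ ρ (x - y) := by
      have hflip := integral_fourier_mul_eq (f := fun y => conj (g₂ y))
        ((LinearIsometryEquiv.integrable_comp_iff (φ := g₂) Complex.conjLIE).2 hg₂) hρx
      have : ∀ y, 𝓕⁻ ρ (x - y) = 𝓕 (fun ξ => 𝐞 (inner ℝ ξ x) • ρ ξ) y := by
        intro y
        rw [fourierInv_eq, fourier_eq]
        congr with ξ
        rw [smul_smul, ← AddChar.map_add_eq_mul, inner_sub_right]
        ring_nf
      simp_rw [this]
      rw [← hflip, fourierInv_eq]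
      congr with ξ
      rw [conj_fourierInv]
      simp only [Circle.smul_def, smul_eq_mul]
      ring
    rw [e1, ← integral_const_mul]
    refine norm_integral_le_of_norm_le (hg₂.norm.const_mul K) (Filter.Eventually.of_forall fun y => ?_)
    rw [norm_mul, RCLike.norm_conj, mul_comm]
    exact mul_le_mul_of_nonneg_right (hK _) (norm_nonneg _)
  rw [h1]
  calc ‖∫ x, g₁ x * 𝓕⁻ (fun ξ => ρ ξ * conj (𝓕⁻ g₂ ξ)) x‖
      ≤ ∫ x, ‖g₁ x‖ * (K * ∫ y, ‖g₂ y‖) := by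
        refine norm_integral_le_of_norm_le (hg₁.norm.mul_const _) (Filter.Eventually.of_forall fun x => ?_)
        rw [norm_mul]
        exact mul_le_mul_of_nonneg_left (h2 x) (norm_nonneg _)
    _ = _ := by rw [integral_mul_const]; ring

lemma integral_mul_le_sqrt_mul_sqrt {f g : V → ℂ} (hf : MemLp f 2) (hg : MemLp g 2) :
    ∫ x, ‖f x‖ * ‖g x‖ ≤ √(∫ x, ‖f x‖ ^ 2) * √(∫ x, ‖g x‖ ^ 2) := by
  have h := integral_mul_norm_le_Lp_mul_Lq (f := f) (g := g) (μ := volume)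
    (Real.HolderConjugate.two_two) (by simpa using hf) (by simpa using hg)
  simpa [Real.sqrt_eq_rpow] using h

/-- The dual (`T T^*`) form of an `L²` estimate for a finite family of Fourier multipliers
evaluated on sets of finite measure. -/
lemma sq_sum_setIntegral_multiplier_le {ι : Type*} (S : Finset ι) (m : ι → V → ℝ)
    (hmc : ∀ n, Continuous (m n)) (hmi : ∀ n, Integrable (m n)) {Y : ℝ} (hY : ∀ n ξ, m n ξ ^ 2 ≤ Y)
    {K : ι → ι → ℝ} (hK : ∀ n n' z, ‖𝓕⁻ (fun ξ => ((m n ξ * m n' ξ : ℝ) : ℂ)) z‖ ≤ K n n')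
    {f : V → ℂ} (hf : Integrable f) (hf2 : MemLp f 2)
    {G : ι → Set V} (hG : ∀ n, MeasurableSet (G n)) (hGfin : ∀ n, volume (G n) ≠ ∞) :
    (∑ n ∈ S, ∫ x in G n, ‖𝓕⁻ (fun ξ => (m n ξ : ℂ) * 𝓕 f ξ) x‖) ^ 2 ≤
      (∫ x, ‖f x‖ ^ 2) * ∑ n ∈ S, ∑ n' ∈ S,
        min (K n n' * volume.real (G n) * volume.real (G n'))
          (Y * ((volume.real (G n) + volume.real (G n')) / 2)) := by
  have hmC : ∀ n, Integrable (fun ξ => (m n ξ : ℂ)) := fun n => (hmi n).ofReal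
  have hmf : ∀ n, Integrable (fun ξ => (m n ξ : ℂ) * 𝓕 f ξ) := fun n =>
    (hmC n).mul_bdd (c := ∫ x, ‖f x‖) (continuous_fourier hf).aestronglyMeasurable
      (Filter.Eventually.of_forall fun ξ => norm_fourier_le f ξ)
  set T : ι → V → ℂ := fun n => 𝓕⁻ (fun ξ => (m n ξ : ℂ) * 𝓕 f ξ) with hT
  have hTc : ∀ n, Continuous (T n) := fun n => continuous_fourierInv (hmf n)
  -- The conjugate phase of T n f, cut off to `G n`, linearizes the L¹ norm. Where T n f vanishes
  -- the quotient is 0, which is harmless.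
  set g : ι → V → ℂ := fun n => (G n).indicator fun x => conj (T n x) / ‖T n x‖ with hg
  have hgm : ∀ n, Measurable (g n) := fun n => by
    refine Measurable.indicator ?_ (hG n)
    exact (Complex.continuous_conj.measurable.comp (hTc n).measurable).div
      (Complex.measurable_ofReal.comp (hTc n).norm.measurable)
  have hgb : ∀ n x, ‖g n x‖ ≤ (G n).indicator (fun _ => (1 : ℝ)) x := by
    intro n x
    simp only [hg, indicator]
    split_ifs with hx
    · rw [norm_div, RCLike.norm_conj, Complex.norm_real, norm_norm]
      exact div_self_le_one _
    · simp
  have hind : ∀ n, Integrable ((G n).indicator (fun _ => (1 : ℝ))) := fun n =>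
    (integrable_indicator_iff (hG n)).2 (integrableOn_const (hGfin n))
  have hgi : ∀ n, Integrable (g n) := fun n =>
    (hind n).mono' (hgm n).aestronglyMeasurable (Filter.Eventually.of_forall (hgb n))
  have hgb1 : ∀ n x, ‖g n x‖ ≤ 1 := fun n x => (hgb n x).trans (indicator_le_self' (by simp) x)
  have hg2 : ∀ n, MemLp (g n) 2 := fun n => by
    refine (memLp_two_iff_integrable_sq_norm (hgm n).aestronglyMeasurable).2 ?_
    refine (hgi n).norm.mono' ((hgm n).norm.pow_const 2).aestronglyMeasurable
      (Filter.Eventually.of_forall fun x => ?_)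
    rw [Real.norm_of_nonneg (by positivity)]
    nlinarith [hgb1 n x, norm_nonneg (g n x)]
  have hI1 : ∀ n, ∫ x, ‖g n x‖ ≤ volume.real (G n) := fun n => by
    refine (integral_mono (hgi n).norm (hind n) (hgb n)).trans_eq ?_
    rw [integral_indicator (hG n)]; simp
  have hI2 : ∀ n, ∫ x, ‖g n x‖ ^ 2 ≤ volume.real (G n) := fun n => by
    refine le_trans (integral_mono ((memLp_two_iff_integrable_sq_norm (hg2 n).1).1 (hg2 n)) (hgi n).norm fun x => ?_) (hI1 n)
    simp only
    nlinarith [hgb1 n x, norm_nonneg (g n x)]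
  have hpair : ∀ n, ((∫ x in G n, ‖T n x‖ : ℝ) : ℂ) = ∫ ξ, 𝓕 f ξ * ((m n ξ : ℂ) * 𝓕⁻ (g n) ξ) := by
    intro n
    have h := integral_fourierInv_mul_eq (hmf n) (hgi n)
    have e : ∫ ξ, 𝓕 f ξ * ((m n ξ : ℂ) * 𝓕⁻ (g n) ξ) =
        ∫ x, (m n x : ℂ) * 𝓕 f x * 𝓕⁻ (g n) x := by
      congr with ξ; ring
    rw [e, ← h, ← integral_complex_ofReal, ← integral_indicator (hG n)]
    congr with x
    simp only [hg, indicator]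
    split_ifs with hx
    · change _ = T n x * _
      rcases eq_or_ne (T n x) 0 with h0 | h0
      · simp [h0]
      · have : (‖T n x‖ : ℂ) ≠ 0 := by simpa using h0
        field_simp
        rw [Complex.mul_conj, Complex.normSq_eq_norm_sq]
        push_cast
        rfl
    · simp
  -- By duality the whole sum is the pairing of 𝓕 f with `h`. Cauchy–Schwarz splits off ‖f‖₂, and
  -- ‖h‖₂² expands into pairs (n, n').
  set h : V → ℂ := fun ξ => ∑ n ∈ S, (m n ξ : ℂ) * 𝓕⁻ (g n) ξ with hh
  have hmg2 : ∀ n, MemLp (fun ξ => (m n ξ : ℂ) * 𝓕⁻ (g n) ξ) 2 := fun n => by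
    refine (memLp_fourierInv (hgi n) (hg2 n)).of_le_mul (c := √Y)
      ((Complex.continuous_ofReal.comp (hmc n)).mul
        (continuous_fourierInv (hgi n))).aestronglyMeasurable (Filter.Eventually.of_forall fun ξ => ?_)
    rw [norm_mul, Complex.norm_real]
    exact mul_le_mul_of_nonneg_right (Real.abs_le_sqrt (hY n ξ)) (norm_nonneg _)
  have hh2 : MemLp h 2 := memLp_finsetSum S fun n _ => hmg2 n
  have hf2' := memLp_fourier hf hf2
  have hsum : ∑ n ∈ S, ∫ x in G n, ‖T n x‖ ≤ √(∫ x, ‖f x‖ ^ 2) * √(∫ ξ, ‖h ξ‖ ^ 2) := by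
    have e : ((∑ n ∈ S, ∫ x in G n, ‖T n x‖ : ℝ) : ℂ) = ∫ ξ, 𝓕 f ξ * h ξ := by
      push_cast
      simp_rw [hpair, hh, Finset.mul_sum]
      rw [integral_finsetSum]
      exact fun n _ => hf2'.integrable_mul (hmg2 n)
    have hn : ∑ n ∈ S, ∫ x in G n, ‖T n x‖ = ‖∫ ξ, 𝓕 f ξ * h ξ‖ := by
      rw [← e, Complex.norm_real, Real.norm_of_nonneg]
      exact Finset.sum_nonneg fun n _ => integral_nonneg fun x => norm_nonneg _
    rw [hn, ← integral_norm_sq_fourier hf hf2]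
    refine (norm_integral_le_integral_norm _).trans ?_
    simp_rw [norm_mul]
    exact integral_mul_le_sqrt_mul_sqrt hf2' hh2
  have hsq : ∫ ξ, ‖h ξ‖ ^ 2 ≤ ∑ n ∈ S, ∑ n' ∈ S,
        min (K n n' * volume.real (G n) * volume.real (G n'))
          (Y * ((volume.real (G n) + volume.real (G n')) / 2)) := by
    have hint : ∀ n n', Integrable (fun ξ => ((m n ξ * m n' ξ : ℝ) : ℂ) *
        (𝓕⁻ (g n) ξ * conj (𝓕⁻ (g n') ξ))) := by
      intro n n'
      have hc : MemLp (fun ξ => conj ((m n' ξ : ℂ) * 𝓕⁻ (g n') ξ)) 2 :=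
        (hmg2 n').of_le (Complex.continuous_conj.comp_aestronglyMeasurable (hmg2 n').1)
          (Filter.Eventually.of_forall fun ξ => by rw [RCLike.norm_conj])
      refine ((hmg2 n).integrable_mul hc).congr (Filter.Eventually.of_forall fun ξ => ?_)
      simp only [Pi.mul_apply, map_mul, Complex.conj_ofReal]
      push_cast
      ring
    have e : ((∫ ξ, ‖h ξ‖ ^ 2 : ℝ) : ℂ) = ∑ n ∈ S, ∑ n' ∈ S,
        ∫ ξ, ((m n ξ * m n' ξ : ℝ) : ℂ) * (𝓕⁻ (g n) ξ * conj (𝓕⁻ (g n') ξ)) := by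
      have e1 : ∀ n ∈ S, ∑ n' ∈ S,
          ∫ ξ, ((m n ξ * m n' ξ : ℝ) : ℂ) * (𝓕⁻ (g n) ξ * conj (𝓕⁻ (g n') ξ)) =
          ∫ ξ, ∑ n' ∈ S, ((m n ξ * m n' ξ : ℝ) : ℂ) * (𝓕⁻ (g n) ξ * conj (𝓕⁻ (g n') ξ)) :=
        fun n _ => (integral_finsetSum _ fun n' _ => hint n n').symm
      rw [Finset.sum_congr rfl e1, ← integral_finsetSum _ fun n _ =>
        integrable_finsetSum _ fun n' _ => hint n n', ← integral_complex_ofReal]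
      congr with ξ
      rw [Complex.ofReal_pow, ← Complex.mul_conj', hh, map_sum, Finset.sum_mul_sum]
      refine Finset.sum_congr rfl fun n _ => Finset.sum_congr rfl fun n' _ => ?_
      rw [map_mul, Complex.conj_ofReal]
      push_cast
      ring
    have e' : ∫ ξ, ‖h ξ‖ ^ 2 = ‖((∫ ξ, ‖h ξ‖ ^ 2 : ℝ) : ℂ)‖ := by
      rw [Complex.norm_real, Real.norm_of_nonneg (integral_nonneg fun x => by positivity)]
    rw [e', e]
    -- Each pair is bounded in two ways: by the supremum of the kernel on L¹ × L¹, and by the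
    -- supremum of the multiplier on L² × L² followed by 2xy ≤ x² + y².
    refine (norm_sum_le _ _).trans (Finset.sum_le_sum fun n _ =>
      (norm_sum_le _ _).trans (Finset.sum_le_sum fun n' _ => le_min ?_ ?_))
    · have hρ : Integrable (fun ξ => ((m n ξ * m n' ξ : ℝ) : ℂ)) := by
        refine Integrable.ofReal ?_
        refine (hmi n).mul_bdd (c := √Y) (hmc n').aestronglyMeasurable
          (Filter.Eventually.of_forall fun ξ => Real.abs_le_sqrt (hY n' ξ))
      have hK0 : 0 ≤ K n n' := (norm_nonneg _).trans (hK n n' 0)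
      refine (norm_integral_mul_fourierInv_le hρ (hgi n) (hgi n') (hK n n')).trans ?_
      gcongr
      · exact hI1 n
      · exact hI1 n'
    · have hi1 := (memLp_two_iff_integrable_sq_norm (memLp_fourierInv (hgi n) (hg2 n)).1).1
        (memLp_fourierInv (hgi n) (hg2 n))
      have hi2 := (memLp_two_iff_integrable_sq_norm (memLp_fourierInv (hgi n') (hg2 n')).1).1
        (memLp_fourierInv (hgi n') (hg2 n'))
      have hY0 : 0 ≤ Y := (sq_nonneg _).trans (hY n 0)
      calc _ ≤ ∫ ξ, Y * ((‖𝓕⁻ (g n) ξ‖ ^ 2 + ‖𝓕⁻ (g n') ξ‖ ^ 2) / 2) := by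
            refine norm_integral_le_of_norm_le (((hi1.add hi2).div_const 2).const_mul Y)
              (Filter.Eventually.of_forall fun ξ => ?_)
            rw [norm_mul, norm_mul, RCLike.norm_conj, Complex.norm_real, Real.norm_eq_abs]
            have a1 : |m n ξ * m n' ξ| ≤ Y := by
              rw [abs_le]
              constructor <;> nlinarith [hY n ξ, hY n' ξ, sq_nonneg (m n ξ - m n' ξ),
                sq_nonneg (m n ξ + m n' ξ)]
            refine mul_le_mul a1 ?_ (by positivity) hY0
            nlinarith [sq_nonneg (‖𝓕⁻ (g n) ξ‖ - ‖𝓕⁻ (g n') ξ‖)]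
        _ = Y * ((∫ ξ, ‖𝓕⁻ (g n) ξ‖ ^ 2) + ∫ ξ, ‖𝓕⁻ (g n') ξ‖ ^ 2) / 2 := by
            rw [integral_const_mul, integral_div, integral_add hi1 hi2]; ring
        _ ≤ _ := by
            rw [integral_norm_sq_fourierInv (hgi n) (hg2 n),
              integral_norm_sq_fourierInv (hgi n') (hg2 n'), mul_div_assoc]
            gcongr
            · exact hI2 n
            · exact hI2 n'
  have hS0 : 0 ≤ ∑ n ∈ S, ∫ x in G n, ‖T n x‖ :=
    Finset.sum_nonneg fun n _ => integral_nonneg fun x => norm_nonneg _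
  have hf0 : 0 ≤ ∫ x, ‖f x‖ ^ 2 := integral_nonneg fun x => by positivity
  have hh0 : 0 ≤ ∫ x, ‖h x‖ ^ 2 := integral_nonneg fun x => by positivity
  calc _ ≤ (√(∫ x, ‖f x‖ ^ 2) * √(∫ ξ, ‖h ξ‖ ^ 2)) ^ 2 := by gcongr
    _ = (∫ x, ‖f x‖ ^ 2) * ∫ ξ, ‖h ξ‖ ^ 2 := by rw [mul_pow, Real.sq_sqrt hf0, Real.sq_sqrt hh0]
    _ ≤ _ := by gcongr

end Fourier
end SphericalMax

namespace SphericalMax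

/-! ### Counting grid radii, and the sum over pairs. -/

section Counting

/-- A covering by intervals of length `δ` realizing the bound on the interval count. -/
lemma exists_cover_of_assouadSup_le {γ : ℝ} {E : Set ℝ} {A : ℝ≥0} (hA : assouadSup γ E ≤ A)
    {δ : ℝ} (hδ : δ ∈ Ioo (0 : ℝ) 1) (a : ℝ) {ℓ : ℝ} (hℓ : ℓ ∈ Icc δ 1) :
    ∃ s : Finset ℝ, E ∩ Icc a (a + ℓ) ⊆ ⋃ c ∈ s, Icc c (c + δ) ∧
      (s.card : ℝ) ≤ A * (ℓ / δ) ^ γ := by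
  have hℓ0 : 0 < ℓ := hδ.1.trans_le hℓ.1
  have h1 : ENNReal.ofReal ((δ / ℓ) ^ γ) * (intervalCount (E ∩ Icc a (a + ℓ)) δ : ℝ≥0∞) ≤ A :=
    le_trans (le_iSup_of_le δ <| le_iSup_of_le hδ <| le_iSup_of_le a <| le_iSup_of_le ℓ <|
      le_iSup (fun _ : ℓ ∈ Icc δ 1 => ENNReal.ofReal ((δ / ℓ) ^ γ) *
        (intervalCount (E ∩ Icc a (a + ℓ)) δ : ℝ≥0∞)) hℓ) hA
  have hpos : 0 < (δ / ℓ) ^ γ := Real.rpow_pos_of_pos (div_pos hδ.1 hℓ0) _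
  have hne : intervalCount (E ∩ Icc a (a + ℓ)) δ ≠ ⊤ := by
    intro htop
    rw [htop] at h1
    have : ENNReal.ofReal ((δ / ℓ) ^ γ) * ((⊤ : ℕ∞) : ℝ≥0∞) = ∞ := by
      rw [ENat.toENNReal_top, ENNReal.mul_top (by simpa using hpos)]
    rw [this] at h1
    exact absurd h1 (by simp)
  obtain ⟨n, hn⟩ := ENat.ne_top_iff_exists.1 hne
  have hex : ∃ s : Finset ℝ, E ∩ Icc a (a + ℓ) ⊆ ⋃ c ∈ s, Icc c (c + δ) ∧ s.card ≤ n := by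
    by_contra! hcon
    have : ((n + 1 : ℕ) : ℕ∞) ≤ intervalCount (E ∩ Icc a (a + ℓ)) δ := by
      refine le_iInf₂ fun s hs => ?_
      exact_mod_cast hcon s hs
    rw [← hn] at this
    have h2 : n + 1 ≤ n := by exact_mod_cast this
    omega
  obtain ⟨s, hs, hcard⟩ := hex
  refine ⟨s, hs, ?_⟩
  rw [← hn] at h1
  have h2 : (δ / ℓ) ^ γ * n ≤ A := by
    have := ENNReal.toReal_mono ENNReal.coe_ne_top h1
    rw [ENNReal.toReal_mul, ENNReal.toReal_ofReal hpos.le] at this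
    simpa using this
  have h3 : (ℓ / δ) ^ γ = ((δ / ℓ) ^ γ)⁻¹ := by
    rw [← Real.inv_rpow (div_pos hδ.1 hℓ0).le, inv_div]
  rw [h3, ← div_eq_mul_inv, le_div_iff₀ hpos]
  calc (s.card : ℝ) * (δ / ℓ) ^ γ ≤ n * (δ / ℓ) ^ γ := by gcongr
    _ ≤ A := by linarith

/-- Radii whose grid index is within r of n₀ lie in an interval of length at most 3rδ, or simply in
[1,2] when 3rδ > 1. Covering it costs at most A(3r)^γ ≤ 3A r^γ intervals of length δ, each of which
meets at most two grid cells; hence the 6. -/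
lemma card_grid_le {γ : ℝ} (hγ0 : 0 ≤ γ) (hγ1 : γ ≤ 1) {E : Set ℝ} (hE : E ⊆ Icc 1 2) {A : ℝ≥0}
    (hA : assouadSup γ E ≤ A) {δ : ℝ} (hδ : δ ∈ Ioo (0 : ℝ) 1) (S : Finset ℤ)
    (hS : ∀ n ∈ S, ∃ t ∈ E, ⌊t / δ⌋ = n) (n₀ : ℤ) {r : ℝ} (hr : 1 ≤ r) :
    ((S.filter fun n : ℤ => |(n₀ : ℝ) - n| ≤ r).card : ℝ) ≤ 6 * A * r ^ γ := by
  have hδ0 := hδ.1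
  set S' := S.filter fun n : ℤ => |(n₀ : ℝ) - n| ≤ r with hS'
  obtain ⟨a, ℓ, hℓ, hℓr, hI⟩ : ∃ a ℓ : ℝ, ℓ ∈ Icc δ 1 ∧ ℓ / δ ≤ 3 * r ∧
      ∀ t ∈ E, |(n₀ : ℝ) - (⌊t / δ⌋ : ℤ)| ≤ r → t ∈ Icc a (a + ℓ) := by
    rcases le_or_gt (3 * r * δ) 1 with h | h
    · refine ⟨(n₀ - r) * δ, 3 * r * δ, ⟨by nlinarith, h⟩, by rw [mul_div_cancel_right₀ _ hδ0.ne'],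
        fun t _ ht => ?_⟩
      rw [abs_le] at ht
      have f1 := Int.floor_le (t / δ)
      have f2 := Int.lt_floor_add_one (t / δ)
      rw [le_div_iff₀ hδ0] at f1
      rw [div_lt_iff₀ hδ0] at f2
      constructor
      · nlinarith
      · nlinarith
    · refine ⟨1, 1, ⟨hδ.2.le, le_rfl⟩, ?_, fun t ht _ => ?_⟩
      · rw [div_le_iff₀ hδ0]; exact h.le
      · have := hE ht
        norm_num
        exact this
  obtain ⟨s, hs, hcard⟩ := exists_cover_of_assouadSup_le hA hδ a hℓ
  have hsub : S' ⊆ s.biUnion fun c => {⌊c / δ⌋, ⌊c / δ⌋ + 1} := by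
    intro n hn
    rw [hS', Finset.mem_filter] at hn
    obtain ⟨t, ht, rfl⟩ := hS n hn.1
    have h1 := hs ⟨ht, hI t ht hn.2⟩
    simp only [mem_iUnion, exists_prop] at h1
    obtain ⟨c, hc, hct⟩ := h1
    simp only [Finset.mem_biUnion, Finset.mem_insert, Finset.mem_singleton]
    refine ⟨c, hc, ?_⟩
    have e1 : c / δ ≤ t / δ := by gcongr; exact hct.1
    have e2 : t / δ ≤ c / δ + 1 := by
      rw [div_add_one hδ0.ne']; gcongr; exact hct.2
    have g1 : ⌊c / δ⌋ ≤ ⌊t / δ⌋ := Int.floor_le_floor e1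
    have g2 : ⌊t / δ⌋ ≤ ⌊c / δ⌋ + 1 := by
      rw [← Int.floor_add_one]; exact Int.floor_le_floor e2
    omega
  have hc1 : (S'.card : ℝ) ≤ s.card * 2 := by
    have h1 := (Finset.card_le_card hsub).trans (Finset.card_biUnion_le_card_mul s _ 2
      fun c _ => Finset.card_le_two)
    exact_mod_cast h1
  have hℓδ : 0 ≤ ℓ / δ := div_nonneg (hδ0.le.trans hℓ.1) hδ0.le
  have h3 : (ℓ / δ) ^ γ ≤ 3 * r ^ γ := by
    calc (ℓ / δ) ^ γ ≤ (3 * r) ^ γ := by gcongr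
      _ = 3 ^ γ * r ^ γ := Real.mul_rpow (by norm_num) (by linarith)
      _ ≤ 3 * r ^ γ := by
        gcongr
        calc (3 : ℝ) ^ γ ≤ 3 ^ (1 : ℝ) := Real.rpow_le_rpow_of_exponent_le (by norm_num) hγ1
          _ = 3 := Real.rpow_one 3
  have hA0 : (0 : ℝ) ≤ A := A.2
  calc (S'.card : ℝ) ≤ s.card * 2 := hc1
    _ ≤ (A * (ℓ / δ) ^ γ) * 2 := by gcongr
    _ ≤ (A * (3 * r ^ γ)) * 2 := by gcongr
    _ = _ := by ring

/-- Off-diagonal decay against growth of the number of neighbours, optimized over the splitting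
distance. -/
lemma sum_min_le {S : Finset ℤ} {a : ℤ → ℝ} (ha : ∀ n, 0 ≤ a n) {W X Y N b γ : ℝ} (hW : 0 < W)
    (haW : ∑ n ∈ S, a n ≤ W) (hX : 0 < X) (hY : 0 < Y) (hN : 0 ≤ N) (hb : 0 < b) (hγ : 0 ≤ γ)
    (hcount : ∀ n : ℤ, ∀ r : ℝ, 1 ≤ r →
      ((S.filter fun n' : ℤ => |(n : ℝ) - n'| ≤ r).card : ℝ) ≤ N * r ^ γ) :
    ∑ n ∈ S, ∑ n' ∈ S, min (X * (1 + |(n : ℝ) - n'|) ^ (-b) * a n * a n')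
      (Y * ((a n + a n') / 2)) ≤
      (1 + N) * ((X * W ^ 2) ^ (1 - b / (b + γ)) * (Y * W) ^ (b / (b + γ))) := by
  have hbγ : 0 < b + γ := by linarith
  set θ := b / (b + γ) with hθ
  have hθ0 : 0 < θ := div_pos hb hbγ
  have hθ1 : 1 - θ = γ / (b + γ) := by rw [hθ]; field_simp; ring
  have hθ1' : 0 ≤ 1 - θ := by rw [hθ1]; positivity
  have hXW : 0 < X * W ^ 2 := by positivity
  have hYW : 0 < Y * W := by positivity
  have haa : ∑ n ∈ S, ∑ n' ∈ S, a n * a n' ≤ W ^ 2 := by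
    rw [← Finset.sum_mul_sum, sq]
    exact mul_le_mul haW haW (Finset.sum_nonneg fun n _ => ha n) hW.le
  -- In the first case the optimal threshold would be at most 1, where the counting bound says
  -- nothing; ignoring the decay altogether is already good enough.
  rcases le_or_gt (X * W ^ 2) (Y * W) with hle | hlt
  · have h1 : ∑ n ∈ S, ∑ n' ∈ S, min (X * (1 + |(n : ℝ) - n'|) ^ (-b) * a n * a n')
      (Y * ((a n + a n') / 2)) ≤ X * W ^ 2 := by
      calc _ ≤ ∑ n ∈ S, ∑ n' ∈ S, X * (a n * a n') := by
            refine Finset.sum_le_sum fun n _ => Finset.sum_le_sum fun n' _ => (min_le_left _ _).trans ?_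
            have : (1 + |(n : ℝ) - n'|) ^ (-b) ≤ 1 :=
              Real.rpow_le_one_of_one_le_of_nonpos (by linarith [abs_nonneg ((n : ℝ) - n')])
                (by linarith)
            have h2 := mul_nonneg hX.le (mul_nonneg (ha n) (ha n'))
            nlinarith
        _ = X * ∑ n ∈ S, ∑ n' ∈ S, a n * a n' := by simp_rw [Finset.mul_sum]
        _ ≤ _ := by gcongr
    refine h1.trans ?_
    have h3 : X * W ^ 2 = (X * W ^ 2) ^ (1 - θ) * (X * W ^ 2) ^ θ := by
      rw [← Real.rpow_add hXW]; simp
    have h4 : X * W ^ 2 ≤ (X * W ^ 2) ^ (1 - θ) * (Y * W) ^ θ := by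
      nth_rewrite 1 [h3]
      gcongr
    nlinarith [mul_nonneg hN (hXW.le.trans h4)]
  · set L := X * W ^ 2 / (Y * W) with hL
    have hL1 : 1 ≤ L := (one_le_div hYW).2 hlt.le
    have hL0 : 0 < L := by linarith
    -- This threshold equates the far contribution R^{-b} X W² with the near one R^γ Y W, up to N.
    set R := L ^ (1 / (b + γ)) with hR
    have hR1 : 1 ≤ R := Real.one_le_rpow hL1 (by positivity)
    have hR0 : 0 < R := by linarith
    have hterm : ∀ n ∈ S, ∀ n' ∈ S, min (X * (1 + |(n : ℝ) - n'|) ^ (-b) * a n * a n')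
        (Y * ((a n + a n') / 2)) ≤ X * R ^ (-b) * (a n * a n') +
          if |(n : ℝ) - n'| ≤ R then Y * ((a n + a n') / 2) else 0 := by
      intro n _ n' _
      split_ifs with h
      · refine (min_le_right _ _).trans (le_add_of_nonneg_left ?_)
        have := mul_nonneg (ha n) (ha n')
        positivity
      · refine (min_le_left _ _).trans ?_
        rw [add_zero, mul_assoc (X * _)]
        have h2 := mul_nonneg (ha n) (ha n')
        have : (1 + |(n : ℝ) - n'|) ^ (-b) ≤ R ^ (-b) :=
          Real.rpow_le_rpow_of_nonpos hR0 (by linarith) (by linarith)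
        gcongr
    have hrow : ∀ c : ℝ, 0 ≤ c → ∀ n : ℤ, ∑ n' ∈ S, (if |(n : ℝ) - n'| ≤ R then c else 0) ≤
        N * R ^ γ * c := by
      intro c hc n
      rw [← Finset.sum_filter, Finset.sum_const, nsmul_eq_mul]
      exact mul_le_mul_of_nonneg_right (hcount n R hR1) hc
    have hdiag : ∑ n ∈ S, ∑ n' ∈ S, (if |(n : ℝ) - n'| ≤ R then Y * ((a n + a n') / 2) else 0) ≤
        N * R ^ γ * (Y * W) := by
      have e1 : ∑ n ∈ S, ∑ n' ∈ S, (if |(n : ℝ) - n'| ≤ R then Y * ((a n + a n') / 2) else 0) =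
          ∑ n ∈ S, ∑ n' ∈ S, (if |(n : ℝ) - n'| ≤ R then Y * a n / 2 else 0) +
          ∑ n ∈ S, ∑ n' ∈ S, (if |(n : ℝ) - n'| ≤ R then Y * a n' / 2 else 0) := by
        rw [← Finset.sum_add_distrib]
        refine Finset.sum_congr rfl fun n _ => ?_
        rw [← Finset.sum_add_distrib]
        refine Finset.sum_congr rfl fun n' _ => ?_
        split_ifs <;> ring
      -- By symmetry both halves become row sums of a fixed weight `a n`, where only the number of
      -- neighbours counts.
      have e2 : ∑ n ∈ S, ∑ n' ∈ S, (if |(n : ℝ) - n'| ≤ R then Y * a n' / 2 else 0) =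
          ∑ n ∈ S, ∑ n' ∈ S, (if |(n : ℝ) - n'| ≤ R then Y * a n / 2 else 0) := by
        rw [Finset.sum_comm]
        simp_rw [abs_sub_comm]
      have e3 : ∑ n ∈ S, ∑ n' ∈ S, (if |(n : ℝ) - n'| ≤ R then Y * a n / 2 else 0) ≤
          N * R ^ γ * (Y * W) / 2 := by
        calc _ ≤ ∑ n ∈ S, N * R ^ γ * (Y * a n / 2) :=
              Finset.sum_le_sum fun n _ => hrow _ (by have := ha n; positivity) n
          _ = N * R ^ γ * (Y * ∑ n ∈ S, a n) / 2 := by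
              rw [Finset.mul_sum, Finset.mul_sum, Finset.sum_div]
              exact Finset.sum_congr rfl fun n _ => by ring
          _ ≤ _ := by gcongr
      rw [e1, e2]
      linarith
    have htot : ∑ n ∈ S, ∑ n' ∈ S, min (X * (1 + |(n : ℝ) - n'|) ^ (-b) * a n * a n')
        (Y * ((a n + a n') / 2)) ≤ R ^ (-b) * (X * W ^ 2) + N * R ^ γ * (Y * W) := by
      refine (Finset.sum_le_sum fun n hn => Finset.sum_le_sum fun n' hn' => hterm n hn n' hn').trans ?_
      simp_rw [Finset.sum_add_distrib]
      refine add_le_add ?_ hdiag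
      simp_rw [← Finset.mul_sum]
      calc X * R ^ (-b) * ∑ n ∈ S, a n * ∑ n' ∈ S, a n'
          = X * R ^ (-b) * ∑ n ∈ S, ∑ n' ∈ S, a n * a n' := by simp_rw [Finset.mul_sum]
        _ ≤ X * R ^ (-b) * W ^ 2 := by gcongr
        _ = _ := by ring
    refine htot.trans ?_
    have hRb : R ^ (-b) = L ^ (-θ) := by
      rw [hR, ← Real.rpow_mul hL0.le, hθ]; congr 1; ring
    have hRγ : R ^ γ = L ^ (1 - θ) := by
      rw [hR, ← Real.rpow_mul hL0.le, hθ1]; congr 1; ring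
    have f1 : L ^ (-θ) * (X * W ^ 2) = (X * W ^ 2) ^ (1 - θ) * (Y * W) ^ θ := by
      rw [hL, Real.rpow_neg (by positivity), Real.div_rpow hXW.le hYW.le, inv_div,
        Real.rpow_sub hXW, Real.rpow_one]
      field_simp
    have f2 : L ^ (1 - θ) * (Y * W) = (X * W ^ 2) ^ (1 - θ) * (Y * W) ^ θ := by
      rw [hL, Real.div_rpow hXW.le hYW.le, Real.rpow_sub hYW, Real.rpow_one]
      field_simp
    rw [hRb, hRγ, f1, mul_assoc N, f2]
    apply le_of_eq
    ring

end Counting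
end SphericalMax

namespace SphericalMax

/-! ### A compactly supported radial mollifier with vanishing moments. -/

section Mollifier

open Real FourierTransform SchwartzMap ComplexConjugate Convolution

variable {V : Type*} [NormedAddCommGroup V] [InnerProductSpace ℝ V] [MeasurableSpace V]
  [BorelSpace V] [FiniteDimensional ℝ V]

lemma norm_fourierChar_sub_one_le (s : ℝ) : ‖(𝐞 s : ℂ) - 1‖ ≤ 2 * π * |s| := by
  have h := Real.norm_exp_I_mul_ofReal_sub_one_le (x := 2 * π * s)
  rw [Real.fourierChar_apply, mul_comm]
  rwa [Real.norm_eq_abs, abs_mul, abs_of_pos (by positivity : 0 < 2 * π)] at h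

variable (V) in
/-- A smooth bump function, invariant under isometries, of integral one. -/
lemma exists_radial_bump : ∃ χ : V → ℂ, ContDiff ℝ (⊤ : ℕ∞) χ ∧ HasCompactSupport χ ∧
    (∀ (L : V ≃ₗᵢ[ℝ] V) x, χ (L x) = χ x) ∧ (∀ x, conj (χ x) = χ x) ∧
    ∃ C, ∀ ξ, ‖1 - 𝓕 χ ξ‖ ≤ C * ‖ξ‖ := by
  set φ : V → ℝ := fun x => Real.smoothTransition (1 - ‖x‖ ^ 2) with hφ
  have hφs : ContDiff ℝ (⊤ : ℕ∞) φ :=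
    Real.smoothTransition.contDiff.comp (contDiff_const.sub (contDiff_norm_sq ℝ))
  have hφ0 : ∀ x, 1 < ‖x‖ → φ x = 0 := fun x hx =>
    Real.smoothTransition.zero_of_nonpos (by nlinarith)
  have hφc : HasCompactSupport φ := by
    refine HasCompactSupport.of_support_subset_isCompact (isCompact_closedBall (0 : V) 1) ?_
    intro x hx
    by_contra h
    exact hx (hφ0 x (by simpa using h))
  have hφn : ∀ x, 0 ≤ φ x := fun x => Real.smoothTransition.nonneg _
  have hI : 0 < ∫ x, φ x := by
    refine hφs.continuous.integral_pos_of_hasCompactSupport_nonneg_nonzero hφc hφn (x := 0) ?_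
    simp [hφ]
  set I := ∫ x, φ x with hIdef
  have hχi : Integrable φ := hφs.continuous.integrable_of_hasCompactSupport hφc
  refine ⟨fun x => ((I⁻¹ * φ x : ℝ) : ℂ), ?_, ?_, ?_, ?_, 2 * π, fun ξ => ?_⟩
  · exact Complex.ofRealCLM.contDiff.comp (contDiff_const.mul hφs)
  · exact (hφc.comp_left (g := fun y : ℝ => ((I⁻¹ * y : ℝ) : ℂ)) (by simp))
  · intro L x
    simp [hφ]
  · intro x
    exact Complex.conj_ofReal _
  · have h1 : (1 : ℂ) = ∫ x, ((I⁻¹ * φ x : ℝ) : ℂ) := by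
      rw [integral_complex_ofReal, integral_const_mul, ← hIdef, inv_mul_cancel₀ hI.ne']
      simp
    have hi : Integrable (fun x => ((I⁻¹ * φ x : ℝ) : ℂ)) := (hχi.const_mul _).ofReal
    have hi' : Integrable (fun x => 𝐞 (-inner ℝ x ξ) • ((I⁻¹ * φ x : ℝ) : ℂ)) := by
      simpa using (Real.fourierIntegral_convergent_iff ξ).2 hi
    rw [h1, fourier_eq, ← integral_sub hi hi']
    have h2 : (2 * π) * ‖ξ‖ = ∫ x, (I⁻¹ * φ x) * (2 * π * ‖ξ‖) := by
      rw [integral_mul_const, integral_const_mul, ← hIdef, inv_mul_cancel₀ hI.ne', one_mul]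
    rw [h2]
    refine norm_integral_le_of_norm_le ((hχi.const_mul _).mul_const _)
      (Filter.Eventually.of_forall fun x => ?_)
    have e : ((I⁻¹ * φ x : ℝ) : ℂ) - 𝐞 (-inner ℝ x ξ) • ((I⁻¹ * φ x : ℝ) : ℂ) =
        ((I⁻¹ * φ x : ℝ) : ℂ) * (1 - (𝐞 (-inner ℝ x ξ) : ℂ)) := by
      rw [Circle.smul_def, smul_eq_mul]; ring
    rw [e, norm_mul, Complex.norm_real, Real.norm_of_nonneg (mul_nonneg (by positivity) (hφn x))]
    rcases le_or_gt ‖x‖ 1 with hx | hx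
    · refine mul_le_mul_of_nonneg_left ?_ (mul_nonneg (by positivity) (hφn x))
      rw [norm_sub_rev]
      refine (norm_fourierChar_sub_one_le _).trans ?_
      rw [abs_neg]
      have := abs_real_inner_le_norm x ξ
      have h3 : ‖x‖ * ‖ξ‖ ≤ ‖ξ‖ := mul_le_of_le_one_left (norm_nonneg _) hx
      have : |inner ℝ x ξ| ≤ ‖ξ‖ := this.trans h3
      gcongr
    · simp [hφ0 x hx]

variable (V) in
/-- A compactly supported mollifier with vanishing moments. -/
lemma exists_radial_kernel (N : ℕ) : ∃ Φ : V → ℂ, ContDiff ℝ (⊤ : ℕ∞) Φ ∧ HasCompactSupport Φ ∧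
    (∀ (L : V ≃ₗᵢ[ℝ] V) x, Φ (L x) = Φ x) ∧ (∀ x, conj (Φ x) = Φ x) ∧
    ∃ C, ∀ ξ, ‖1 - 𝓕 Φ ξ‖ ≤ C * ‖ξ‖ ^ N := by
  obtain ⟨χ, hχs, hχc, hχL, hχr, c, hc⟩ := exists_radial_bump V
  have hχi : Integrable χ := hχs.continuous.integrable_of_hasCompactSupport hχc
  induction N with
  | zero =>
    -- Order zero asks only for boundedness, so the zero kernel starts the induction.
    refine ⟨0, contDiff_const, HasCompactSupport.zero, by simp, by simp, 1, fun ξ => ?_⟩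
    have : 𝓕 (0 : V → ℂ) ξ = 0 := by rw [fourier_eq]; simp
    simp [this]
  | succ N ih =>
    obtain ⟨Φ, hΦs, hΦc, hΦL, hΦr, C, hC⟩ := ih
    have hΦi : Integrable Φ := hΦs.continuous.integrable_of_hasCompactSupport hΦc
    set κ : V → ℂ := χ ⋆[ContinuousLinearMap.mul ℂ ℂ] Φ with hκ
    have hκs : ContDiff ℝ (⊤ : ℕ∞) κ :=
      hΦc.contDiff_convolution_right ((ContinuousLinearMap.mul ℝ ℂ)) hχi.locallyIntegrable hΦs
    have hκc : HasCompactSupport κ := hχc.convolution _ hΦc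
    have hκi : Integrable κ := hκs.continuous.integrable_of_hasCompactSupport hκc
    have hκx : ∀ x, κ x = ∫ t, χ t * Φ (x - t) := fun x => rfl
    -- Chosen so that one minus its transform is (1 - 𝓕 Φ)(1 - 𝓕 χ): each step multiplies in one
    -- more factor that vanishes at the origin, and the support stays compact.
    refine ⟨fun x => Φ x + χ x - κ x, (hΦs.add hχs).sub hκs, ?_, ?_, ?_, |C| * |c|, fun ξ => ?_⟩
    · exact (hΦc.add hχc).sub hκc
    · intro L x
      have : κ (L x) = κ x := by
        rw [hκx, hκx, ← L.measurePreserving.integral_comp L.toHomeomorph.measurableEmbedding]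
        congr with t
        rw [hχL, ← map_sub, hΦL]
      simp only [hΦL, hχL, this]
    · intro x
      have : conj (κ x) = κ x := by
        rw [hκx, ← integral_conj]
        congr with t
        rw [map_mul, hχr, hΦr]
      simp only [map_sub, map_add, hΦr, hχr, this]
    · have hF : 𝓕 (fun x => Φ x + χ x - κ x) ξ = 𝓕 Φ ξ + 𝓕 χ ξ - 𝓕 χ ξ * 𝓕 Φ ξ := by
        rw [← Real.fourier_mul_convolution_eq hχi hΦi, fourier_eq, fourier_eq, fourier_eq,
          fourier_eq]
        have i1 := (Real.fourierIntegral_convergent_iff ξ).2 hΦi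
        have i2 := (Real.fourierIntegral_convergent_iff ξ).2 hχi
        have i3 := (Real.fourierIntegral_convergent_iff ξ).2 hκi
        have e := integral_sub (i1.add i2) i3
        rw [integral_add' i1 i2] at e
        rw [← e]
        refine integral_congr_ae (Filter.Eventually.of_forall fun x => ?_)
        simp only [Pi.add_apply, smul_sub, smul_add]
      have hfac : 1 - 𝓕 (fun x => Φ x + χ x - κ x) ξ = (1 - 𝓕 Φ ξ) * (1 - 𝓕 χ ξ) := by
        rw [hF]; ring
      rw [hfac, norm_mul]
      have h1 : ‖1 - 𝓕 Φ ξ‖ ≤ |C| * ‖ξ‖ ^ N :=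
        (hC ξ).trans (mul_le_mul_of_nonneg_right (le_abs_self _) (by positivity))
      have h2 : ‖1 - 𝓕 χ ξ‖ ≤ |c| * ‖ξ‖ :=
        (hc ξ).trans (mul_le_mul_of_nonneg_right (le_abs_self _) (by positivity))
      calc _ ≤ (|C| * ‖ξ‖ ^ N) * (|c| * ‖ξ‖) := by gcongr
        _ = _ := by ring

/-- A mollifier `Φ` on `ℝ^d` together with its radial Fourier transform `P`. -/
structure Mollifier (d : ℕ) where
  /-- the mollifier -/
  Φ : EuclideanSpace ℝ (Fin d) → ℂ
  /-- its Fourier transform -/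
  P : EuclideanSpace ℝ (Fin d) → ℝ
  /-- the radius of a ball that supports `Φ` -/
  R : ℝ
  /-- a bound -/
  C : ℝ
  R_pos : 0 < R
  C_pos : 0 < C
  continuous_Φ : Continuous Φ
  Φ_eq_zero : ∀ x, R < ‖x‖ → Φ x = 0
  norm_Φ_le : ∀ x, ‖Φ x‖ ≤ C
  integrable_P : Integrable P
  fourier_Φ : ∀ ξ, 𝓕 Φ ξ = P ξ
  radial : ∀ ξ η, ‖ξ‖ = ‖η‖ → P ξ = P η
  P_zero : P 0 = 1
  decay : ∀ u, (1 + 2 * π * ‖u‖) * |P ((1 / 2 : ℝ) • u) - P u| ≤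
    C * (‖u‖ ^ d / (1 + ‖u‖) ^ (3 * d))

/-- Radial and real-valued, hence with a radial real transform. In the field `decay`, vanishing of 1
- P to order d at the origin gives the numerator ‖u‖^d. Schwartz decay gives the denominator, with
one power more than 3d because the factor 1 + 2π‖u‖ must pay for one derivative in the radius. -/
lemma nonempty_mollifier (d : ℕ) [NeZero d] : Nonempty (Mollifier d) := by
  obtain ⟨Φ, hs, hc, hL, hr, C₁, hC₁⟩ := exists_radial_kernel (EuclideanSpace ℝ (Fin d)) d
  set Ψ : 𝓢(EuclideanSpace ℝ (Fin d), ℂ) := hc.toSchwartzMap hs with hΨ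
  have hΨΦ : (Ψ : EuclideanSpace ℝ (Fin d) → ℂ) = Φ := rfl
  have hFΦ : ((𝓕 Ψ : 𝓢(EuclideanSpace ℝ (Fin d), ℂ)) : EuclideanSpace ℝ (Fin d) → ℂ) = 𝓕 Φ := by
    rw [SchwartzMap.fourier_coe, hΨΦ]
  have hrad : ∀ ξ η, ‖ξ‖ = ‖η‖ → 𝓕 Φ ξ = 𝓕 Φ η := by
    intro ξ η h
    set L := (ℝ ∙ (ξ - η))ᗮ.reflection
    have hLξ : L ξ = η := Submodule.reflection_sub h
    have hΦL : Φ ∘ L = Φ := funext fun x => hL L x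
    rw [← hLξ, ← Real.fourier_comp_linearIsometry L Φ ξ, hΦL]
  have hreal : ∀ ξ, conj (𝓕 Φ ξ) = 𝓕 Φ ξ := by
    intro ξ
    have h1 : 𝓕 Φ ξ = 𝓕⁻ Φ ξ := by
      rw [fourierInv_eq_fourier_neg]
      exact hrad _ _ (by simp)
    rw [h1, conj_fourierInv, ← h1, funext hr]
  set P : EuclideanSpace ℝ (Fin d) → ℝ := fun ξ => (𝓕 Φ ξ).re with hP
  have hPc : ∀ ξ, 𝓕 Φ ξ = P ξ := fun ξ => (Complex.conj_eq_iff_re.1 (hreal ξ)).symm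
  obtain ⟨R₀, hR₀⟩ := hc.isCompact.isBounded.subset_closedBall (0 : EuclideanSpace ℝ (Fin d))
  obtain ⟨C₂, hC₂⟩ := hs.continuous.bounded_above_of_compact_support hc
  obtain ⟨C₃, hC₃, hdec⟩ : ∃ C₃, 0 < C₃ ∧ ∀ ξ, (1 + ‖ξ‖) ^ (3 * d + 1) * |P ξ| ≤ C₃ := by
    have H : ∃ M : ℝ, ∀ ξ, (1 + ‖ξ‖) ^ (3 * d + 1) * |P ξ| ≤ M := by
      have h := SchwartzMap.one_add_le_sup_seminorm_apply (𝕜 := ℝ) (m := (3 * d + 1, 0)) (k := 3 * d + 1)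
        (n := 0) le_rfl le_rfl (𝓕 Ψ : 𝓢(EuclideanSpace ℝ (Fin d), ℂ))
      refine ⟨_, fun ξ => le_trans (le_of_eq ?_) (h ξ)⟩
      rw [norm_iteratedFDeriv_zero, hFΦ, hPc, Complex.norm_real, Real.norm_eq_abs]
    obtain ⟨M, hM⟩ := H
    exact ⟨|M| + 1, by positivity, fun ξ => by linarith [hM ξ, le_abs_self M]⟩
  have hlow : ∀ ξ, |1 - P ξ| ≤ |C₁| * ‖ξ‖ ^ d := by
    intro ξ
    have h := hC₁ ξ
    rw [hPc, ← Complex.ofReal_one, ← Complex.ofReal_sub, Complex.norm_real, Real.norm_eq_abs] at h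
    exact h.trans (mul_le_mul_of_nonneg_right (le_abs_self _) (by positivity))
  set D : ℝ := (1 + 2 * π) * (2 * |C₁|) * 2 ^ (3 * d) + 2 * π * (2 ^ (3 * d + 1) * C₃ + C₃) with hD
  have hpi := Real.pi_gt_three
  refine ⟨⟨Φ, P, |R₀| + 1, |C₂| + D + 1, by positivity, by positivity, hs.continuous, ?_, ?_, ?_,
    hPc, ?_, ?_, ?_⟩⟩
  · intro x hx
    by_contra h
    have := hR₀ (subset_tsupport _ h)
    rw [mem_closedBall_zero_iff] at this
    linarith [le_abs_self R₀]
  · intro x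
    have : 0 ≤ D := by positivity
    linarith [hC₂ x, le_abs_self C₂]
  · have h : Integrable (𝓕 Φ) := by
      rw [← hFΦ]; exact SchwartzMap.integrable _
    exact h.re
  · intro ξ η h
    simp only [hP, hrad ξ η h]
  · have := hlow 0
    rw [norm_zero, zero_pow (NeZero.ne d), mul_zero] at this
    have := abs_nonpos_iff.1 this
    linarith
  · intro u
    have hu0 := norm_nonneg u
    rw [← mul_div_assoc, le_div_iff₀ (by positivity)]
    refine le_trans ?_ (mul_le_mul_of_nonneg_right (by linarith [abs_nonneg C₂] :
      D ≤ |C₂| + D + 1) (by positivity))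
    have hhalf : ‖(1 / 2 : ℝ) • u‖ = ‖u‖ / 2 := by
      rw [norm_smul]; norm_num; ring
    rcases le_or_gt ‖u‖ 1 with h1 | h1
    · have e1 : |P ((1 / 2 : ℝ) • u) - P u| ≤ 2 * |C₁| * ‖u‖ ^ d := by
        have a1 := hlow u
        have a2 := hlow ((1 / 2 : ℝ) • u)
        have a3 : ‖(1 / 2 : ℝ) • u‖ ^ d ≤ ‖u‖ ^ d := by
          rw [hhalf]; gcongr; linarith
        have a4 : |1 - P ((1 / 2 : ℝ) • u)| ≤ |C₁| * ‖u‖ ^ d :=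
          a2.trans (mul_le_mul_of_nonneg_left a3 (abs_nonneg _))
        have e : P ((1 / 2 : ℝ) • u) - P u = (1 - P u) - (1 - P ((1 / 2 : ℝ) • u)) := by ring
        rw [e]
        linarith [abs_sub (1 - P u) (1 - P ((1 / 2 : ℝ) • u))]
      have e2 : (1 + ‖u‖) ^ (3 * d) ≤ 2 ^ (3 * d) := by gcongr; linarith
      have e3 : 1 + 2 * π * ‖u‖ ≤ 1 + 2 * π := by nlinarith
      calc (1 + 2 * π * ‖u‖) * |P ((1 / 2 : ℝ) • u) - P u| * (1 + ‖u‖) ^ (3 * d)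
          ≤ (1 + 2 * π) * (2 * |C₁| * ‖u‖ ^ d) * 2 ^ (3 * d) := by gcongr
        _ = (1 + 2 * π) * (2 * |C₁|) * 2 ^ (3 * d) * ‖u‖ ^ d := by ring
        _ ≤ D * ‖u‖ ^ d := by
          gcongr
          rw [hD]
          exact le_add_of_nonneg_right (by positivity)
    · have e1 : (1 + ‖u‖) ^ (3 * d + 1) * |P ((1 / 2 : ℝ) • u) - P u| ≤
          2 ^ (3 * d + 1) * C₃ + C₃ := by
        have a1 := hdec u
        have a2 := hdec ((1 / 2 : ℝ) • u)
        rw [hhalf] at a2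
        have a3 : (1 + ‖u‖) ^ (3 * d + 1) ≤ 2 ^ (3 * d + 1) * (1 + ‖u‖ / 2) ^ (3 * d + 1) := by
          rw [← mul_pow]; gcongr; linarith
        calc _ ≤ (1 + ‖u‖) ^ (3 * d + 1) * (|P ((1 / 2 : ℝ) • u)| + |P u|) := by
              gcongr; exact abs_sub _ _
          _ = (1 + ‖u‖) ^ (3 * d + 1) * |P ((1 / 2 : ℝ) • u)| + (1 + ‖u‖) ^ (3 * d + 1) * |P u| := by
              ring
          _ ≤ 2 ^ (3 * d + 1) * (1 + ‖u‖ / 2) ^ (3 * d + 1) * |P ((1 / 2 : ℝ) • u)| + C₃ := by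
              gcongr
          _ ≤ _ := by
              rw [mul_assoc]; gcongr
      have e2 : 1 + 2 * π * ‖u‖ ≤ 2 * π * (1 + ‖u‖) := by nlinarith
      have e3 : 1 ≤ ‖u‖ ^ d := one_le_pow₀ h1.le
      calc (1 + 2 * π * ‖u‖) * |P ((1 / 2 : ℝ) • u) - P u| * (1 + ‖u‖) ^ (3 * d)
          ≤ 2 * π * (1 + ‖u‖) * |P ((1 / 2 : ℝ) • u) - P u| * (1 + ‖u‖) ^ (3 * d) := by gcongr
        _ = 2 * π * ((1 + ‖u‖) ^ (3 * d + 1) * |P ((1 / 2 : ℝ) • u) - P u|) := by ring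
        _ ≤ 2 * π * (2 ^ (3 * d + 1) * C₃ + C₃) := by gcongr
        _ ≤ D := by
          rw [hD]
          exact le_add_of_nonneg_left (by positivity)
        _ ≤ D * ‖u‖ ^ d := le_mul_of_one_le_right (by positivity) e3

end Mollifier
end SphericalMax

namespace SphericalMax

/-! ### Multipliers, their kernels, and spherical means. -/

section Multiplier

open Real FourierTransform Metric

variable {d : ℕ}

local notation "𝔼" => EuclideanSpace ℝ (Fin d)

lemma fourierInv_comp_smul (g : 𝔼 → ℂ) {δ : ℝ} (hδ : 0 < δ) (x : 𝔼) :
    𝓕⁻ (fun ξ => g (δ • ξ)) x = ((δ ^ d)⁻¹ : ℝ) • 𝓕⁻ g (δ⁻¹ • x) := by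
  rw [fourierInv_eq, fourierInv_eq]
  have h := Measure.integral_comp_smul (volume : Measure 𝔼)
    (fun ξ => 𝐞 (inner ℝ ξ (δ⁻¹ • x)) • g ξ) δ
  rw [finrank_euclideanSpace, Fintype.card_fin, abs_of_pos (by positivity)] at h
  rw [← h]
  congr with ξ
  rw [inner_smul_left, inner_smul_right]
  simp [hδ.ne']

lemma fourier_comp_inv_smul (g : 𝔼 → ℂ) {δ : ℝ} (hδ : 0 < δ) (ξ : 𝔼) :
    𝓕 (fun x => ((δ ^ d)⁻¹ : ℝ) • g (δ⁻¹ • x)) ξ = 𝓕 g (δ • ξ) := by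
  rw [fourier_eq, fourier_eq]
  have h := Measure.integral_comp_inv_smul (volume : Measure 𝔼)
    (fun x => 𝐞 (-inner ℝ x (δ • ξ)) • g x) δ
  rw [finrank_euclideanSpace, Fintype.card_fin, abs_of_pos (by positivity)] at h
  rw [← inv_smul_eq_iff₀ (by positivity), ← integral_smul] at h
  rw [← h]
  congr with x
  rw [inner_smul_left, inner_smul_right, smul_comm]
  simp [hδ.ne']

/-- A Fourier multiplier operator as a convolution. -/
lemma fourierInv_mul_fourier {p f : 𝔼 → ℂ} (hp : Integrable p) (hf : Integrable f) (x : 𝔼) :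
    𝓕⁻ (fun ξ => p ξ * 𝓕 f ξ) x = ∫ y, f y * 𝓕⁻ p (x - y) := by
  have hpx : Integrable (fun ξ => 𝐞 (inner ℝ ξ x) • p ξ) := by
    refine hp.mono ?_ (Filter.Eventually.of_forall fun ξ => by simp)
    exact (Real.continuous_fourierChar.comp (by fun_prop)).aestronglyMeasurable.smul hp.1
  have hflip := integral_fourier_mul_eq hf hpx
  have : ∀ y, 𝓕⁻ p (x - y) = 𝓕 (fun ξ => 𝐞 (inner ℝ ξ x) • p ξ) y := by
    intro y
    rw [fourierInv_eq, fourier_eq]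
    congr with ξ
    rw [smul_smul, ← AddChar.map_add_eq_mul, inner_sub_right]
    ring_nf
  simp_rw [this]
  rw [← hflip, fourierInv_eq]
  congr with ξ
  simp only [Circle.smul_def, smul_eq_mul]
  ring

namespace Mollifier

variable (M : Mollifier d)

lemma integrable_Φ : Integrable M.Φ := by
  refine M.continuous_Φ.integrable_of_hasCompactSupport ?_
  refine HasCompactSupport.of_support_subset_isCompact (isCompact_closedBall (0 : 𝔼) M.R) ?_
  intro x hx
  by_contra h
  exact hx (M.Φ_eq_zero x (by simpa using h))

lemma continuous_P : Continuous M.P := by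
  have h : M.P = fun ξ => (𝓕 M.Φ ξ).re := by ext ξ; simp [M.fourier_Φ]
  rw [h]
  exact Complex.continuous_re.comp (continuous_fourier M.integrable_Φ)

lemma fourierInv_P (x : 𝔼) : 𝓕⁻ (fun ξ => (M.P ξ : ℂ)) x = M.Φ x := by
  have h : (fun ξ => (M.P ξ : ℂ)) = 𝓕 M.Φ := funext fun ξ => (M.fourier_Φ ξ).symm
  rw [h]
  refine congrFun (Continuous.fourierInv_fourier_eq M.continuous_Φ M.integrable_Φ ?_) x
  rw [← h]
  exact M.integrable_P.ofReal

lemma integrable_P_smul {δ : ℝ} (hδ : 0 < δ) : Integrable (fun ξ => (M.P (δ • ξ) : ℂ)) :=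
  (M.integrable_P.comp_smul hδ.ne').ofReal

lemma fourierInv_P_smul {δ : ℝ} (hδ : 0 < δ) (x : 𝔼) :
    𝓕⁻ (fun ξ => (M.P (δ • ξ) : ℂ)) x = ((δ ^ d)⁻¹ : ℝ) • M.Φ (δ⁻¹ • x) := by
  rw [fourierInv_comp_smul (fun ξ => (M.P ξ : ℂ)) hδ, M.fourierInv_P]

lemma fourier_Φ_smul {δ : ℝ} (hδ : 0 < δ) (ξ : 𝔼) :
    𝓕 (fun x => ((δ ^ d)⁻¹ : ℝ) • M.Φ (δ⁻¹ • x)) ξ = M.P (δ • ξ) := by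
  rw [fourier_comp_inv_smul M.Φ hδ, M.fourier_Φ]

lemma Φ_smul_eq_zero {δ : ℝ} (hδ : 0 < δ) {x : 𝔼} (hx : M.R * δ < ‖x‖) : M.Φ (δ⁻¹ • x) = 0 := by
  refine M.Φ_eq_zero _ ?_
  rw [norm_smul, Real.norm_of_nonneg (by positivity), inv_mul_eq_div, lt_div_iff₀ hδ]
  exact hx

/-- The kernel is the convolution of two dilates of Φ, supported in balls of radii Ra and Rb. -/
lemma fourierInv_P_mul_P_eq_zero {a b : ℝ} (ha : 0 < a) (hb : 0 < b) {z : 𝔼}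
    (hz : M.R * (a + b) < ‖z‖) :
    𝓕⁻ (fun ξ => (M.P (a • ξ) : ℂ) * (M.P (b • ξ) : ℂ)) z = 0 := by
  have hi : Integrable (fun x => ((b ^ d)⁻¹ : ℝ) • M.Φ (b⁻¹ • x)) :=
    (M.integrable_Φ.comp_smul (inv_ne_zero hb.ne')).smul ((b ^ d)⁻¹ : ℝ)
  have h := fourierInv_mul_fourier (M.integrable_P_smul ha) hi z
  simp_rw [M.fourier_Φ_smul hb, M.fourierInv_P_smul ha] at h
  rw [h]
  refine integral_eq_zero_of_ae (Filter.Eventually.of_forall fun y => ?_)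
  rcases lt_or_ge (M.R * b) ‖y‖ with hy | hy
  · simp [M.Φ_smul_eq_zero hb hy]
  · have : M.R * a < ‖z - y‖ := by
      have := norm_sub_norm_le z y
      linarith
    simp [M.Φ_smul_eq_zero ha this]

/-- The frequency-localized part of the mollifier. -/
noncomputable def Q (u : 𝔼) : ℝ := M.P ((1 / 2 : ℝ) • u) - M.P u

lemma continuous_Q : Continuous M.Q :=
  (M.continuous_P.comp (by fun_prop)).sub M.continuous_P

lemma Q_radial {ξ η : 𝔼} (h : ‖ξ‖ = ‖η‖) : M.Q ξ = M.Q η := by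
  rw [Q, Q, M.radial ξ η h, M.radial ((1 / 2 : ℝ) • ξ) ((1 / 2 : ℝ) • η) (by simp [norm_smul, h])]

/-- Expanding the square leaves products of P at the scales δ/2 and δ. Exact compact support, rather
than rapid decay, is what later makes the composed kernels vanish identically near the origin when
the radii are far apart. -/
lemma fourierInv_Q_sq_eq_zero {δ : ℝ} (hδ : 0 < δ) {z : 𝔼} (hz : 2 * M.R * δ < ‖z‖) :
    𝓕⁻ (fun ξ => ((M.Q (δ • ξ) ^ 2 : ℝ) : ℂ)) z = 0 := by
  have hδ2 : 0 < 1 / 2 * δ := by positivity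
  have hR := M.R_pos
  have hRδ : 0 < M.R * δ := by positivity
  have z1 := M.fourierInv_P_mul_P_eq_zero hδ2 hδ2 (z := z) (by nlinarith)
  have z2 := M.fourierInv_P_mul_P_eq_zero hδ2 hδ (z := z) (by nlinarith)
  have z3 := M.fourierInv_P_mul_P_eq_zero hδ hδ (z := z) (by nlinarith)
  have hint : ∀ {a b : ℝ}, 0 < a → 0 < b → Integrable (fun ξ : 𝔼 => 𝐞 (inner ℝ ξ z) •
      ((M.P (a • ξ) : ℂ) * (M.P (b • ξ) : ℂ))) := by
    intro a b ha hb
    have hbd : Integrable (fun ξ => (M.P (a • ξ) : ℂ) * (M.P (b • ξ) : ℂ)) := by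
      refine (M.integrable_P_smul ha).mul_bdd (c := ∫ x, ‖M.Φ x‖)
        (Complex.continuous_ofReal.comp (M.continuous_P.comp (by fun_prop))).aestronglyMeasurable
        (Filter.Eventually.of_forall fun ξ => ?_)
      rw [← M.fourier_Φ]
      exact norm_fourier_le _ _
    refine hbd.mono ?_ (Filter.Eventually.of_forall fun ξ => by simp)
    exact (Real.continuous_fourierChar.comp (by fun_prop)).aestronglyMeasurable.smul hbd.1
  rw [fourierInv_eq] at z1 z2 z3 ⊢
  have e : ∀ ξ : 𝔼, 𝐞 (inner ℝ ξ z) • ((M.Q (δ • ξ) ^ 2 : ℝ) : ℂ) =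
      𝐞 (inner ℝ ξ z) • ((M.P ((1 / 2 * δ) • ξ) : ℂ) * (M.P ((1 / 2 * δ) • ξ) : ℂ)) -
      2 * (𝐞 (inner ℝ ξ z) • ((M.P ((1 / 2 * δ) • ξ) : ℂ) * (M.P (δ • ξ) : ℂ))) +
      𝐞 (inner ℝ ξ z) • ((M.P (δ • ξ) : ℂ) * (M.P (δ • ξ) : ℂ)) := by
    intro ξ
    simp only [Q, smul_smul, Circle.smul_def, smul_eq_mul]
    push_cast
    ring
  simp_rw [e]
  have h1 := integral_add ((hint hδ2 hδ2).sub ((hint hδ2 hδ).const_mul 2)) (hint hδ hδ)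
  rw [integral_sub' (hint hδ2 hδ2) ((hint hδ2 hδ).const_mul 2), integral_const_mul, z1, z2, z3] at h1
  simpa using h1

end Mollifier

variable [NeZero d]

/-- Spherical means act as Fourier multipliers. -/
lemma integral_sphere_fourierInv {p : 𝔼 → ℂ} (hp : Integrable p) (t : ℝ) (x : 𝔼) :
    ∫ y : sphere (0 : 𝔼) 1, 𝓕⁻ p (x - t • (y : 𝔼)) ∂(sphereMeasure d) =
      𝓕⁻ (fun ξ => (sphereProfile d (2 * π * t * ‖ξ‖) : ℂ) * p ξ) x := by
  simp_rw [fourierInv_eq]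
  rw [integral_integral_swap]
  · congr with ξ
    have h := integral_sphere_fourierChar ξ (-t)
    have heven : sphereProfile d (2 * π * (-t) * ‖ξ‖) = sphereProfile d (2 * π * t * ‖ξ‖) := by
      rw [sphereProfile, sphereProfile]
      congr with y
      rw [← Real.cos_neg]
      ring_nf
    rw [heven] at h
    rw [← h]
    have e : ∀ y : sphere (0 : 𝔼) 1, 𝐞 (inner ℝ ξ (x - t • (y : 𝔼))) • p ξ =
        (𝐞 (inner ℝ ((-t) • (y : 𝔼)) ξ) : ℂ) * ((𝐞 (inner ℝ ξ x) : ℂ) * p ξ) := by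
      intro y
      have : inner ℝ ξ (x - t • (y : 𝔼)) = inner ℝ ((-t) • (y : 𝔼)) ξ + inner ℝ ξ x := by
        rw [inner_sub_right, neg_smul, inner_neg_left, real_inner_comm ξ (t • (y : 𝔼))]; ring
      rw [this, AddChar.map_add_eq_mul, Circle.smul_def, smul_eq_mul]
      push_cast
      ring
    simp_rw [e]
    rw [integral_mul_const, Circle.smul_def, smul_eq_mul]
    ring
  · have hp' : Integrable (fun q : sphere (0 : 𝔼) 1 × 𝔼 => p q.2) ((sphereMeasure d).prod volume) :=
      hp.comp_snd _
    refine hp'.mono ?_ (Filter.Eventually.of_forall fun q => by simp [Function.uncurry])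
    refine AEStronglyMeasurable.smul (f := fun q : sphere (0 : 𝔼) 1 × 𝔼 =>
      𝐞 (inner ℝ q.2 (x - t • (q.1 : 𝔼)))) ?_ hp'.1
    exact (Real.continuous_fourierChar.comp (by fun_prop)).aestronglyMeasurable

/-- Averaging a radial multiplier over rotations. -/
lemma norm_fourierInv_radial_le {ρ : 𝔼 → ℂ} (hρ : Integrable ρ)
    (hrad : ∀ ξ η, ‖ξ‖ = ‖η‖ → ρ ξ = ρ η) (z : 𝔼) :
    ‖𝓕⁻ ρ z‖ ≤ ∫ ξ, |sphereProfile d (2 * π * ‖z‖ * ‖ξ‖)| * ‖ρ ξ‖ := by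
  -- A radial multiplier has a radial kernel, so the kernel at z equals its mean over the sphere of
  -- radius ‖z‖. This inserts the decaying factor `sphereProfile` in ‖z‖‖ξ‖.
  have hinv : ∀ y : sphere (0 : 𝔼) 1, 𝓕⁻ ρ (0 - ‖z‖ • (y : 𝔼)) = 𝓕⁻ ρ z := by
    intro y
    have hn : ‖(0 - ‖z‖ • (y : 𝔼))‖ = ‖z‖ := by simp [norm_smul]
    set L := (ℝ ∙ ((0 - ‖z‖ • (y : 𝔼)) - z))ᗮ.reflection
    have hL : L (0 - ‖z‖ • (y : 𝔼)) = z := Submodule.reflection_sub hn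
    have hρL : ρ ∘ L = ρ := funext fun x => hrad _ _ (by simp)
    have h := Real.fourierInv_comp_linearIsometry L ρ (0 - ‖z‖ • (y : 𝔼))
    rwa [hρL, hL] at h
  have h := integral_sphere_fourierInv hρ ‖z‖ 0
  simp_rw [hinv] at h
  simp only [integral_const, probReal_univ, one_smul] at h
  rw [h]
  refine (norm_fourierInv_le _ _).trans_eq ?_
  congr with ξ
  rw [norm_mul, Complex.norm_real, Real.norm_eq_abs]

/-- Serves two purposes: it carries the support property of products of `mult` over to `multDeriv`,
and it gives the fundamental theorem of calculus inside a grid cell. -/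
lemma hasDerivAt_fourierInv_profile {p : 𝔼 → ℂ} (hp : Integrable p)
    (hp' : Integrable fun ξ => (‖ξ‖ : ℂ) * p ξ) (z : 𝔼) (t : ℝ) :
    HasDerivAt (fun t => 𝓕⁻ (fun ξ => (sphereProfile d (2 * π * t * ‖ξ‖) : ℂ) * p ξ) z)
      (𝓕⁻ (fun ξ => ((2 * π * ‖ξ‖ * sphereProfileDeriv d (2 * π * t * ‖ξ‖) : ℝ) : ℂ) * p ξ) z) t := by
  simp_rw [fourierInv_eq]
  have hchar : AEStronglyMeasurable (fun ξ : 𝔼 => 𝐞 (inner ℝ ξ z)) volume :=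
    (Real.continuous_fourierChar.comp (by fun_prop)).aestronglyMeasurable
  have hU : ∀ s, AEStronglyMeasurable (fun ξ : 𝔼 => (sphereProfile d (2 * π * s * ‖ξ‖) : ℂ)) volume :=
    fun s => (Complex.continuous_ofReal.comp
      (continuous_sphereProfile.comp (by fun_prop))).aestronglyMeasurable
  have hU' : AEStronglyMeasurable (fun ξ : 𝔼 =>
      ((2 * π * ‖ξ‖ * sphereProfileDeriv d (2 * π * t * ‖ξ‖) : ℝ) : ℂ)) volume :=
    (Complex.continuous_ofReal.comp (((continuous_const.mul continuous_norm)).mul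
      (continuous_sphereProfileDeriv.comp (by fun_prop)))).aestronglyMeasurable
  refine (hasDerivAt_integral_of_dominated_loc_of_deriv_le (s := univ) Filter.univ_mem
    (F' := fun s ξ => 𝐞 (inner ℝ ξ z) •
      (((2 * π * ‖ξ‖ * sphereProfileDeriv d (2 * π * s * ‖ξ‖) : ℝ) : ℂ) * p ξ))
    (bound := fun ξ => 2 * π * ‖(‖ξ‖ : ℂ) * p ξ‖)
    (Filter.Eventually.of_forall fun s => hchar.smul ((hU s).mul hp.1)) ?_
    (hchar.smul (hU'.mul hp.1)) ?_ (hp'.norm.const_mul _) ?_).2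
  · refine hp.mono (hchar.smul ((hU t).mul hp.1)) (Filter.Eventually.of_forall fun ξ => ?_)
    change ‖𝐞 (inner ℝ ξ z) • ((sphereProfile d (2 * π * t * ‖ξ‖) : ℂ) * p ξ)‖ ≤ _
    rw [Circle.norm_smul, norm_mul, Complex.norm_real]
    exact mul_le_of_le_one_left (norm_nonneg _) (abs_sphereProfile_le_one _)
  · refine Filter.Eventually.of_forall fun ξ s _ => ?_
    rw [Circle.norm_smul, norm_mul, norm_mul, Complex.norm_real, Complex.norm_real, norm_norm, norm_mul,
      Real.norm_of_nonneg (by positivity : 0 ≤ 2 * π * ‖ξ‖), ← mul_assoc]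
    exact mul_le_mul_of_nonneg_right
      (mul_le_of_le_one_right (by positivity) (abs_sphereProfileDeriv_le_one _)) (norm_nonneg _)
  · refine Filter.Eventually.of_forall fun ξ s _ => ?_
    have h1 : HasDerivAt (fun s : ℝ => sphereProfile d (2 * π * s * ‖ξ‖))
        (2 * π * ‖ξ‖ * sphereProfileDeriv d (2 * π * s * ‖ξ‖)) s := by
      have h2 : HasDerivAt (fun s : ℝ => 2 * π * s * ‖ξ‖) (2 * π * ‖ξ‖) s := by
        refine HasDerivAt.congr_deriv (((hasDerivAt_id s).const_mul (2 * π)).mul_const ‖ξ‖) ?_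
        ring
      refine HasDerivAt.congr_deriv ((hasDerivAt_sphereProfile _).comp s h2) ?_
      ring
    simp only [Circle.smul_def, smul_eq_mul]
    exact (h1.ofReal_comp.mul_const (p ξ)).const_mul _

end Multiplier
end SphericalMax

namespace SphericalMax

/-! ### The kernel of a product of two localized multipliers. -/

section Kernel

open Real FourierTransform Metric

variable {d : ℕ}

local notation "𝔼" => EuclideanSpace ℝ (Fin d)

/-- The weight that dominates frequency-localized multipliers. -/
noncomputable def weight (u : 𝔼) : ℝ := ‖u‖ ^ d / (1 + ‖u‖) ^ (3 * d)

lemma weight_nonneg (u : 𝔼) : 0 ≤ weight u := by unfold weight; positivity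

lemma continuous_weight : Continuous (weight (d := d)) := by
  unfold weight
  exact (by fun_prop : Continuous fun u : 𝔼 => ‖u‖ ^ d).div (by fun_prop) fun u => by positivity

variable (d) in
/-- The integral that controls all weighted integrals of `weight`. -/
noncomputable def weightConst : ℝ := ∫ u : 𝔼, (1 + ‖u‖) ^ (-(4 * d : ℝ))

lemma weightConst_nonneg : 0 ≤ weightConst d := integral_nonneg fun u => by positivity

variable [NeZero d]

lemma weight_zero : weight (0 : 𝔼) = 0 := by simp [weight, NeZero.ne d]

/-- The numerator ‖u‖^{2d} of the squared weight absorbs the singularity at the origin. The largest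
exponent needed later is c = 3(d-1)/2, which is below 2d. -/
lemma weight_sq_mul_rpow_le {c : ℝ} (hc0 : 0 ≤ c) (hc : c ≤ 2 * d) (u : 𝔼) :
    weight u ^ 2 * ‖u‖ ^ (-c) ≤ (1 + ‖u‖) ^ (-(4 * d : ℝ)) := by
  rcases eq_or_ne u 0 with rfl | hu
  · rw [weight_zero]; simp
  have hu0 : 0 < ‖u‖ := norm_pos_iff.2 hu
  have h1 : (0 : ℝ) < 1 + ‖u‖ := by positivity
  have e1 : weight u ^ 2 = ‖u‖ ^ (2 * d : ℝ) * (1 + ‖u‖) ^ (-(6 * d : ℝ)) := by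
    rw [weight, div_pow, ← pow_mul, ← pow_mul, Real.rpow_neg h1.le, div_eq_mul_inv]
    congr 1
    · rw [← Real.rpow_natCast]; congr 1; push_cast; ring
    · rw [← Real.rpow_natCast]; congr 2; push_cast; ring
  have e2 : ‖u‖ ^ (2 * d : ℝ) * ‖u‖ ^ (-c) ≤ (1 + ‖u‖) ^ (2 * d : ℝ) := by
    rw [← Real.rpow_add hu0]
    calc ‖u‖ ^ (2 * d + -c : ℝ) ≤ (1 + ‖u‖) ^ (2 * d + -c : ℝ) :=
          Real.rpow_le_rpow hu0.le (by linarith) (by linarith)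
      _ ≤ (1 + ‖u‖) ^ (2 * d : ℝ) := Real.rpow_le_rpow_of_exponent_le (by linarith) (by linarith)
  calc weight u ^ 2 * ‖u‖ ^ (-c)
      = (‖u‖ ^ (2 * d : ℝ) * ‖u‖ ^ (-c)) * (1 + ‖u‖) ^ (-(6 * d : ℝ)) := by rw [e1]; ring
    _ ≤ (1 + ‖u‖) ^ (2 * d : ℝ) * (1 + ‖u‖) ^ (-(6 * d : ℝ)) := by gcongr
    _ = _ := by rw [← Real.rpow_add h1]; congr 1; ring

variable (d) in
lemma integrable_one_add_norm_rpow : Integrable (fun u : 𝔼 => (1 + ‖u‖) ^ (-(4 * d : ℝ))) := by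
  refine integrable_one_add_norm ?_
  rw [finrank_euclideanSpace, Fintype.card_fin]
  have : (0 : ℝ) < d := by exact_mod_cast Nat.pos_of_ne_zero (NeZero.ne d)
  linarith

lemma weight_smul_sq_mul_rpow_le {c : ℝ} (hc0 : 0 ≤ c) (hc : c ≤ 2 * d) {δ : ℝ} (hδ : 0 < δ) (ξ : 𝔼) :
    weight (δ • ξ) ^ 2 * ‖ξ‖ ^ (-c) ≤ δ ^ c * (1 + ‖δ • ξ‖) ^ (-(4 * d : ℝ)) := by
  have h := weight_sq_mul_rpow_le hc0 hc (δ • ξ)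
  have e : ‖ξ‖ ^ (-c) = δ ^ c * ‖δ • ξ‖ ^ (-c) := by
    rw [norm_smul, Real.norm_of_nonneg hδ.le, Real.mul_rpow hδ.le (norm_nonneg _), ← mul_assoc,
      ← Real.rpow_add hδ]
    simp
  rw [e]
  calc _ = δ ^ c * (weight (δ • ξ) ^ 2 * ‖δ • ξ‖ ^ (-c)) := by ring
    _ ≤ _ := by gcongr

lemma integrable_weight_smul_sq {c : ℝ} (hc0 : 0 ≤ c) (hc : c ≤ 2 * d) {δ : ℝ} (hδ : 0 < δ) :
    Integrable (fun ξ : 𝔼 => weight (δ • ξ) ^ 2 * ‖ξ‖ ^ (-c)) := by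
  refine (((integrable_one_add_norm_rpow d).comp_smul hδ.ne').const_mul (δ ^ c)).mono' ?_
    (Filter.Eventually.of_forall fun ξ => ?_)
  · refine Measurable.aestronglyMeasurable ?_
    exact ((continuous_weight.comp (by fun_prop)).measurable.pow_const 2).mul
      (measurable_norm.pow_const _)
  · have := weight_nonneg (δ • ξ)
    rw [Real.norm_of_nonneg (by positivity)]
    exact weight_smul_sq_mul_rpow_le hc0 hc hδ ξ

lemma integral_weight_smul_sq_le {c : ℝ} (hc0 : 0 ≤ c) (hc : c ≤ 2 * d) {δ : ℝ} (hδ : 0 < δ) :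
    ∫ ξ : 𝔼, weight (δ • ξ) ^ 2 * ‖ξ‖ ^ (-c) ≤ weightConst d * δ ^ (c - d) := by
  refine (integral_mono (integrable_weight_smul_sq hc0 hc hδ)
    (((integrable_one_add_norm_rpow d).comp_smul hδ.ne').const_mul (δ ^ c))
    fun ξ => weight_smul_sq_mul_rpow_le hc0 hc hδ ξ).trans_eq ?_
  rw [integral_const_mul, Measure.integral_comp_smul (volume : Measure 𝔼)
    (fun u => (1 + ‖u‖) ^ (-(4 * d : ℝ))), finrank_euclideanSpace, Fintype.card_fin,
    abs_of_pos (by positivity), Real.rpow_sub hδ, Real.rpow_natCast, smul_eq_mul, weightConst]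
  ring

lemma weight_le_rpow (u : 𝔼) : weight u ≤ (1 + ‖u‖) ^ (-(2 * d : ℝ)) := by
  have h := weight_sq_mul_rpow_le (le_refl (0 : ℝ)) (by positivity) u
  simp only [neg_zero, Real.rpow_zero, mul_one] at h
  refine le_of_sq_le_sq ?_ (by positivity)
  refine h.trans_eq ?_
  rw [← Real.rpow_natCast, ← Real.rpow_mul (by positivity)]
  congr 1; push_cast; ring

lemma integrable_weight_smul {δ : ℝ} (hδ : 0 < δ) : Integrable (fun ξ : 𝔼 => weight (δ • ξ)) := by
  have hd : (0 : ℝ) < d := by exact_mod_cast Nat.pos_of_ne_zero (NeZero.ne d)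
  have h : Integrable (fun u : 𝔼 => (1 + ‖u‖) ^ (-(2 * d : ℝ))) := by
    refine integrable_one_add_norm ?_
    rw [finrank_euclideanSpace, Fintype.card_fin]
    linarith
  have h2 : Integrable (weight (d := d)) := h.mono' continuous_weight.aestronglyMeasurable
    (Filter.Eventually.of_forall fun u => by
      rw [Real.norm_of_nonneg (weight_nonneg u)]; exact weight_le_rpow u)
  exact h2.comp_smul hδ.ne'

/-- The size conditions on the multipliers of frequency `1/δ`. -/
structure IsLocalized (C δ : ℝ) (m : 𝔼 → ℝ) : Prop where
  continuous : Continuous m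
  radial : ∀ ξ η, ‖ξ‖ = ‖η‖ → m ξ = m η
  abs_le : ∀ ξ, |m ξ| ≤ C * weight (δ • ξ)
  abs_le_rpow : ∀ ξ, |m ξ| ≤ C * (weight (δ • ξ) * ‖ξ‖ ^ (-(((d : ℝ) - 1) / 2)))

namespace IsLocalized

variable {C δ : ℝ} {m m' : EuclideanSpace ℝ (Fin d) → ℝ}

lemma integrable (h : IsLocalized C δ m) (hδ : 0 < δ) : Integrable m :=
  ((integrable_weight_smul hδ).const_mul C).mono' h.continuous.aestronglyMeasurable
    (Filter.Eventually.of_forall h.abs_le)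

lemma one_le_dim : (1 : ℝ) ≤ d := by exact_mod_cast Nat.one_le_iff_ne_zero.2 (NeZero.ne d)

lemma abs_mul_le (h : IsLocalized C δ m) (h' : IsLocalized C δ m') (ξ : 𝔼) :
    |m ξ * m' ξ| ≤ C ^ 2 * (weight (δ • ξ) ^ 2 * ‖ξ‖ ^ (-((d : ℝ) - 1))) := by
  rw [abs_mul]
  refine (mul_le_mul (h.abs_le_rpow ξ) (h'.abs_le_rpow ξ) (abs_nonneg _)
    ((abs_nonneg _).trans (h.abs_le_rpow ξ))).trans_eq ?_
  have e : ‖ξ‖ ^ (-((d : ℝ) - 1)) = ‖ξ‖ ^ (-(((d : ℝ) - 1) / 2)) * ‖ξ‖ ^ (-(((d : ℝ) - 1) / 2)) := by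
    rw [← sq, ← Real.rpow_natCast, ← Real.rpow_mul (norm_nonneg _)]
    congr 1; push_cast; ring
  rw [e]
  ring

/-- The weight concentrates on ‖ξ‖ ~ 1/δ, where the squared decay ‖ξ‖^{-(d-1)} of the sphere
transform is δ^{d-1}. This is the L² gain of the T T* argument. -/
lemma sq_le (h : IsLocalized C δ m) (hδ : 0 < δ) (ξ : 𝔼) : m ξ ^ 2 ≤ C ^ 2 * δ ^ ((d : ℝ) - 1) := by
  have h1 := h.abs_mul_le h ξ
  rw [← sq, abs_of_nonneg (sq_nonneg _)] at h1
  have hd := one_le_dim (d := d)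
  have h2 := weight_smul_sq_mul_rpow_le (c := (d : ℝ) - 1) (by linarith) (by linarith) hδ ξ
  have h3 : (1 + ‖δ • ξ‖) ^ (-(4 * d : ℝ)) ≤ 1 :=
    Real.rpow_le_one_of_one_le_of_nonpos (by linarith [norm_nonneg (δ • ξ)]) (by linarith)
  refine h1.trans (mul_le_mul_of_nonneg_left (h2.trans ?_) (sq_nonneg _))
  exact mul_le_of_le_one_right (by positivity) h3

end IsLocalized

variable (d) in
/-- The kernel estimate. -/
lemma exists_kernel_bound (C R : ℝ) (hC : 0 < C) (hR : 0 < R) : ∃ X : ℝ, 0 < X ∧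
    ∀ (δ : ℝ) (m m' : 𝔼 → ℝ) (τ : ℝ), 0 < δ → IsLocalized C δ m → IsLocalized C δ m' → 0 ≤ τ →
      (∀ z, ‖z‖ < τ * δ - 2 * R * δ → 𝓕⁻ (fun ξ => ((m ξ * m' ξ : ℝ) : ℂ)) z = 0) →
      ∀ z, ‖𝓕⁻ (fun ξ => ((m ξ * m' ξ : ℝ) : ℂ)) z‖ ≤
        X * δ⁻¹ * (1 + τ) ^ (-(((d : ℝ) - 1) / 2)) := by
  obtain ⟨B, hB, hU⟩ := exists_sphereProfile_bound d
  set b : ℝ := ((d : ℝ) - 1) / 2 with hb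
  have hd := IsLocalized.one_le_dim (d := d)
  have hb0 : 0 ≤ b := by rw [hb]; linarith
  have hI := weightConst_nonneg (d := d)
  set I := weightConst d with hIdef
  set X₁ : ℝ := C ^ 2 * I * (1 + 4 * R) ^ b with hX₁
  set X₂ : ℝ := B * C ^ 2 * I * (2 * (1 + 1 / (4 * R))) ^ b with hX₂
  refine ⟨X₁ + X₂ + 1, by positivity, fun δ m m' τ hδ hm hm' hτ hvan z => ?_⟩
  have hρi : Integrable (fun ξ => ((m ξ * m' ξ : ℝ) : ℂ)) := by
    refine Integrable.ofReal (((integrable_weight_smul_sq (c := (d : ℝ) - 1) (by linarith) (by linarith)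
      hδ).const_mul (C ^ 2)).mono' (hm.continuous.mul hm'.continuous).aestronglyMeasurable
      (Filter.Eventually.of_forall fun ξ => hm.abs_mul_le hm' ξ))
  have hτ1 : 0 < 1 + τ := by linarith
  have hX1 : 0 ≤ X₁ := by positivity
  have hX2 : 0 ≤ X₂ := by positivity
  -- For nearby radii no decay in τ is needed, and the L¹ norm of the multiplier gives δ^{-1}. For τ
  -- > 4R the kernel vanishes unless ‖z‖ ≥ (τ - 2R)δ ≥ τδ/2, so decay in ‖z‖ becomes decay in τ.
  rcases le_or_gt τ (4 * R) with h4 | h4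
  · calc ‖𝓕⁻ (fun ξ => ((m ξ * m' ξ : ℝ) : ℂ)) z‖ ≤ ∫ ξ, ‖((m ξ * m' ξ : ℝ) : ℂ)‖ :=
          norm_fourierInv_le _ _
      _ ≤ ∫ ξ, C ^ 2 * (weight (δ • ξ) ^ 2 * ‖ξ‖ ^ (-((d : ℝ) - 1))) := by
          refine integral_mono hρi.norm ((integrable_weight_smul_sq (c := (d : ℝ) - 1) (by linarith)
            (by linarith) hδ).const_mul (C ^ 2)) fun ξ => ?_
          simp only [Complex.norm_real, Real.norm_eq_abs]
          exact hm.abs_mul_le hm' ξ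
      _ ≤ C ^ 2 * (I * δ ^ ((d : ℝ) - 1 - d)) := by
          rw [integral_const_mul]
          gcongr
          exact integral_weight_smul_sq_le (by linarith) (by linarith) hδ
      _ = C ^ 2 * I * δ⁻¹ * 1 := by
          rw [show (d : ℝ) - 1 - d = -1 by ring, Real.rpow_neg_one]; ring
      _ ≤ C ^ 2 * I * δ⁻¹ * ((1 + 4 * R) ^ b * (1 + τ) ^ (-b)) := by
          gcongr
          rw [Real.rpow_neg hτ1.le, ← div_eq_mul_inv, one_le_div (by positivity)]
          gcongr
      _ = X₁ * δ⁻¹ * (1 + τ) ^ (-b) := by rw [hX₁]; ring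
      _ ≤ _ := by
          gcongr
          linarith
  · rcases lt_or_ge ‖z‖ (τ * δ - 2 * R * δ) with hz | hz
    · rw [hvan z hz, norm_zero]; positivity
    have hz2 : (2 * (1 + 1 / (4 * R)))⁻¹ * ((1 + τ) * δ) ≤ ‖z‖ := by
      have h1 : 1 + τ ≤ (1 + 1 / (4 * R)) * τ := by
        have : 1 ≤ 1 / (4 * R) * τ := by
          rw [one_div, inv_mul_eq_div, one_le_div (by positivity)]; exact h4.le
        linarith
      have h2 : τ * δ / 2 ≤ ‖z‖ := by nlinarith
      refine le_trans ?_ h2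
      rw [inv_mul_le_iff₀ (by positivity)]
      nlinarith
    have hz0 : 0 < ‖z‖ := lt_of_lt_of_le (by positivity) hz2
    have hi3 := integrable_weight_smul_sq (d := d) (c := 3 * b) (by linarith)
      (by rw [hb]; linarith) hδ
    -- Rotational averaging adds a third decaying factor to those of m and m', for a total of
    -- ‖ξ‖^{-3b}. Integration then yields ‖z‖^{-b} δ^{3b-d}, and with ‖z‖ ≳ (1+τ)δ the power of δ is
    -- 2b - d = -1.
    have hpt : ∀ ξ : 𝔼, |sphereProfile d (2 * π * ‖z‖ * ‖ξ‖)| * ‖((m ξ * m' ξ : ℝ) : ℂ)‖ ≤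
        B * ‖z‖ ^ (-b) * C ^ 2 * (weight (δ • ξ) ^ 2 * ‖ξ‖ ^ (-(3 * b))) := by
      intro ξ
      rcases eq_or_ne ξ 0 with rfl | hξ
      · have h0 : m 0 = 0 := by
          have := hm.abs_le 0
          rw [smul_zero, weight_zero, mul_zero] at this
          exact abs_nonpos_iff.1 this
        rw [h0, smul_zero, weight_zero]
        simp
      have hξ0 : 0 < ‖ξ‖ := norm_pos_iff.2 hξ
      have u1 : |sphereProfile d (2 * π * ‖z‖ * ‖ξ‖)| ≤ B * (‖z‖ ^ (-b) * ‖ξ‖ ^ (-b)) := by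
        refine (hU _ (by positivity)).1.trans ?_
        rw [← Real.mul_rpow hz0.le hξ0.le]
        gcongr B * ?_
        refine Real.rpow_le_rpow_of_nonpos (by positivity) ?_ (by linarith)
        have : 1 ≤ 2 * π := by linarith [Real.pi_gt_three]
        rw [mul_assoc]
        exact le_mul_of_one_le_left (by positivity) this
      have u2 := hm.abs_mul_le hm' ξ
      rw [Complex.norm_real, Real.norm_eq_abs]
      calc _ ≤ B * (‖z‖ ^ (-b) * ‖ξ‖ ^ (-b)) *
            (C ^ 2 * (weight (δ • ξ) ^ 2 * ‖ξ‖ ^ (-((d : ℝ) - 1)))) := by gcongr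
        _ = B * ‖z‖ ^ (-b) * C ^ 2 * (weight (δ • ξ) ^ 2 * (‖ξ‖ ^ (-b) * ‖ξ‖ ^ (-((d : ℝ) - 1)))) := by
            ring
        _ = _ := by
            rw [← Real.rpow_add hξ0]
            congr 3
            rw [hb]; ring
    have hrad : ∀ ξ η, ‖ξ‖ = ‖η‖ → ((m ξ * m' ξ : ℝ) : ℂ) = ((m η * m' η : ℝ) : ℂ) := by
      intro ξ η h
      rw [hm.radial ξ η h, hm'.radial ξ η h]
    calc ‖𝓕⁻ (fun ξ => ((m ξ * m' ξ : ℝ) : ℂ)) z‖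
        ≤ ∫ ξ, |sphereProfile d (2 * π * ‖z‖ * ‖ξ‖)| * ‖((m ξ * m' ξ : ℝ) : ℂ)‖ :=
          norm_fourierInv_radial_le hρi hrad z
      _ ≤ ∫ ξ, B * ‖z‖ ^ (-b) * C ^ 2 * (weight (δ • ξ) ^ 2 * ‖ξ‖ ^ (-(3 * b))) :=
          integral_mono_of_nonneg (Filter.Eventually.of_forall fun ξ => by positivity)
            (hi3.const_mul _) (Filter.Eventually.of_forall hpt)
      _ ≤ B * ‖z‖ ^ (-b) * C ^ 2 * (I * δ ^ (3 * b - d)) := by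
          rw [integral_const_mul]
          gcongr
          exact integral_weight_smul_sq_le (by linarith) (by rw [hb]; linarith) hδ
      _ ≤ B * ((2 * (1 + 1 / (4 * R)))⁻¹ * ((1 + τ) * δ)) ^ (-b) * C ^ 2 * (I * δ ^ (3 * b - d)) := by
          have := Real.rpow_le_rpow_of_nonpos (z := -b) (by positivity) hz2 (by linarith)
          gcongr
      _ = X₂ * (δ ^ (-b) * δ ^ (3 * b - d)) * (1 + τ) ^ (-b) := by
          rw [Real.mul_rpow (by positivity) (by positivity), Real.mul_rpow hτ1.le hδ.le,
            Real.inv_rpow (by positivity), Real.rpow_neg (by positivity) b, inv_inv, hX₂]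
          ring
      _ = X₂ * δ⁻¹ * (1 + τ) ^ (-b) := by
          rw [← Real.rpow_add hδ, ← Real.rpow_neg_one]
          congr 3
          rw [hb]; ring
      _ ≤ _ := by
          gcongr
          linarith

end Kernel
end SphericalMax

namespace SphericalMax

/-! ### The T T* bound at one frequency for radii on a grid. -/

section Level

open Real FourierTransform Metric

variable {d : ℕ} [NeZero d]

local notation "𝔼" => EuclideanSpace ℝ (Fin d)

namespace Mollifier

variable (M : Mollifier d)

/-- The multiplier of the frequency-localized spherical mean. -/
noncomputable def mult (δ t : ℝ) (ξ : 𝔼) : ℝ := sphereProfile d (2 * π * t * ‖ξ‖) * M.Q (δ • ξ)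

/-- The multiplier of the (rescaled) `t`-derivative of the frequency-localized spherical mean. -/
noncomputable def multDeriv (δ t : ℝ) (ξ : 𝔼) : ℝ :=
  2 * π * ‖δ • ξ‖ * sphereProfileDeriv d (2 * π * t * ‖ξ‖) * M.Q (δ • ξ)

lemma abs_Q_le (u : 𝔼) : (1 + 2 * π * ‖u‖) * |M.Q u| ≤ M.C * weight u := M.decay u

lemma abs_mult_le (δ t : ℝ) (ξ : 𝔼) :
    |M.mult δ t ξ| ≤ |sphereProfile d (2 * π * t * ‖ξ‖)| * (M.C * weight (δ • ξ)) := by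
  rw [mult, abs_mul]
  refine mul_le_mul_of_nonneg_left (le_trans ?_ (M.abs_Q_le _)) (abs_nonneg _)
  exact le_mul_of_one_le_left (abs_nonneg _) (le_add_of_nonneg_right (by positivity))

lemma abs_multDeriv_le (δ t : ℝ) (ξ : 𝔼) :
    |M.multDeriv δ t ξ| ≤ |sphereProfileDeriv d (2 * π * t * ‖ξ‖)| * (M.C * weight (δ • ξ)) := by
  have e : |M.multDeriv δ t ξ| = |sphereProfileDeriv d (2 * π * t * ‖ξ‖)| *
      (2 * π * ‖δ • ξ‖ * |M.Q (δ • ξ)|) := by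
    rw [multDeriv, abs_mul, abs_mul, abs_of_nonneg (by positivity : 0 ≤ 2 * π * ‖δ • ξ‖)]
    ring
  rw [e]
  refine mul_le_mul_of_nonneg_left (le_trans ?_ (M.abs_Q_le _)) (abs_nonneg _)
  exact mul_le_mul_of_nonneg_right (by linarith) (abs_nonneg _)

/-- Common to the mean and its radial derivative, whose profiles U and U' have the same size and
decay. The bound t ≥ 1/2 ensures 2πt ≥ 1, so that decay in 2πt‖ξ‖ is at least decay in ‖ξ‖. -/
lemma isLocalized_of_profile_bound {B δ t : ℝ} (hB : 0 < B) (ht : 1 / 2 ≤ t) {m : 𝔼 → ℝ} {u : ℝ → ℝ}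
    (hm : Continuous m) (hrad : ∀ ξ η, ‖ξ‖ = ‖η‖ → m ξ = m η) (hu1 : ∀ r, |u r| ≤ 1)
    (hu2 : ∀ r, 0 < r → |u r| ≤ B * r ^ (-(((d : ℝ) - 1) / 2)))
    (hmu : ∀ ξ, |m ξ| ≤ |u (2 * π * t * ‖ξ‖)| * (M.C * weight (δ • ξ))) :
    IsLocalized ((1 + B) * M.C) δ m := by
  have hd := IsLocalized.one_le_dim (d := d)
  have hC := M.C_pos
  have hw : ∀ ξ : 𝔼, 0 ≤ M.C * weight (δ • ξ) := fun ξ => mul_nonneg hC.le (weight_nonneg _)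
  refine ⟨hm, hrad, fun ξ => ?_, fun ξ => ?_⟩
  · refine (hmu ξ).trans ?_
    calc _ ≤ (1 + B) * (M.C * weight (δ • ξ)) :=
          mul_le_mul_of_nonneg_right ((hu1 _).trans (by linarith)) (hw ξ)
      _ = _ := by ring
  · rcases eq_or_ne ξ 0 with rfl | hξ
    · refine (hmu 0).trans ?_
      rw [smul_zero, weight_zero]; simp
    · have hξ0 : 0 < ‖ξ‖ := norm_pos_iff.2 hξ
      have hpow : (2 * π * t * ‖ξ‖) ^ (-(((d : ℝ) - 1) / 2)) ≤ ‖ξ‖ ^ (-(((d : ℝ) - 1) / 2)) := by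
        refine Real.rpow_le_rpow_of_nonpos hξ0 ?_ (by linarith)
        refine le_mul_of_one_le_left hξ0.le ?_
        nlinarith [Real.pi_gt_three]
      have h0 : 0 < 2 * π * t * ‖ξ‖ := by
        have := Real.pi_pos
        positivity
      refine (hmu ξ).trans ?_
      have h1 : |u (2 * π * t * ‖ξ‖)| ≤ (1 + B) * ‖ξ‖ ^ (-(((d : ℝ) - 1) / 2)) := by
        refine (hu2 _ h0).trans ?_
        exact mul_le_mul (by linarith) hpow (by positivity) (by positivity)
      calc _ ≤ (1 + B) * ‖ξ‖ ^ (-(((d : ℝ) - 1) / 2)) * (M.C * weight (δ • ξ)) :=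
            mul_le_mul_of_nonneg_right h1 (hw ξ)
        _ = _ := by ring

lemma continuous_mult (δ t : ℝ) : Continuous (M.mult δ t) := by
  unfold mult
  exact (continuous_sphereProfile.comp (by fun_prop)).mul (M.continuous_Q.comp (by fun_prop))

lemma continuous_multDeriv (δ t : ℝ) : Continuous (M.multDeriv δ t) := by
  unfold multDeriv
  exact ((by fun_prop : Continuous fun ξ : 𝔼 => 2 * π * ‖δ • ξ‖).mul
    (continuous_sphereProfileDeriv.comp (by fun_prop))).mul (M.continuous_Q.comp (by fun_prop))

lemma Q_smul_radial (δ : ℝ) {ξ η : 𝔼} (h : ‖ξ‖ = ‖η‖) : M.Q (δ • ξ) = M.Q (δ • η) :=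
  M.Q_radial (by rw [norm_smul, norm_smul, h])

lemma exists_isLocalized : ∃ C : ℝ, 0 < C ∧ ∀ δ t : ℝ, 1 / 2 ≤ t →
    IsLocalized C δ (M.mult δ t) ∧ IsLocalized C δ (M.multDeriv δ t) := by
  obtain ⟨B, hB, hU⟩ := exists_sphereProfile_bound d
  refine ⟨(1 + B) * M.C, mul_pos (by linarith) M.C_pos, fun δ t ht => ⟨?_, ?_⟩⟩
  · refine M.isLocalized_of_profile_bound hB ht (M.continuous_mult δ t) (fun ξ η h => ?_)
      abs_sphereProfile_le_one (fun r hr => (hU r hr).1) (M.abs_mult_le δ t)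
    simp only [mult, h, M.Q_smul_radial δ h]
  · refine M.isLocalized_of_profile_bound hB ht (M.continuous_multDeriv δ t) (fun ξ η h => ?_)
      abs_sphereProfileDeriv_le_one (fun r hr => (hU r hr).2) (M.abs_multDeriv_le δ t)
    simp only [multDeriv, norm_smul, h, M.Q_smul_radial δ h]

/-- Differentiating once in each of the two radii costs a factor ‖ξ‖ each, whence k ≤ 2; the two
factors 1 + 2π‖u‖ in the decay of Q² pay for them. -/
lemma integrable_norm_pow_mul_Q_sq {δ : ℝ} (hδ : 0 < δ) {k : ℕ} (hk : k ≤ 2) :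
    Integrable (fun ξ : 𝔼 => ‖ξ‖ ^ k * M.Q (δ • ξ) ^ 2) := by
  have hC := M.C_pos
  have hi := integrable_weight_smul_sq (d := d) (le_refl (0 : ℝ)) (by positivity) hδ
  simp only [neg_zero, Real.rpow_zero, mul_one] at hi
  refine (hi.const_mul ((δ ^ k)⁻¹ * M.C ^ 2)).mono' ?_ (Filter.Eventually.of_forall fun ξ => ?_)
  · exact ((continuous_norm.pow k).mul ((M.continuous_Q.comp (by fun_prop)).pow 2)).aestronglyMeasurable
  · rw [Real.norm_of_nonneg (by positivity), mul_assoc, ← mul_pow, inv_mul_eq_div,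
      le_div_iff₀ (by positivity)]
    have h1 : ‖δ • ξ‖ ^ k ≤ (1 + 2 * π * ‖δ • ξ‖) ^ 2 := by
      have h2 : ‖δ • ξ‖ ≤ 1 + 2 * π * ‖δ • ξ‖ := by
        nlinarith [Real.pi_gt_three, norm_nonneg (δ • ξ)]
      calc ‖δ • ξ‖ ^ k ≤ (1 + 2 * π * ‖δ • ξ‖) ^ k := by gcongr
        _ ≤ _ := pow_le_pow_right₀ (le_add_of_nonneg_right (by positivity)) hk
    have e : ‖ξ‖ ^ k * M.Q (δ • ξ) ^ 2 * δ ^ k = ‖δ • ξ‖ ^ k * |M.Q (δ • ξ)| ^ 2 := by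
      rw [norm_smul, Real.norm_of_nonneg hδ.le, mul_pow, sq_abs]; ring
    rw [e]
    calc _ ≤ (1 + 2 * π * ‖δ • ξ‖) ^ 2 * |M.Q (δ • ξ)| ^ 2 := by gcongr
      _ = ((1 + 2 * π * ‖δ • ξ‖) * |M.Q (δ • ξ)|) ^ 2 := by ring
      _ ≤ _ := by
        have := M.abs_Q_le (δ • ξ)
        gcongr

/-- A double spherical mean of the kernel of Q², which lives in the ball of radius 2Rδ. It is
evaluated at points z - ty - t'y' of norm at least |t-t'| - ‖z‖, outside that ball. -/
lemma fourierInv_profile_mul_eq_zero {δ t t' : ℝ} (hδ : 0 < δ) (ht : 0 ≤ t) (ht' : 0 ≤ t') {z : 𝔼}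
    (hz : ‖z‖ < |t - t'| - 2 * M.R * δ) :
    𝓕⁻ (fun ξ => (sphereProfile d (2 * π * t * ‖ξ‖) : ℂ) *
      ((sphereProfile d (2 * π * t' * ‖ξ‖) : ℂ) * ((M.Q (δ • ξ) ^ 2 : ℝ) : ℂ))) z = 0 := by
  have hi : Integrable (fun ξ : 𝔼 => ((M.Q (δ • ξ) ^ 2 : ℝ) : ℂ)) := by
    have := M.integrable_norm_pow_mul_Q_sq hδ (k := 0) (by norm_num)
    simp only [pow_zero, one_mul] at this
    exact this.ofReal
  have hi' : Integrable (fun ξ : 𝔼 => (sphereProfile d (2 * π * t' * ‖ξ‖) : ℂ) *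
      ((M.Q (δ • ξ) ^ 2 : ℝ) : ℂ)) := by
    refine hi.bdd_mul (c := 1) (Complex.continuous_ofReal.comp
      (continuous_sphereProfile.comp (by fun_prop))).aestronglyMeasurable
      (Filter.Eventually.of_forall fun ξ => ?_)
    rw [Complex.norm_real]
    exact abs_sphereProfile_le_one _
  rw [← integral_sphere_fourierInv hi']
  refine integral_eq_zero_of_ae (Filter.Eventually.of_forall fun y => ?_)
  simp only [Pi.zero_apply]
  rw [← integral_sphere_fourierInv hi]
  refine integral_eq_zero_of_ae (Filter.Eventually.of_forall fun y' => ?_)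
  refine M.fourierInv_Q_sq_eq_zero hδ ?_
  have h1 : ‖t • (y : 𝔼)‖ = t := by simp [norm_smul, abs_of_nonneg ht]
  have h2 : ‖t' • (y' : 𝔼)‖ = t' := by simp [norm_smul, abs_of_nonneg ht']
  have h3 := abs_norm_sub_norm_le (t • (y : 𝔼)) (-(t' • (y' : 𝔼)))
  rw [norm_neg, h1, h2, sub_neg_eq_add] at h3
  have h4 : ‖t • (y : 𝔼) + t' • (y' : 𝔼)‖ ≤ ‖z‖ + ‖z - t • (y : 𝔼) - t' • (y' : 𝔼)‖ := by
    have e : t • (y : 𝔼) + t' • (y' : 𝔼) = z - (z - t • (y : 𝔼) - t' • (y' : 𝔼)) := by abel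
    rw [e]
    exact norm_sub_le _ _
  linarith

lemma fourierInv_mult_mul_eq_zero {δ t t' : ℝ} (hδ : 0 < δ) (ht : 0 < t) (ht' : 0 < t') {z : 𝔼}
    (hz : ‖z‖ < |t - t'| - 2 * M.R * δ) :
    𝓕⁻ (fun ξ => ((M.mult δ t ξ * M.mult δ t' ξ : ℝ) : ℂ)) z = 0 := by
  rw [← M.fourierInv_profile_mul_eq_zero hδ ht.le ht'.le hz, fourierInv_eq, fourierInv_eq]
  congr with ξ
  simp only [mult]
  push_cast
  ring_nf

/-- The condition on z is open in t and t', so the vanishing of the undifferentiated kernel persists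
nearby and may be differentiated, first in t and then in t'. -/
lemma fourierInv_multDeriv_mul_eq_zero {δ t t' : ℝ} (hδ : 0 < δ) (ht : 0 < t) (ht' : 0 < t') {z : 𝔼}
    (hz : ‖z‖ < |t - t'| - 2 * M.R * δ) :
    𝓕⁻ (fun ξ => ((M.multDeriv δ t ξ * M.multDeriv δ t' ξ : ℝ) : ℂ)) z = 0 := by
  have hq : ∀ k ≤ 2, Integrable (fun ξ : 𝔼 => ((‖ξ‖ ^ k * M.Q (δ • ξ) ^ 2 : ℝ) : ℂ)) := fun k hk =>
    (M.integrable_norm_pow_mul_Q_sq hδ hk).ofReal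
  have hUc : ∀ s, Continuous fun ξ : 𝔼 => (sphereProfile d (2 * π * s * ‖ξ‖) : ℂ) := fun s =>
    Complex.continuous_ofReal.comp (continuous_sphereProfile.comp (by fun_prop))
  have hVc : ∀ s, Continuous fun ξ : 𝔼 => (sphereProfileDeriv d (2 * π * s * ‖ξ‖) : ℂ) := fun s =>
    Complex.continuous_ofReal.comp (continuous_sphereProfileDeriv.comp (by fun_prop))
  have hU : ∀ s, ∀ k ≤ 2, Integrable (fun ξ : 𝔼 => (sphereProfile d (2 * π * s * ‖ξ‖) : ℂ) *
      ((‖ξ‖ ^ k * M.Q (δ • ξ) ^ 2 : ℝ) : ℂ)) := fun s k hk =>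
    (hq k hk).bdd_mul (c := 1) (hUc s).aestronglyMeasurable (Filter.Eventually.of_forall fun ξ => by
      rw [Complex.norm_real]; exact abs_sphereProfile_le_one _)
  have hV : ∀ s, ∀ k ≤ 2, Integrable (fun ξ : 𝔼 => (sphereProfileDeriv d (2 * π * s * ‖ξ‖) : ℂ) *
      ((‖ξ‖ ^ k * M.Q (δ • ξ) ^ 2 : ℝ) : ℂ)) := fun s k hk =>
    (hq k hk).bdd_mul (c := 1) (hVc s).aestronglyMeasurable (Filter.Eventually.of_forall fun ξ => by
      rw [Complex.norm_real]; exact abs_sphereProfileDeriv_le_one _)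
  have hopen : ∀ a c : ℝ, 0 < a → ‖z‖ < |a - c| - 2 * M.R * δ →
      ∀ᶠ s in nhds a, 0 < s ∧ ‖z‖ < |s - c| - 2 * M.R * δ := by
    intro a c ha h
    refine (lt_mem_nhds ha).and ?_
    exact (by fun_prop : Continuous fun s : ℝ => |s - c| - 2 * M.R * δ).continuousAt.eventually
      (lt_mem_nhds h)
  have h1 : ∀ s', 0 < s' → ‖z‖ < |t - s'| - 2 * M.R * δ →
      𝓕⁻ (fun ξ => ((2 * π * ‖ξ‖ * sphereProfileDeriv d (2 * π * t * ‖ξ‖) : ℝ) : ℂ) *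
        ((sphereProfile d (2 * π * s' * ‖ξ‖) : ℂ) * ((M.Q (δ • ξ) ^ 2 : ℝ) : ℂ))) z = 0 := by
    intro s' hs' hzs
    have hder := hasDerivAt_fourierInv_profile
      (p := fun ξ => (sphereProfile d (2 * π * s' * ‖ξ‖) : ℂ) * ((M.Q (δ • ξ) ^ 2 : ℝ) : ℂ))
      ((hU s' 0 (by norm_num)).congr (Filter.Eventually.of_forall fun ξ => by simp))
      ((hU s' 1 (by norm_num)).congr (Filter.Eventually.of_forall fun ξ => by
        simp only [pow_one]; push_cast; ring)) z t
    refine hder.unique ((hasDerivAt_const t (0 : ℂ)).congr_of_eventuallyEq ?_)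
    filter_upwards [hopen t s' ht hzs] with s hs
    exact M.fourierInv_profile_mul_eq_zero hδ hs.1.le hs'.le hs.2
  have h2 : 𝓕⁻ (fun ξ => ((2 * π * ‖ξ‖ * sphereProfileDeriv d (2 * π * t' * ‖ξ‖) : ℝ) : ℂ) *
      (((2 * π * ‖ξ‖ * sphereProfileDeriv d (2 * π * t * ‖ξ‖) : ℝ) : ℂ) *
        ((M.Q (δ • ξ) ^ 2 : ℝ) : ℂ))) z = 0 := by
    have hder := hasDerivAt_fourierInv_profile
      (p := fun ξ => ((2 * π * ‖ξ‖ * sphereProfileDeriv d (2 * π * t * ‖ξ‖) : ℝ) : ℂ) *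
        ((M.Q (δ • ξ) ^ 2 : ℝ) : ℂ))
      (((hV t 1 (by norm_num)).const_mul (2 * π : ℂ)).congr (Filter.Eventually.of_forall fun ξ => by
        simp only [pow_one]; push_cast; ring))
      (((hV t 2 (by norm_num)).const_mul (2 * π : ℂ)).congr (Filter.Eventually.of_forall fun ξ => by
        simp only; push_cast; ring)) z t'
    refine hder.unique ((hasDerivAt_const t' (0 : ℂ)).congr_of_eventuallyEq ?_)
    filter_upwards [hopen t' t ht' (by rwa [abs_sub_comm])] with s hs
    rw [← h1 s hs.1 (by rw [abs_sub_comm]; exact hs.2), fourierInv_eq, fourierInv_eq]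
    congr with ξ
    ring_nf
  have e : 𝓕⁻ (fun ξ => ((M.multDeriv δ t ξ * M.multDeriv δ t' ξ : ℝ) : ℂ)) z =
      (δ : ℂ) ^ 2 * 𝓕⁻ (fun ξ => ((2 * π * ‖ξ‖ * sphereProfileDeriv d (2 * π * t' * ‖ξ‖) : ℝ) : ℂ) *
      (((2 * π * ‖ξ‖ * sphereProfileDeriv d (2 * π * t * ‖ξ‖) : ℝ) : ℂ) *
        ((M.Q (δ • ξ) ^ 2 : ℝ) : ℂ))) z := by
    rw [fourierInv_eq, fourierInv_eq, ← integral_const_mul]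
    congr with ξ
    simp only [multDeriv, norm_smul, Real.norm_of_nonneg hδ.le, Circle.smul_def, smul_eq_mul]
    push_cast
    ring
  rw [e, h2, mul_zero]

end Mollifier

/-- The square function estimate at a fixed frequency for a separated family of radii. -/
lemma exists_grid_bound (hd : 2 ≤ d) (M : Mollifier d) {C : ℝ} (hC : 0 < C) : ∃ X : ℝ, 0 < X ∧
    ∀ (δ s : ℝ) (m : ℝ → 𝔼 → ℝ) (S : Finset ℤ) (G : ℤ → Set 𝔼) (W N γ : ℝ) (f : 𝔼 → ℂ), 0 < δ →
      (∀ t, 1 / 2 ≤ t → IsLocalized C δ (m t)) →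
      (∀ t t' z, 0 < t → 0 < t' → ‖z‖ < |t - t'| - 2 * M.R * δ →
        𝓕⁻ (fun ξ => ((m t ξ * m t' ξ : ℝ) : ℂ)) z = 0) →
      (∀ n ∈ S, 1 / 2 ≤ (n + s) * δ) → 0 ≤ N → 0 ≤ γ →
      (∀ n : ℤ, ∀ r : ℝ, 1 ≤ r →
        ((S.filter fun n' : ℤ => |(n : ℝ) - n'| ≤ r).card : ℝ) ≤ N * r ^ γ) →
      (∀ n, MeasurableSet (G n)) → (∀ n, volume (G n) ≠ ∞) → 0 < W →
      ∑ n ∈ S, volume.real (G n) ≤ W → Integrable f → MemLp f 2 →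
      (∑ n ∈ S, ∫ x in G n, ‖𝓕⁻ (fun ξ => (m ((n + s) * δ) ξ : ℂ) * 𝓕 f ξ) x‖) ^ 2 ≤
        (∫ x, ‖f x‖ ^ 2) * ((1 + N) * ((X * δ⁻¹ * W ^ 2) ^ (1 - (((d : ℝ) - 1) / 2) / (((d : ℝ) - 1) / 2 + γ)) *
          (X * δ ^ ((d : ℝ) - 1) * W) ^ ((((d : ℝ) - 1) / 2) / (((d : ℝ) - 1) / 2 + γ)))) := by
  obtain ⟨X, hX, hker⟩ := exists_kernel_bound d C M.R hC M.R_pos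
  have hd' : (2 : ℝ) ≤ d := by exact_mod_cast hd
  -- One constant for both inputs of the pair sum: X for the kernel bound, C² for the multiplier
  -- bound.
  refine ⟨X + C ^ 2, by positivity, ?_⟩
  intro δ s m S G W N γ f hδ hloc hvan hS hN hγ hcount hG hGfin hW hGW hf hf2
  have hXX : X * δ⁻¹ ≤ (X + C ^ 2) * δ⁻¹ := by gcongr; linarith [sq_nonneg C]
  have key := sq_sum_setIntegral_multiplier_le (V := 𝔼) (Finset.univ : Finset S)
    (fun n ξ => m (((n : ℤ) + s) * δ) ξ) (fun n => (hloc _ (hS n n.2)).continuous)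
    (fun n => (hloc _ (hS n n.2)).integrable hδ) (Y := (X + C ^ 2) * δ ^ ((d : ℝ) - 1))
    (fun n ξ => ((hloc _ (hS n n.2)).sq_le hδ ξ).trans (by gcongr; linarith))
    (K := fun n n' => (X + C ^ 2) * δ⁻¹ * (1 + |((n : ℤ) : ℝ) - (n' : ℤ)|) ^ (-(((d : ℝ) - 1) / 2)))
    (fun n n' z => ?_) hf hf2 (G := fun n => G n) (fun n => hG n) (fun n => hGfin n)
  · have hcomb := sum_min_le (S := S) (a := fun n => volume.real (G n)) (fun n => measureReal_nonneg)
      hW hGW (X := (X + C ^ 2) * δ⁻¹) (Y := (X + C ^ 2) * δ ^ ((d : ℝ) - 1)) (b := ((d : ℝ) - 1) / 2)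
      (by positivity) (by positivity) hN (by linarith) hγ hcount
    rw [Finset.sum_coe_sort S (fun n => ∫ x in G n, ‖𝓕⁻ (fun ξ => (m ((n + s) * δ) ξ : ℂ) * 𝓕 f ξ) x‖)]
      at key
    refine key.trans (mul_le_mul_of_nonneg_left (le_trans (le_of_eq ?_) hcomb)
      (integral_nonneg fun x => by positivity))
    rw [← Finset.sum_coe_sort S]
    refine Finset.sum_congr rfl fun n _ => ?_
    rw [← Finset.sum_coe_sort S]
  · have h1 := hker δ (m (((n : ℤ) + s) * δ)) (m (((n' : ℤ) + s) * δ)) |((n : ℤ) : ℝ) - (n' : ℤ)| hδ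
      (hloc _ (hS n n.2)) (hloc _ (hS n' n'.2)) (abs_nonneg _) ?_ z
    · exact h1.trans (by gcongr)
    · intro z hz
      refine hvan _ _ z (by linarith [hS n n.2]) (by linarith [hS n' n'.2]) ?_
      have e : (((n : ℤ) : ℝ) + s) * δ - (((n' : ℤ) : ℝ) + s) * δ =
          (((n : ℤ) : ℝ) - (n' : ℤ)) * δ := by ring
      rw [e, abs_mul, abs_of_pos hδ]
      exact hz

end Level
end SphericalMax

namespace SphericalMax

/-! ### From grid radii to arbitrary radii in E. -/

section Discretization

open Real FourierTransform Metric

variable {d : ℕ} [NeZero d]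

local notation "𝔼" => EuclideanSpace ℝ (Fin d)

namespace Mollifier

variable (M : Mollifier d)

lemma abs_mult_le_weight (δ t : ℝ) (ξ : 𝔼) : |M.mult δ t ξ| ≤ M.C * weight (δ • ξ) :=
  (M.abs_mult_le δ t ξ).trans (mul_le_of_le_one_left (mul_nonneg M.C_pos.le (weight_nonneg _))
    (abs_sphereProfile_le_one _))

lemma abs_multDeriv_le_weight (δ t : ℝ) (ξ : 𝔼) : |M.multDeriv δ t ξ| ≤ M.C * weight (δ • ξ) :=
  (M.abs_multDeriv_le δ t ξ).trans (mul_le_of_le_one_left (mul_nonneg M.C_pos.le (weight_nonneg _))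
    (abs_sphereProfileDeriv_le_one _))

/-- Joint continuity of a family of multiplier operators. -/
lemma continuous_fourierInv_family {m : ℝ → 𝔼 → ℝ} {δ : ℝ} (hδ : 0 < δ)
    (hmt : ∀ ξ, Continuous fun t => m t ξ) (hmc : ∀ t, Continuous (m t))
    (hm : ∀ t ξ, |m t ξ| ≤ M.C * weight (δ • ξ)) {f : 𝔼 → ℂ} (hf : Integrable f)
    {Y : Type*} [TopologicalSpace Y] [FirstCountableTopology Y] {t : Y → ℝ} {x : Y → 𝔼}
    (ht : Continuous t) (hx : Continuous x) :
    Continuous fun q => 𝓕⁻ (fun ξ => (m (t q) ξ : ℂ) * 𝓕 f ξ) (x q) := by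
  simp only [fourierInv_eq]
  have hfc := continuous_fourier hf
  refine continuous_of_dominated (bound := fun ξ => M.C * weight (δ • ξ) * ∫ x, ‖f x‖)
    (fun q => ?_) (fun q => Filter.Eventually.of_forall fun ξ => ?_)
    (((integrable_weight_smul hδ).const_mul _).mul_const _)
    (Filter.Eventually.of_forall fun ξ => ?_)
  · exact ((Real.continuous_fourierChar.comp (by fun_prop)).smul
      ((Complex.continuous_ofReal.comp (hmc (t q))).mul hfc)).aestronglyMeasurable
  · rw [Circle.norm_smul, norm_mul, Complex.norm_real, Real.norm_eq_abs]
    exact mul_le_mul (hm _ _) (norm_fourier_le _ _) (norm_nonneg _)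
      (mul_nonneg M.C_pos.le (weight_nonneg _))
  · exact (Real.continuous_fourierChar.comp (by fun_prop)).smul
      ((Complex.continuous_ofReal.comp ((hmt ξ).comp ht)).mul continuous_const)

lemma continuous_fourierInv_mult {δ : ℝ} (hδ : 0 < δ) {f : 𝔼 → ℂ} (hf : Integrable f)
    {Y : Type*} [TopologicalSpace Y] [FirstCountableTopology Y] {t : Y → ℝ} {x : Y → 𝔼}
    (ht : Continuous t) (hx : Continuous x) :
    Continuous fun q => 𝓕⁻ (fun ξ => (M.mult δ (t q) ξ : ℂ) * 𝓕 f ξ) (x q) := by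
  refine M.continuous_fourierInv_family hδ (fun ξ => ?_) (M.continuous_mult δ)
    (M.abs_mult_le_weight δ) hf ht hx
  unfold mult
  exact (continuous_sphereProfile.comp (by fun_prop)).mul continuous_const

lemma continuous_fourierInv_multDeriv {δ : ℝ} (hδ : 0 < δ) {f : 𝔼 → ℂ} (hf : Integrable f)
    {Y : Type*} [TopologicalSpace Y] [FirstCountableTopology Y] {t : Y → ℝ} {x : Y → 𝔼}
    (ht : Continuous t) (hx : Continuous x) :
    Continuous fun q => 𝓕⁻ (fun ξ => (M.multDeriv δ (t q) ξ : ℂ) * 𝓕 f ξ) (x q) := by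
  refine M.continuous_fourierInv_family hδ (fun ξ => ?_) (M.continuous_multDeriv δ)
    (M.abs_multDeriv_le_weight δ) hf ht hx
  unfold multDeriv
  exact (continuous_const.mul (continuous_sphereProfileDeriv.comp (by fun_prop))).mul continuous_const

lemma norm_fourierInv_family_le {m : 𝔼 → ℝ} {δ : ℝ} (hδ : 0 < δ)
    (hm : ∀ ξ, |m ξ| ≤ M.C * weight (δ • ξ)) {f : 𝔼 → ℂ} (x : 𝔼) :
    ‖𝓕⁻ (fun ξ => (m ξ : ℂ) * 𝓕 f ξ) x‖ ≤ ∫ ξ : 𝔼, M.C * weight (δ • ξ) * ∫ x, ‖f x‖ := by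
  refine (norm_fourierInv_le _ _).trans (integral_mono_of_nonneg
    (Filter.Eventually.of_forall fun ξ => norm_nonneg _)
    (((integrable_weight_smul hδ).const_mul _).mul_const _)
    (Filter.Eventually.of_forall fun ξ => ?_))
  simp only [norm_mul, Complex.norm_real, Real.norm_eq_abs]
  exact mul_le_mul (hm _) (norm_fourier_le _ _) (norm_nonneg _)
    (mul_nonneg M.C_pos.le (weight_nonneg _))

/-- Measuring the radius in units of δ makes the derivative the same size as the mean: the factor
‖ξ‖ becomes ‖δξ‖, of order one at frequency 1/δ. -/
lemma hasDerivAt_fourierInv_mult {δ : ℝ} (hδ : 0 < δ) {f : 𝔼 → ℂ} (hf : Integrable f) (x : 𝔼)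
    (c s : ℝ) : HasDerivAt (fun s => 𝓕⁻ (fun ξ => (M.mult δ ((c + s) * δ) ξ : ℂ) * 𝓕 f ξ) x)
      (𝓕⁻ (fun ξ => (M.multDeriv δ ((c + s) * δ) ξ : ℂ) * 𝓕 f ξ) x) s := by
  have hfc := continuous_fourier hf
  have hQ : ∀ ξ : 𝔼, |M.Q (δ • ξ)| ≤ M.C * weight (δ • ξ) := fun ξ =>
    le_trans (le_mul_of_one_le_left (abs_nonneg _) (le_add_of_nonneg_right (by positivity)))
      (M.abs_Q_le _)
  have hQ' : ∀ ξ : 𝔼, ‖ξ‖ * |M.Q (δ • ξ)| ≤ δ⁻¹ * (M.C * weight (δ • ξ)) := fun ξ => by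
    rw [le_inv_mul_iff₀ hδ]
    refine le_trans ?_ (M.abs_Q_le (δ • ξ))
    rw [← mul_assoc]
    refine mul_le_mul_of_nonneg_right ?_ (abs_nonneg _)
    rw [norm_smul, Real.norm_of_nonneg hδ.le]
    have : 0 ≤ δ * ‖ξ‖ := by positivity
    nlinarith [Real.pi_gt_three]
  have hQc : Continuous fun ξ : 𝔼 => (M.Q (δ • ξ) : ℂ) :=
    Complex.continuous_ofReal.comp (M.continuous_Q.comp (by fun_prop))
  have hw := integrable_weight_smul (d := d) hδ
  have hp : Integrable (fun ξ => (M.Q (δ • ξ) : ℂ) * 𝓕 f ξ) := by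
    refine ((hw.const_mul M.C).mul_const (∫ x, ‖f x‖)).mono' (hQc.mul hfc).aestronglyMeasurable
      (Filter.Eventually.of_forall fun ξ => ?_)
    rw [norm_mul, Complex.norm_real, Real.norm_eq_abs]
    exact mul_le_mul (hQ ξ) (norm_fourier_le _ _) (norm_nonneg _) ((abs_nonneg _).trans (hQ ξ))
  have hp' : Integrable (fun ξ => (‖ξ‖ : ℂ) * ((M.Q (δ • ξ) : ℂ) * 𝓕 f ξ)) := by
    refine (((hw.const_mul M.C).const_mul δ⁻¹).mul_const (∫ x, ‖f x‖)).mono'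
      ((Complex.continuous_ofReal.comp continuous_norm).mul (hQc.mul hfc)).aestronglyMeasurable
      (Filter.Eventually.of_forall fun ξ => ?_)
    rw [norm_mul, norm_mul, Complex.norm_real, Complex.norm_real, norm_norm, Real.norm_eq_abs,
      ← mul_assoc]
    exact mul_le_mul (hQ' ξ) (norm_fourier_le _ _) (norm_nonneg _)
      ((mul_nonneg (norm_nonneg _) (abs_nonneg _)).trans (hQ' ξ))
  have hder := hasDerivAt_fourierInv_profile hp hp' x ((c + s) * δ)
  have hlin : HasDerivAt (fun s : ℝ => (c + s) * δ) δ s := by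
    simpa using ((hasDerivAt_id s).const_add c).mul_const δ
  have hcomp := hder.scomp s hlin
  have e1 : (fun s => 𝓕⁻ (fun ξ => (M.mult δ ((c + s) * δ) ξ : ℂ) * 𝓕 f ξ) x) =
      (fun t => 𝓕⁻ (fun ξ => (sphereProfile d (2 * π * t * ‖ξ‖) : ℂ) *
        ((M.Q (δ • ξ) : ℂ) * 𝓕 f ξ)) x) ∘ fun s : ℝ => (c + s) * δ := by
    funext s
    simp only [Function.comp, mult, Complex.ofReal_mul, mul_assoc]
  rw [e1]
  refine HasDerivAt.congr_deriv hcomp ?_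
  rw [fourierInv_eq, fourierInv_eq, ← integral_smul]
  congr with ξ
  simp only [multDeriv, norm_smul, Real.norm_of_nonneg hδ.le, Circle.smul_def, smul_eq_mul,
    Complex.real_smul]
  push_cast
  ring

/-- Control of a localized mean by grid points and the derivative. -/
lemma norm_fourierInv_mult_le {δ : ℝ} (hδ : 0 < δ) {f : 𝔼 → ℂ} (hf : Integrable f) (x : 𝔼) (t : ℝ) :
    ‖𝓕⁻ (fun ξ => (M.mult δ t ξ : ℂ) * 𝓕 f ξ) x‖ ≤
      ‖𝓕⁻ (fun ξ => (M.mult δ ((⌊t / δ⌋ + 0) * δ) ξ : ℂ) * 𝓕 f ξ) x‖ +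
      ∫ s in (0 : ℝ)..1, ‖𝓕⁻ (fun ξ => (M.multDeriv δ ((⌊t / δ⌋ + s) * δ) ξ : ℂ) * 𝓕 f ξ) x‖ := by
  set n := ⌊t / δ⌋ with hn
  set D : ℝ → ℂ := fun s => 𝓕⁻ (fun ξ => (M.multDeriv δ ((n + s) * δ) ξ : ℂ) * 𝓕 f ξ) x with hD
  have hDc : Continuous D := M.continuous_fourierInv_multDeriv hδ hf (by fun_prop) continuous_const
  have h0 : 0 ≤ t / δ - n := sub_nonneg.2 (Int.floor_le _)
  have h1 : t / δ - n ≤ 1 := by linarith [Int.lt_floor_add_one (t / δ)]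
  have hftc := intervalIntegral.integral_eq_sub_of_hasDerivAt
    (fun s _ => M.hasDerivAt_fourierInv_mult hδ hf x n s) (hDc.intervalIntegrable 0 (t / δ - n))
  have e : ((n : ℝ) + (t / δ - n)) * δ = t := by field_simp; ring
  rw [e] at hftc
  rw [sub_eq_iff_eq_add'.1 hftc.symm]
  refine (norm_add_le _ _).trans (add_le_add le_rfl ?_)
  refine (intervalIntegral.norm_integral_le_integral_norm h0).trans ?_
  refine intervalIntegral.integral_mono_interval le_rfl h0 h1
    (Filter.Eventually.of_forall fun s => norm_nonneg _) (hDc.norm.intervalIntegrable 0 1)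

end Mollifier

/-- Merges all radii of one grid cell. Disjointness keeps the total measure unchanged, so the number
of radii of T in a cell never enters. -/
lemma sum_setIntegral_fiberwise (T : Finset ℝ) (φ : ℝ → ℤ) {G : ℝ → Set 𝔼}
    (hG : ∀ t, MeasurableSet (G t)) (hdisj : (T : Set ℝ).PairwiseDisjoint G) {F : ℤ → 𝔼 → ℝ}
    (hF : ∀ n, ∀ t, IntegrableOn (F n) (G t)) :
    ∑ t ∈ T, ∫ x in G t, F (φ t) x =
      ∑ n ∈ T.image φ, ∫ x in ⋃ t ∈ T.filter (fun t => φ t = n), G t, F n x := by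
  rw [← Finset.sum_fiberwise_of_maps_to (g := φ) (t := T.image φ)
    (fun t ht => Finset.mem_image_of_mem φ ht)]
  refine Finset.sum_congr rfl fun n _ => ?_
  rw [integral_biUnion_finset _ (fun t _ => hG t)
    (hdisj.subset (by intro t ht; exact (Finset.mem_filter.1 (Finset.mem_coe.1 ht)).1))
    (fun t _ => hF n t)]
  refine Finset.sum_congr rfl fun t ht => ?_
  rw [(Finset.mem_filter.1 ht).2]

lemma integrableOn_of_continuous_of_bound {X : Type*} [TopologicalSpace X] [MeasurableSpace X]
    [OpensMeasurableSpace X] [SecondCountableTopology X] {μ : Measure X} {F : X → ℝ}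
    (hF : Continuous F) {B : ℝ} (hB : ∀ x, ‖F x‖ ≤ B) {G : Set X} (hG : μ G ≠ ∞) :
    IntegrableOn F G μ :=
  Measure.integrableOn_of_bounded hG hF.aestronglyMeasurable (Filter.Eventually.of_forall hB)

/-- The estimate at a fixed frequency. -/
lemma exists_level_bound (hd : 2 ≤ d) (M : Mollifier d) {γ : ℝ} (hγ0 : 0 ≤ γ) (hγ1 : γ ≤ 1)
    (A : ℝ≥0) : ∃ X : ℝ, 0 < X ∧ ∀ (E : Set ℝ), E ⊆ Icc 1 2 → assouadSup γ E ≤ A →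
      ∀ (T : Finset ℝ), (T : Set ℝ) ⊆ E → ∀ (G : ℝ → Set 𝔼), (∀ t, MeasurableSet (G t)) →
      (∀ t, volume (G t) ≠ ∞) → (T : Set ℝ).PairwiseDisjoint G → ∀ W, 0 < W →
      ∑ t ∈ T, volume.real (G t) ≤ W → ∀ δ, 0 < δ → δ ≤ 1 / 2 → ∀ f : 𝔼 → ℂ, Integrable f →
      MemLp f 2 → ∑ t ∈ T, ∫ x in G t, ‖𝓕⁻ (fun ξ => (M.mult δ t ξ : ℂ) * 𝓕 f ξ) x‖ ≤
        √(X * ((∫ x, ‖f x‖ ^ 2) *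
          ((δ⁻¹ * W ^ 2) ^ (1 - (((d : ℝ) - 1) / 2) / (((d : ℝ) - 1) / 2 + γ)) *
          (δ ^ ((d : ℝ) - 1) * W) ^ ((((d : ℝ) - 1) / 2) / (((d : ℝ) - 1) / 2 + γ))))) := by
  obtain ⟨C, hC, hloc⟩ := M.exists_isLocalized
  obtain ⟨X, hX, hgrid⟩ := exists_grid_bound hd M hC
  have hd' : (2 : ℝ) ≤ d := by exact_mod_cast hd
  set b : ℝ := ((d : ℝ) - 1) / 2 with hb
  have hb0 : 0 < b := by rw [hb]; linarith
  set θ : ℝ := b / (b + γ) with hθ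
  -- The grid values and the derivative term contribute √Z each, and √Z + √Z = √(4Z); the 6A comes
  -- from `card_grid_le`.
  refine ⟨4 * ((1 + 6 * A) * X), by positivity, ?_⟩
  intro E hE hA T hT G hG hGfin hdisj W hW hGW δ hδ hδ2 f hf hf2
  set N : ℝ := 6 * A with hN
  set S : Finset ℤ := T.image fun t => ⌊t / δ⌋ with hS
  set H : ℤ → Set 𝔼 := fun n => ⋃ t ∈ T.filter (fun t => ⌊t / δ⌋ = n), G t with hH
  have hHm : ∀ n, MeasurableSet (H n) := fun n => Finset.measurableSet_biUnion _ fun t _ => hG t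
  have hHfin : ∀ n, volume (H n) ≠ ∞ := fun n =>
    ((measure_biUnion_lt_top (Finset.finite_toSet _) fun t _ => (hGfin t).lt_top)).ne
  have hHW : ∑ n ∈ S, volume.real (H n) ≤ W := by
    refine le_trans (le_of_eq ?_) hGW
    have := sum_setIntegral_fiberwise T (fun t => ⌊t / δ⌋) hG hdisj (F := fun _ _ => (1 : ℝ))
      (fun n t => integrableOn_const (hGfin t))
    simp only [integral_const, smul_eq_mul, mul_one, measureReal_restrict_apply_univ] at this
    exact this.symm
  have hcount : ∀ n : ℤ, ∀ r : ℝ, 1 ≤ r →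
      ((S.filter fun n' : ℤ => |(n : ℝ) - n'| ≤ r).card : ℝ) ≤ N * r ^ γ := fun n r hr =>
    card_grid_le hγ0 hγ1 hE hA ⟨hδ, by linarith⟩ S (fun n hn => by
      obtain ⟨t, ht, rfl⟩ := Finset.mem_image.1 hn
      exact ⟨t, hT ht, rfl⟩) n hr
  -- Rounding down loses less than δ ≤ 1/2 from a radius t ≥ 1.
  have hlow : ∀ s : ℝ, 0 ≤ s → ∀ n ∈ S, 1 / 2 ≤ ((n : ℝ) + s) * δ := by
    intro s hs n hn
    obtain ⟨t, ht, rfl⟩ := Finset.mem_image.1 hn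
    have h1 := (hE (hT ht)).1
    have h2 := Int.lt_floor_add_one (t / δ)
    rw [div_lt_iff₀ hδ] at h2
    have h3 : 0 ≤ s * δ := by positivity
    nlinarith
  set Z : ℝ := (∫ x, ‖f x‖ ^ 2) * ((1 + N) * ((X * δ⁻¹ * W ^ 2) ^ (1 - θ) *
      (X * δ ^ ((d : ℝ) - 1) * W) ^ θ)) with hZ
  have hg1 : ∑ n ∈ S, ∫ x in H n, ‖𝓕⁻ (fun ξ => (M.mult δ ((n + 0) * δ) ξ : ℂ) * 𝓕 f ξ) x‖ ≤ √Z :=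
    Real.le_sqrt_of_sq_le (hgrid δ 0 (M.mult δ) S H W N γ f hδ (fun t ht => (hloc δ t ht).1)
      (fun t t' z ht ht' hz => M.fourierInv_mult_mul_eq_zero hδ ht ht' hz) (hlow 0 le_rfl)
      (by positivity) hγ0 hcount hHm hHfin hW hHW hf hf2)
  have hg2 : ∀ s : ℝ, 0 ≤ s → ∑ n ∈ S, ∫ x in H n,
      ‖𝓕⁻ (fun ξ => (M.multDeriv δ ((n + s) * δ) ξ : ℂ) * 𝓕 f ξ) x‖ ≤ √Z := fun s hs =>
    Real.le_sqrt_of_sq_le (hgrid δ s (M.multDeriv δ) S H W N γ f hδ (fun t ht => (hloc δ t ht).2)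
      (fun t t' z ht ht' hz => M.fourierInv_multDeriv_mul_eq_zero hδ ht ht' hz) (hlow s hs)
      (by positivity) hγ0 hcount hHm hHfin hW hHW hf hf2)
  set B : ℝ := ∫ ξ : 𝔼, M.C * weight (δ • ξ) * ∫ x, ‖f x‖ with hB
  have hb1 : ∀ t x, ‖(‖𝓕⁻ (fun ξ => (M.mult δ t ξ : ℂ) * 𝓕 f ξ) x‖)‖ ≤ B := fun t x => by
    rw [norm_norm]; exact M.norm_fourierInv_family_le hδ (M.abs_mult_le_weight δ t) x
  have hb2 : ∀ t x, ‖(‖𝓕⁻ (fun ξ => (M.multDeriv δ t ξ : ℂ) * 𝓕 f ξ) x‖)‖ ≤ B := fun t x => by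
    rw [norm_norm]; exact M.norm_fourierInv_family_le hδ (M.abs_multDeriv_le_weight δ t) x
  have hi1 : ∀ t u, IntegrableOn (fun x => ‖𝓕⁻ (fun ξ => (M.mult δ u ξ : ℂ) * 𝓕 f ξ) x‖) (G t) :=
    fun t u => integrableOn_of_continuous_of_bound
      (M.continuous_fourierInv_mult hδ hf continuous_const continuous_id).norm (hb1 u) (hGfin t)
  have hprod : ∀ n : ℤ, ∀ K : Set 𝔼, volume K ≠ ∞ → Integrable (fun q : 𝔼 × ℝ =>
      ‖𝓕⁻ (fun ξ => (M.multDeriv δ ((n + q.2) * δ) ξ : ℂ) * 𝓕 f ξ) q.1‖)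
        ((volume.restrict K).prod (volume.restrict (Ioc (0 : ℝ) 1))) := by
    intro n K hK
    have : IsFiniteMeasure (volume.restrict K) := ⟨by simpa using hK.lt_top⟩
    refine (integrable_const B).mono' ?_ (Filter.Eventually.of_forall fun q => hb2 _ _)
    exact (M.continuous_fourierInv_multDeriv hδ hf (by fun_prop)
      continuous_fst).norm.aestronglyMeasurable
  have hi2 : ∀ n : ℤ, ∀ t, IntegrableOn (fun x => ∫ s in (0 : ℝ)..1,
      ‖𝓕⁻ (fun ξ => (M.multDeriv δ ((n + s) * δ) ξ : ℂ) * 𝓕 f ξ) x‖) (G t) := by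
    intro n t
    simp only [intervalIntegral.integral_of_le zero_le_one]
    exact (hprod n (G t) (hGfin t)).integral_prod_left
  have step1 : ∑ t ∈ T, ∫ x in G t, ‖𝓕⁻ (fun ξ => (M.mult δ t ξ : ℂ) * 𝓕 f ξ) x‖ ≤
      (∑ t ∈ T, ∫ x in G t, ‖𝓕⁻ (fun ξ => (M.mult δ ((⌊t / δ⌋ + 0) * δ) ξ : ℂ) * 𝓕 f ξ) x‖) +
      ∑ t ∈ T, ∫ x in G t, ∫ s in (0 : ℝ)..1,
        ‖𝓕⁻ (fun ξ => (M.multDeriv δ ((⌊t / δ⌋ + s) * δ) ξ : ℂ) * 𝓕 f ξ) x‖ := by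
    rw [← Finset.sum_add_distrib]
    refine Finset.sum_le_sum fun t _ => ?_
    rw [← integral_add (hi1 _ _) (hi2 _ _)]
    exact integral_mono (hi1 _ _) ((hi1 _ _).add (hi2 _ _))
      fun x => M.norm_fourierInv_mult_le hδ hf x t
  have step2 : ∑ t ∈ T, ∫ x in G t,
      ‖𝓕⁻ (fun ξ => (M.mult δ ((⌊t / δ⌋ + 0) * δ) ξ : ℂ) * 𝓕 f ξ) x‖ ≤ √Z := by
    rw [sum_setIntegral_fiberwise T (fun t => ⌊t / δ⌋) hG hdisj
      (F := fun n x => ‖𝓕⁻ (fun ξ => (M.mult δ ((n + 0) * δ) ξ : ℂ) * 𝓕 f ξ) x‖)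
      (fun n t => hi1 _ _)]
    exact hg1
  have step3 : ∑ t ∈ T, ∫ x in G t, ∫ s in (0 : ℝ)..1,
      ‖𝓕⁻ (fun ξ => (M.multDeriv δ ((⌊t / δ⌋ + s) * δ) ξ : ℂ) * 𝓕 f ξ) x‖ ≤ √Z := by
    rw [sum_setIntegral_fiberwise T (fun t => ⌊t / δ⌋) hG hdisj
      (F := fun n x => ∫ s in (0 : ℝ)..1,
        ‖𝓕⁻ (fun ξ => (M.multDeriv δ ((n + s) * δ) ξ : ℂ) * 𝓕 f ξ) x‖) hi2]
    simp only [intervalIntegral.integral_of_le zero_le_one]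
    -- With the shift s outermost, the radii (n + s)δ form a grid for each fixed s, and the grid
    -- estimate is uniform in s.
    have hswap : ∀ n ∈ S, ∫ x in H n, ∫ s in Ioc (0 : ℝ) 1,
        ‖𝓕⁻ (fun ξ => (M.multDeriv δ ((n + s) * δ) ξ : ℂ) * 𝓕 f ξ) x‖ =
        ∫ s in Ioc (0 : ℝ) 1, ∫ x in H n,
        ‖𝓕⁻ (fun ξ => (M.multDeriv δ ((n + s) * δ) ξ : ℂ) * 𝓕 f ξ) x‖ := fun n _ =>
      integral_integral_swap (hprod n (H n) (hHfin n))
    have hint : ∀ n ∈ S, IntegrableOn (fun s : ℝ => ∫ x in H n,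
        ‖𝓕⁻ (fun ξ => (M.multDeriv δ ((n + s) * δ) ξ : ℂ) * 𝓕 f ξ) x‖) (Ioc 0 1) := fun n _ =>
      (hprod n (H n) (hHfin n)).integral_prod_right
    rw [Finset.sum_congr rfl hswap, ← integral_finsetSum _ hint]
    calc _ ≤ ∫ s in Ioc (0 : ℝ) 1, √Z :=
          setIntegral_mono_on (integrable_finsetSum _ hint) (integrableOn_const (by simp))
            measurableSet_Ioc fun s hs => hg2 s hs.1.le
      _ = √Z := by simp
  have hZX : Z = (1 + N) * X * ((∫ x, ‖f x‖ ^ 2) * ((δ⁻¹ * W ^ 2) ^ (1 - θ) *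
      (δ ^ ((d : ℝ) - 1) * W) ^ θ)) := by
    have hX1 : X ^ (1 - θ) * X ^ θ = X := by rw [← Real.rpow_add hX]; simp
    have hp1 : 0 < δ⁻¹ * W ^ 2 := by positivity
    have hp2 : 0 < δ ^ ((d : ℝ) - 1) * W := by positivity
    rw [hZ, mul_assoc X, mul_assoc X, Real.mul_rpow hX.le hp1.le, Real.mul_rpow hX.le hp2.le]
    calc _ = (1 + N) * (X ^ (1 - θ) * X ^ θ) * ((∫ x, ‖f x‖ ^ 2) * ((δ⁻¹ * W ^ 2) ^ (1 - θ) *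
          (δ ^ ((d : ℝ) - 1) * W) ^ θ)) := by ring
      _ = _ := by rw [hX1]
  have h2 : √Z + √Z = √(4 * Z) := by
    rw [Real.sqrt_mul (by norm_num : (0 : ℝ) ≤ 4), show (4 : ℝ) = 2 ^ 2 by norm_num,
      Real.sqrt_sq (by norm_num : (0 : ℝ) ≤ 2)]
    ring
  rw [mul_assoc, ← hZX, ← h2]
  exact step1.trans (add_le_add step2 step3)

end Discretization
end SphericalMax

namespace SphericalMax

/-! ### Spherical means of mollified functions. -/

section SmoothMean

open Real FourierTransform Metric

variable {d : ℕ} [NeZero d]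

local notation "𝔼" => EuclideanSpace ℝ (Fin d)

namespace Mollifier

variable (M : Mollifier d)

/-- The spherical mean of the mollification of `f` at scale `δ`. -/
noncomputable def smoothMean (δ t : ℝ) (f : 𝔼 → ℂ) (x : 𝔼) : ℂ :=
  𝓕⁻ (fun ξ => ((sphereProfile d (2 * π * t * ‖ξ‖) : ℂ) * (M.P (δ • ξ) : ℂ)) * 𝓕 f ξ) x

lemma continuous_ofReal_profile (t : ℝ) :
    Continuous fun ξ : 𝔼 => (sphereProfile d (2 * π * t * ‖ξ‖) : ℂ) :=
  Complex.continuous_ofReal.comp (continuous_sphereProfile.comp (by fun_prop))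

lemma integrable_profile_mul (t : ℝ) {p : 𝔼 → ℂ} (hp : Integrable p) :
    Integrable (fun ξ => (sphereProfile d (2 * π * t * ‖ξ‖) : ℂ) * p ξ) :=
  hp.bdd_mul (c := 1) (continuous_ofReal_profile t).aestronglyMeasurable
    (Filter.Eventually.of_forall fun ξ => by
      rw [Complex.norm_real]; exact abs_sphereProfile_le_one _)

lemma integrable_mul_fourier {p f : 𝔼 → ℂ} (hp : Integrable p) (hf : Integrable f) :
    Integrable (fun ξ => p ξ * 𝓕 f ξ) :=
  hp.mul_bdd (c := ∫ x, ‖f x‖) (continuous_fourier hf).aestronglyMeasurable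
    (Filter.Eventually.of_forall fun ξ => norm_fourier_le _ _)

/-- The telescoping identity: passing from scale δ to δ/2 adds exactly the piece with multiplier
`mult`, since Q(u) = P(u/2) - P(u). -/
lemma smoothMean_half_sub {δ : ℝ} (hδ : 0 < δ) (t : ℝ) {f : 𝔼 → ℂ} (hf : Integrable f) (x : 𝔼) :
    M.smoothMean (1 / 2 * δ) t f x - M.smoothMean δ t f x =
      𝓕⁻ (fun ξ => (M.mult δ t ξ : ℂ) * 𝓕 f ξ) x := by
  have hi : ∀ ε : ℝ, 0 < ε → Integrable (fun ξ => 𝐞 (inner ℝ ξ x) •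
      (((sphereProfile d (2 * π * t * ‖ξ‖) : ℂ) * (M.P (ε • ξ) : ℂ)) * 𝓕 f ξ)) := by
    intro ε hε
    have h := integrable_mul_fourier (integrable_profile_mul t (M.integrable_P_smul hε)) hf
    refine h.mono ?_ (Filter.Eventually.of_forall fun ξ => by rw [Circle.norm_smul])
    exact (Real.continuous_fourierChar.comp (by fun_prop)).aestronglyMeasurable.smul h.1
  rw [smoothMean, smoothMean, fourierInv_eq, fourierInv_eq, fourierInv_eq,
    ← integral_sub (hi _ (by positivity)) (hi _ hδ)]
  congr with ξ
  rw [← smul_sub, mult, Q, smul_smul]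
  push_cast
  ring_nf

lemma smoothMean_eq_integral_sphere {δ : ℝ} (hδ : 0 < δ) (t : ℝ) {f : 𝔼 → ℂ} (hf : Integrable f)
    (x : 𝔼) : M.smoothMean δ t f x = ∫ y : sphere (0 : 𝔼) 1,
      𝓕⁻ (fun ξ => (M.P (δ • ξ) : ℂ) * 𝓕 f ξ) (x - t • (y : 𝔼)) ∂(sphereMeasure d) := by
  rw [integral_sphere_fourierInv (integrable_mul_fourier (M.integrable_P_smul hδ) hf), smoothMean]
  simp only [mul_assoc]

lemma integral_Φ_smul {δ : ℝ} (hδ : 0 < δ) : ∫ u : 𝔼, ((δ ^ d)⁻¹ : ℝ) • M.Φ (δ⁻¹ • u) = 1 := by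
  have h := M.fourier_Φ_smul hδ 0
  rw [fourier_eq] at h
  simpa [M.P_zero] using h

lemma integral_norm_Φ_smul {δ : ℝ} (hδ : 0 < δ) :
    ∫ u : 𝔼, ‖((δ ^ d)⁻¹ : ℝ) • M.Φ (δ⁻¹ • u)‖ = ∫ u, ‖M.Φ u‖ := by
  simp only [norm_smul]
  rw [integral_const_mul, Measure.integral_comp_smul (volume : Measure 𝔼) (fun u => ‖M.Φ u‖),
    finrank_euclideanSpace, Fintype.card_fin, smul_eq_mul, ← mul_assoc,
    Real.norm_of_nonneg (by positivity), abs_of_pos (by positivity)]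
  rw [inv_pow, inv_inv, inv_mul_cancel₀ (by positivity), one_mul]

/-- Mollifications converge uniformly. -/
lemma norm_mollify_sub_le {δ ε : ℝ} (hδ : 0 < δ) {f : 𝔼 → ℂ} (hf : Integrable f)
    (hε : ∀ x y, ‖x - y‖ ≤ M.R * δ → ‖f y - f x‖ ≤ ε) (x : 𝔼) :
    ‖𝓕⁻ (fun ξ => (M.P (δ • ξ) : ℂ) * 𝓕 f ξ) x - f x‖ ≤ ε * ∫ u, ‖M.Φ u‖ := by
  rw [fourierInv_mul_fourier (M.integrable_P_smul hδ) hf]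
  simp only [M.fourierInv_P_smul hδ]
  set κ : 𝔼 → ℂ := fun u => ((δ ^ d)⁻¹ : ℝ) • M.Φ (δ⁻¹ • u) with hκ
  have hκi : Integrable κ := (M.integrable_Φ.comp_smul (inv_ne_zero hδ.ne')).smul ((δ ^ d)⁻¹ : ℝ)
  have hκx : Integrable fun y => κ (x - y) := hκi.comp_sub_left x
  have hκb : ∀ u, ‖κ u‖ ≤ (δ ^ d)⁻¹ * M.C := fun u => by
    rw [hκ, norm_smul, Real.norm_of_nonneg (by positivity)]
    exact mul_le_mul_of_nonneg_left (M.norm_Φ_le _) (by positivity)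
  have h1 : f x = ∫ y, f x * κ (x - y) := by
    rw [integral_const_mul, integral_sub_left_eq_self κ volume x, M.integral_Φ_smul hδ, mul_one]
  have hfκ : Integrable fun y => f y * κ (x - y) :=
    hf.mul_bdd (c := (δ ^ d)⁻¹ * M.C) hκx.1 (Filter.Eventually.of_forall fun y => hκb _)
  calc ‖(∫ y, f y * κ (x - y)) - f x‖ = ‖∫ y, (f y - f x) * κ (x - y)‖ := by
        congr 1
        conv_lhs => rw [h1]
        rw [← integral_sub hfκ (hκx.const_mul _)]
        simp only [sub_mul]
    _ ≤ ∫ y, ε * ‖κ (x - y)‖ := by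
        refine norm_integral_le_of_norm_le (hκx.norm.const_mul ε)
          (Filter.Eventually.of_forall fun y => ?_)
        rw [norm_mul]
        rcases le_or_gt ‖x - y‖ (M.R * δ) with h | h
        · exact mul_le_mul_of_nonneg_right (hε x y h) (norm_nonneg _)
        · simp [hκ, M.Φ_smul_eq_zero hδ h]
    _ = ε * ∫ u, ‖M.Φ u‖ := by
        rw [integral_const_mul, integral_sub_left_eq_self (fun u => ‖κ u‖) volume x,
          M.integral_norm_Φ_smul hδ]

/-- Smooth means converge uniformly to spherical means. -/
lemma tendsto_smoothMean {f : 𝔼 → ℂ} (hf : Continuous f) (hfs : HasCompactSupport f) {ε : ℝ}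
    (hε : 0 < ε) : ∃ δ₀ > 0, ∀ δ, 0 < δ → δ ≤ δ₀ → ∀ t x,
      ‖sphericalMean t f x - M.smoothMean δ t f x‖ ≤ ε := by
  have hfi : Integrable f := hf.integrable_of_hasCompactSupport hfs
  have hI : 0 ≤ ∫ u, ‖M.Φ u‖ := integral_nonneg fun u => norm_nonneg _
  have hη : 0 < ε / (1 + ∫ u, ‖M.Φ u‖) := by positivity
  obtain ⟨ρ, hρ, hfρ⟩ := Metric.uniformContinuous_iff.1
    (hfs.uniformContinuous_of_continuous hf) _ hη
  have hR := M.R_pos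
  refine ⟨ρ / (2 * M.R), by positivity, fun δ hδ hδ₀ t x => ?_⟩
  have hRδ : M.R * δ < ρ := by
    rw [le_div_iff₀ (by positivity)] at hδ₀
    nlinarith
  have hb := M.norm_mollify_sub_le hδ hfi (ε := ε / (1 + ∫ u, ‖M.Φ u‖)) fun x y hxy => by
    rw [← dist_eq_norm]
    refine (hfρ ?_).le
    rw [dist_eq_norm, norm_sub_rev]
    exact hxy.trans_lt hRδ
  have hc : Continuous (𝓕⁻ (fun ξ => (M.P (δ • ξ) : ℂ) * 𝓕 f ξ)) :=
    continuous_fourierInv (integrable_mul_fourier (M.integrable_P_smul hδ) hfi)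
  have hi1 : Integrable (fun y : sphere (0 : 𝔼) 1 => f (x - t • (y : 𝔼))) (sphereMeasure d) :=
    integrable_sphere_of_continuous (by fun_prop)
  have hi2 : Integrable (fun y : sphere (0 : 𝔼) 1 =>
      𝓕⁻ (fun ξ => (M.P (δ • ξ) : ℂ) * 𝓕 f ξ) (x - t • (y : 𝔼))) (sphereMeasure d) :=
    integrable_sphere_of_continuous (by fun_prop)
  rw [M.smoothMean_eq_integral_sphere hδ t hfi, sphericalMean, ← integral_sub hi1 hi2]
  refine (norm_integral_le_of_norm_le_const (C := ε) (Filter.Eventually.of_forall fun y => ?_)).trans ?_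
  · rw [norm_sub_rev]
    refine (hb _).trans ?_
    rw [div_mul_eq_mul_div, div_le_iff₀ (by positivity)]
    nlinarith
  · simp

end Mollifier

/-- The kernel of a smooth mean. -/
lemma exists_smoothMean_kernel_bound (hd : 2 ≤ d) (M : Mollifier d) : ∃ C : ℝ, 0 < C ∧
    ∀ δ t : ℝ, 0 < δ → δ ≤ 1 → 1 ≤ t → t ≤ 2 → ∀ z : 𝔼,
      ‖𝓕⁻ (fun ξ => (sphereProfile d (2 * π * t * ‖ξ‖) : ℂ) * (M.P (δ • ξ) : ℂ)) z‖ ≤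
        (closedBall (0 : 𝔼) (2 + M.R)).indicator (fun _ => C * δ⁻¹) z := by
  have hR := M.R_pos
  have hC := M.C_pos
  refine ⟨M.C * (2 ^ d * (2 * M.R) ^ (d - 1)), by positivity, fun δ t hδ hδ1 ht ht2 z => ?_⟩
  rw [← integral_sphere_fourierInv (M.integrable_P_smul hδ)]
  simp only [M.fourierInv_P_smul hδ]
  by_cases hz : z ∈ closedBall (0 : 𝔼) (2 + M.R)
  · rw [indicator_of_mem hz]
    -- Only a cap of radius O(δ) sees the mollifier. Its measure O(δ^{d-1}) against the height
    -- δ^{-d} leaves δ^{-1}. The factor 2 makes the support inequality strict, as t ≥ 1.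
    set S : Set (sphere (0 : 𝔼) 1) := {y | dist (y : 𝔼) (t⁻¹ • z) < 2 * M.R * δ} with hS
    have hSm : MeasurableSet S := (isOpen_lt (by fun_prop) continuous_const).measurableSet
    have hpt : ∀ y : sphere (0 : 𝔼) 1, ‖((δ ^ d)⁻¹ : ℝ) • M.Φ (δ⁻¹ • (z - t • (y : 𝔼)))‖ ≤
        S.indicator (fun _ => (δ ^ d)⁻¹ * M.C) y := by
      intro y
      by_cases hy : y ∈ S
      · rw [indicator_of_mem hy, norm_smul, Real.norm_of_nonneg (by positivity)]
        exact mul_le_mul_of_nonneg_left (M.norm_Φ_le _) (by positivity)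
      · rw [indicator_of_notMem hy, M.Φ_smul_eq_zero hδ, smul_zero, norm_zero]
        have h1 : 2 * M.R * δ ≤ ‖(y : 𝔼) - t⁻¹ • z‖ := by
          rw [← dist_eq_norm]; exact not_lt.1 hy
        have h2 : z - t • (y : 𝔼) = -(t • ((y : 𝔼) - t⁻¹ • z)) := by
          rw [smul_sub, smul_smul, mul_inv_cancel₀ (by linarith), one_smul, neg_sub]
        rw [h2, norm_neg, norm_smul, Real.norm_of_nonneg (by linarith)]
        have h3 : 0 < M.R * δ := by positivity
        nlinarith
    have hint : Integrable (S.indicator fun _ => (δ ^ d)⁻¹ * M.C) (sphereMeasure d) :=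
      (integrable_const _).indicator hSm
    calc _ ≤ ∫ y, S.indicator (fun _ => (δ ^ d)⁻¹ * M.C) y ∂(sphereMeasure d) :=
          norm_integral_le_of_norm_le hint (Filter.Eventually.of_forall hpt)
      _ = (sphereMeasure d).real S * ((δ ^ d)⁻¹ * M.C) := by
          rw [integral_indicator hSm]; simp
      _ ≤ 2 ^ d * (2 * M.R * δ) ^ (d - 1) * ((δ ^ d)⁻¹ * M.C) := by
          gcongr
          exact sphereMeasure_ball_le _ (by positivity)
      _ = _ := by
          obtain ⟨k, rfl⟩ : ∃ k, d = k + 1 := ⟨d - 1, by omega⟩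
          simp only [Nat.add_sub_cancel]
          rw [mul_pow (2 * M.R) δ, pow_succ δ k]
          field_simp
  · rw [indicator_of_notMem hz]
    refine le_of_eq ?_
    rw [norm_eq_zero]
    refine integral_eq_zero_of_ae (Filter.Eventually.of_forall fun y => ?_)
    simp only [Pi.zero_apply]
    rw [M.Φ_smul_eq_zero hδ, smul_zero]
    rw [mem_closedBall_zero_iff, not_le] at hz
    have h1 : ‖t • (y : 𝔼)‖ = t := by simp [norm_smul, abs_of_nonneg (by linarith : 0 ≤ t)]
    have h2 := norm_sub_norm_le z (t • (y : 𝔼))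
    nlinarith

end SmoothMean
end SphericalMax

namespace SphericalMax

/-! ### Optimizing the frequency threshold. -/

section Balance

/-- The product of powers dominates one of three elementary bounds. -/
lemma min_le_rpow_mul_rpow {V W α β : ℝ} (hV : 0 < V) (hW : 0 < W) (hα0 : 0 ≤ α) (hα1 : α ≤ 1)
    (hβ0 : 0 ≤ β) (hβ1 : β ≤ 1) (hαβ : 1 ≤ α + β) :
    V * W ≤ V ^ α * W ^ β ∨ V ≤ V ^ α * W ^ β ∨ W ≤ V ^ α * W ^ β := by
  have hle : ∀ x : ℝ, 0 < x → ∀ e : ℝ, x ≤ 1 → e ≤ 1 → x ≤ x ^ e := fun x hx e h1 he => by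
    simpa using Real.rpow_le_rpow_of_exponent_ge hx h1 he
  have hone : ∀ x : ℝ, ∀ e : ℝ, 1 ≤ x → 0 ≤ e → 1 ≤ x ^ e := fun x e h1 he =>
    Real.one_le_rpow h1 he
  rcases le_total V 1 with hV1 | hV1 <;> rcases le_total W 1 with hW1 | hW1
  · exact Or.inl (mul_le_mul (hle V hV α hV1 hα1) (hle W hW β hW1 hβ1) hW.le (by positivity))
  · exact Or.inr (Or.inl ((hle V hV α hV1 hα1).trans
      (le_mul_of_one_le_right (by positivity) (hone W β hW1 hβ0))))
  · exact Or.inr (Or.inr ((hle W hW β hW1 hβ1).trans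
      (le_mul_of_one_le_left (by positivity) (hone V α hV1 hα0))))
  · rcases le_total V W with h | h
    · refine Or.inr (Or.inl ?_)
      calc V = V ^ (1 : ℝ) := (Real.rpow_one V).symm
        _ ≤ V ^ (α + β) := Real.rpow_le_rpow_of_exponent_le hV1 hαβ
        _ = V ^ α * V ^ β := Real.rpow_add hV _ _
        _ ≤ _ := by gcongr
    · refine Or.inr (Or.inr ?_)
      calc W = W ^ (1 : ℝ) := (Real.rpow_one W).symm
        _ ≤ W ^ (α + β) := Real.rpow_le_rpow_of_exponent_le hW1 hαβ
        _ = W ^ α * W ^ β := Real.rpow_add hW _ _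
        _ ≤ _ := by gcongr

/-- Optimization of a two-term bound over the dyadic scale. -/
lemma le_of_forall_dyadic_bound {V W Z H a c₁ c₂ S Y : ℝ} (hZ : 0 < Z) (hH : 0 < H)
    (ha : 0 < a) (hc₁ : 0 ≤ c₁) (hc₂ : 0 ≤ c₂) (hVW : V * W = Z * H)
    (hY : Y = Z ^ (a / (1 + a)) * H) (hmin : V * W ≤ Y ∨ V ≤ Y ∨ W ≤ Y)
    (hVWb : ∀ J : ℕ, 1 ≤ J → S ≤ c₁ * (2 ^ J * (V * W)) + c₂ * (((1 / 2 : ℝ) ^ a) ^ J * H))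
    (hVb : S ≤ c₁ * (2 * V) + c₂ * ((1 / 2 : ℝ) ^ a * H))
    (hWb : S ≤ c₁ * (2 * W) + c₂ * ((1 / 2 : ℝ) ^ a * H)) :
    S ≤ (2 * c₁ + c₂) * Y := by
  have ha1 : 0 < 1 + a := by linarith
  rcases le_or_gt Z 1 with hZ1 | hZ1
  -- The real number x solves xZ = x^{-a}, the balance of the two terms after division by H. The
  -- integer threshold n + 1 has 2^n ≤ x < 2^{n+1}, which costs the factor 2 in front of c₁.
  · set x : ℝ := Z ^ (-(1 / (1 + a))) with hx
    have hx1 : 1 ≤ x := Real.one_le_rpow_of_pos_of_le_one_of_nonpos hZ hZ1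
      (by rw [neg_nonpos]; positivity)
    have hx0 : 0 < x := by linarith
    obtain ⟨n, hn1, hn2⟩ := exists_nat_pow_near hx1 (one_lt_two : (1 : ℝ) < 2)
    refine (hVWb (n + 1) (by omega)).trans ?_
    have hρ : ((1 / 2 : ℝ) ^ a) ^ (n + 1) ≤ Z ^ (a / (1 + a)) := by
      have e1 : ((1 / 2 : ℝ) ^ a) ^ (n + 1) = ((2 : ℝ) ^ (n + 1)) ^ (-a) := by
        rw [Real.rpow_pow_comm (by norm_num), Real.rpow_neg (by positivity), one_div, inv_pow,
          Real.inv_rpow (by positivity)]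
      have e2 : Z ^ (a / (1 + a)) = x ^ (-a) := by
        rw [hx, ← Real.rpow_mul hZ.le]; congr 1; ring
      rw [e1, e2]
      exact Real.rpow_le_rpow_of_nonpos hx0 hn2.le (by linarith)
    have h2 : (2 : ℝ) ^ (n + 1) * (V * W) ≤ 2 * Y := by
      have e3 : x * Z = Z ^ (a / (1 + a)) := by
        rw [hx]
        nth_rw 2 [← Real.rpow_one Z]
        rw [← Real.rpow_add hZ]
        congr 1
        field_simp
        ring
      calc (2 : ℝ) ^ (n + 1) * (V * W) = 2 * (2 ^ n * (Z * H)) := by rw [hVW]; ring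
        _ ≤ 2 * (x * (Z * H)) := by gcongr
        _ = 2 * (x * Z * H) := by ring
        _ = 2 * Y := by rw [e3, hY]
    have h3 : ((1 / 2 : ℝ) ^ a) ^ (n + 1) * H ≤ Y := by rw [hY]; gcongr
    calc _ ≤ c₁ * (2 * Y) + c₂ * Y := by gcongr
      _ = _ := by ring
  -- Here the balance would lie below frequency one, so the threshold is J = 1 and the low part must
  -- be bounded by whichever of VW, V, W is at most Y.
  · have hHY : (1 / 2 : ℝ) ^ a * H ≤ Y := by
      rw [hY]
      gcongr
      exact (Real.rpow_le_one (by norm_num) (by norm_num) ha.le).trans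
        (Real.one_le_rpow hZ1.le (by positivity))
    have key : ∀ L, L ≤ Y → S ≤ c₁ * (2 * L) + c₂ * ((1 / 2 : ℝ) ^ a * H) →
        S ≤ (2 * c₁ + c₂) * Y := fun L hL hS =>
      calc S ≤ c₁ * (2 * L) + c₂ * ((1 / 2 : ℝ) ^ a * H) := hS
        _ ≤ c₁ * (2 * Y) + c₂ * Y := by gcongr
        _ = _ := by ring
    rcases hmin with h | h | h
    · exact key _ h (by simpa using hVWb 1 le_rfl)
    · exact key _ h hVb
    · exact key _ h hWb

end Balance

/-! ### The low-frequency part as a local average. -/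

section LowFrequency

open Real FourierTransform Metric

variable {d : ℕ}

local notation "𝔼" => EuclideanSpace ℝ (Fin d)

/-- The mass of `f` near `x`. -/
noncomputable def nearMass (r : ℝ) (f : 𝔼 → ℂ) (x : 𝔼) : ℝ :=
  ∫ y, ‖f y‖ * (closedBall (0 : 𝔼) r).indicator (fun _ => (1 : ℝ)) (x - y)

lemma integrable_indicator_closedBall (r : ℝ) :
    Integrable ((closedBall (0 : 𝔼) r).indicator fun _ => (1 : ℝ)) :=
  (integrable_indicator_iff measurableSet_closedBall).2
    (integrableOn_const measure_closedBall_lt_top.ne)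

lemma indicator_closedBall_nonneg (r : ℝ) (z : 𝔼) :
    0 ≤ (closedBall (0 : 𝔼) r).indicator (fun _ => (1 : ℝ)) z := indicator_nonneg (by simp) _

lemma indicator_closedBall_le_one (r : ℝ) (z : 𝔼) :
    (closedBall (0 : 𝔼) r).indicator (fun _ => (1 : ℝ)) z ≤ 1 :=
  indicator_le_self' (by simp) _

variable {r : ℝ} {f : EuclideanSpace ℝ (Fin d) → ℂ}

lemma integrable_nearMass_integrand (hf : Integrable f) (x : 𝔼) :
    Integrable fun y => ‖f y‖ * (closedBall (0 : 𝔼) r).indicator (fun _ => (1 : ℝ)) (x - y) := by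
  refine hf.norm.mul_bdd (c := 1) ((integrable_indicator_closedBall r).comp_sub_left x).1
    (Filter.Eventually.of_forall fun y => ?_)
  rw [Real.norm_of_nonneg (indicator_closedBall_nonneg r _)]
  exact indicator_closedBall_le_one r _

lemma nearMass_nonneg (x : 𝔼) : 0 ≤ nearMass r f x :=
  integral_nonneg fun y => mul_nonneg (norm_nonneg _) (indicator_closedBall_nonneg r _)

lemma nearMass_le_integral (hf : Integrable f) (x : 𝔼) : nearMass r f x ≤ ∫ y, ‖f y‖ :=
  integral_mono (integrable_nearMass_integrand hf x) hf.norm fun y =>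
    mul_le_of_le_one_right (norm_nonneg _) (indicator_closedBall_le_one r _)

lemma nearMass_le_volume (hf : Integrable f) (hf1 : ∀ x, ‖f x‖ ≤ 1) (x : 𝔼) :
    nearMass r f x ≤ volume.real (closedBall (0 : 𝔼) r) := by
  refine (integral_mono (integrable_nearMass_integrand hf x)
    ((integrable_indicator_closedBall r).comp_sub_left x) fun y =>
      mul_le_of_le_one_left (indicator_closedBall_nonneg r _) (hf1 y)).trans_eq ?_
  rw [integral_sub_left_eq_self ((closedBall (0 : 𝔼) r).indicator fun _ => (1 : ℝ)) volume x,
    integral_indicator measurableSet_closedBall]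
  simp

lemma integrable_nearMass_prod (hf : Integrable f) : Integrable (fun p : 𝔼 × 𝔼 =>
    ‖f p.2‖ * (closedBall (0 : 𝔼) r).indicator (fun _ => (1 : ℝ)) (p.1 - p.2))
      (volume.prod volume) := by
  simpa using Integrable.convolution_integrand (ContinuousLinearMap.mul ℝ ℝ) hf.norm
    (integrable_indicator_closedBall r)

lemma integrable_nearMass (hf : Integrable f) : Integrable (nearMass r f) :=
  (integrable_nearMass_prod hf).integral_prod_left

lemma integral_nearMass (hf : Integrable f) :
    ∫ x, nearMass r f x = (∫ y, ‖f y‖) * volume.real (closedBall (0 : 𝔼) r) := by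
  unfold nearMass
  rw [integral_integral_swap (integrable_nearMass_prod hf), ← integral_mul_const]
  congr with y
  rw [integral_const_mul,
    integral_sub_right_eq_self ((closedBall (0 : 𝔼) r).indicator fun _ => (1 : ℝ)) y,
    integral_indicator measurableSet_closedBall]
  simp

/-- The three elementary bounds for the low-frequency part. -/
lemma sum_setIntegral_nearMass_le (hf : Integrable f) (hf1 : ∀ x, ‖f x‖ ≤ 1) {T : Finset ℝ}
    {G : ℝ → Set 𝔼} (hG : ∀ t, MeasurableSet (G t)) (hGfin : ∀ t, volume (G t) ≠ ∞)
    (hdisj : (T : Set ℝ).PairwiseDisjoint G) {V W : ℝ} (hV : ∫ y, ‖f y‖ ≤ V)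
    (hGW : ∑ t ∈ T, volume.real (G t) ≤ W) :
    ∑ t ∈ T, ∫ x in G t, nearMass r f x ≤ V * W ∧
    ∑ t ∈ T, ∫ x in G t, nearMass r f x ≤ volume.real (closedBall (0 : 𝔼) r) * V ∧
    ∑ t ∈ T, ∫ x in G t, nearMass r f x ≤ volume.real (closedBall (0 : 𝔼) r) * W := by
  have hV0 : 0 ≤ V := (integral_nonneg fun y => norm_nonneg _).trans hV
  have key : ∀ L, 0 ≤ L → (∀ x, nearMass r f x ≤ L) → ∑ t ∈ T, ∫ x in G t, nearMass r f x ≤ L * W := by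
    intro L hL h
    calc ∑ t ∈ T, ∫ x in G t, nearMass r f x ≤ ∑ t ∈ T, L * volume.real (G t) := by
          refine Finset.sum_le_sum fun t _ => ?_
          refine (setIntegral_mono_on (integrable_nearMass hf).integrableOn
            (integrableOn_const (hGfin t)) (hG t) fun x _ => h x).trans_eq ?_
          simp [mul_comm]
      _ = L * ∑ t ∈ T, volume.real (G t) := by rw [Finset.mul_sum]
      _ ≤ _ := by gcongr
  refine ⟨key V hV0 fun x => (nearMass_le_integral hf x).trans hV, ?_,
    key _ measureReal_nonneg fun x => nearMass_le_volume hf hf1 x⟩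
  rw [← integral_biUnion_finset T (fun t _ => hG t) hdisj
    (fun t _ => (integrable_nearMass hf).integrableOn)]
  calc _ ≤ ∫ x, nearMass r f x := setIntegral_le_integral (integrable_nearMass hf)
        (Filter.Eventually.of_forall nearMass_nonneg)
    _ = (∫ y, ‖f y‖) * volume.real (closedBall (0 : 𝔼) r) := integral_nearMass hf
    _ ≤ V * volume.real (closedBall (0 : 𝔼) r) := by gcongr
    _ = _ := mul_comm _ _

/-- A majorant independent of t: once the kernel is replaced by its size δ^{-1} on a fixed ball, the
supremum over radii costs nothing. -/
lemma exists_norm_smoothMean_le [NeZero d] (hd : 2 ≤ d) (M : Mollifier d) : ∃ C : ℝ, 0 < C ∧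
    ∀ δ t : ℝ, 0 < δ → δ ≤ 1 → 1 ≤ t → t ≤ 2 → ∀ f : 𝔼 → ℂ, Integrable f → ∀ x,
      ‖M.smoothMean δ t f x‖ ≤ C * δ⁻¹ * nearMass (2 + M.R) f x := by
  obtain ⟨C, hC, hk⟩ := exists_smoothMean_kernel_bound hd M
  refine ⟨C, hC, fun δ t hδ hδ1 ht ht2 f hf x => ?_⟩
  rw [Mollifier.smoothMean, fourierInv_mul_fourier
    (Mollifier.integrable_profile_mul t (M.integrable_P_smul hδ)) hf, nearMass, ← integral_const_mul]
  refine norm_integral_le_of_norm_le ((integrable_nearMass_integrand hf x).const_mul _)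
    (Filter.Eventually.of_forall fun y => ?_)
  rw [norm_mul, mul_left_comm]
  refine mul_le_mul_of_nonneg_left ((hk δ t hδ hδ1 ht ht2 (x - y)).trans_eq ?_) (norm_nonneg _)
  by_cases h : x - y ∈ closedBall (0 : 𝔼) (2 + M.R)
  · rw [indicator_of_mem h, indicator_of_mem h, mul_one]
  · rw [indicator_of_notMem h, indicator_of_notMem h, mul_zero]

end LowFrequency
end SphericalMax

namespace SphericalMax

/-! ### Summing the frequencies: the restricted estimate. -/

section Core

open Real FourierTransform Metric

variable {d : ℕ} [NeZero d]

local notation "𝔼" => EuclideanSpace ℝ (Fin d)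

lemma continuous_sphericalMean {f : 𝔼 → ℂ} (hf : Continuous f) :
    Continuous fun q : ℝ × 𝔼 => sphericalMean q.1 f q.2 := by
  have h := continuous_parametric_integral_of_continuous (μ := sphereMeasure d)
    (f := fun (q : ℝ × 𝔼) (y : sphere (0 : 𝔼) 1) => f (q.2 - q.1 • (y : 𝔼)))
    (by unfold Function.uncurry; fun_prop) isCompact_univ
  simpa only [Measure.restrict_univ, sphericalMean] using h

lemma norm_sphericalMean_le {f : 𝔼 → ℂ} {B : ℝ} (hB : ∀ x, ‖f x‖ ≤ B) (t : ℝ) (x : 𝔼) :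
    ‖sphericalMean t f x‖ ≤ B := by
  refine (norm_integral_le_of_norm_le_const (C := B)
    (Filter.Eventually.of_forall fun y => hB _)).trans ?_
  simp

lemma Mollifier.integrableOn_norm_fourierInv_mult (M : Mollifier d) {δ : ℝ} (hδ : 0 < δ) (t : ℝ)
    {f : 𝔼 → ℂ} (hf : Integrable f) {G : Set 𝔼} (hG : volume G ≠ ∞) :
    IntegrableOn (fun x => ‖𝓕⁻ (fun ξ => (M.mult δ t ξ : ℂ) * 𝓕 f ξ) x‖) G :=
  integrableOn_of_continuous_of_bound
    (M.continuous_fourierInv_mult hδ hf continuous_const continuous_id).norm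
    (fun x => by rw [norm_norm]; exact norm_fourierInv_le _ _) hG

/-- The telescoping decomposition into frequency-localized pieces. -/
lemma Mollifier.norm_smoothMean_le_add_sum (M : Mollifier d) (J K : ℕ) (t : ℝ) {f : 𝔼 → ℂ}
    (hf : Integrable f) (x : 𝔼) :
    ‖M.smoothMean ((1 / 2) ^ (J + K)) t f x‖ ≤ ‖M.smoothMean ((1 / 2) ^ J) t f x‖ +
      ∑ i ∈ Finset.range K, ‖𝓕⁻ (fun ξ => (M.mult ((1 / 2) ^ (J + i)) t ξ : ℂ) * 𝓕 f ξ) x‖ := by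
  induction K with
  | zero => simp
  | succ K ih =>
    have h := M.smoothMean_half_sub (δ := (1 / 2) ^ (J + K)) (by positivity) t hf x
    have e : (1 / 2 : ℝ) ^ (J + (K + 1)) = 1 / 2 * (1 / 2) ^ (J + K) := by
      rw [← add_assoc, pow_succ]; ring
    rw [Finset.sum_range_succ, e, sub_eq_iff_eq_add'.1 h, ← add_assoc]
    exact (norm_add_le _ _).trans (add_le_add ih le_rfl)

/-- Bookkeeping: half of -(1-θ) + (D-1)θ is the exponent (Dθ-1)/2 of δ, and half of 2(1-θ) + θ is
the exponent 1 - θ/2 of W. -/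
lemma sqrt_level_eq {X I V W δ b θ D : ℝ} (hX : 0 < X) (hI : I ≤ V) (hV : 0 < V) (hW : 0 < W)
    (hδ : 0 < δ) (hb : b = (D * θ - 1) / 2) :
    √(X * (I * ((δ⁻¹ * W ^ 2) ^ (1 - θ) * (δ ^ (D - 1) * W) ^ θ))) ≤
      √X * (δ ^ b * (V ^ (1 / 2 : ℝ) * W ^ (1 - θ / 2))) := by
  refine Real.sqrt_le_iff.2 ⟨by positivity, ?_⟩
  have e : (δ⁻¹ * W ^ 2) ^ (1 - θ) * (δ ^ (D - 1) * W) ^ θ = (δ ^ b * W ^ (1 - θ / 2)) ^ 2 := by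
    rw [Real.mul_rpow (by positivity) (by positivity), Real.mul_rpow (by positivity) hW.le,
      mul_pow, ← Real.rpow_natCast, ← Real.rpow_natCast, ← Real.rpow_natCast, ← Real.rpow_mul hδ.le,
      ← Real.rpow_mul hδ.le, ← Real.rpow_mul hW.le, ← Real.rpow_mul hW.le, ← Real.rpow_neg_one,
      ← Real.rpow_mul hδ.le, mul_mul_mul_comm, ← Real.rpow_add hδ, ← Real.rpow_add hW, hb]
    push_cast
    ring_nf
  have e2 : (V ^ (1 / 2 : ℝ)) ^ 2 = V := by
    rw [← Real.rpow_natCast, ← Real.rpow_mul hV.le]; simp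
  calc X * (I * ((δ⁻¹ * W ^ 2) ^ (1 - θ) * (δ ^ (D - 1) * W) ^ θ))
      ≤ X * (V * ((δ⁻¹ * W ^ 2) ^ (1 - θ) * (δ ^ (D - 1) * W) ^ θ)) := by gcongr
    _ = √X ^ 2 * ((V ^ (1 / 2 : ℝ)) ^ 2 * (δ ^ b * W ^ (1 - θ / 2)) ^ 2) := by
        rw [e, e2, Real.sq_sqrt hX.le]
    _ = _ := by ring

/-- Summation of the frequency-localized estimates above the frequency `2 ^ J`. -/
lemma Mollifier.sum_setIntegral_sphericalMean_le (M : Mollifier d) {C₀ Y ρ : ℝ} (hρ0 : 0 ≤ ρ)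
    (hρ1 : ρ < 1) (hY : 0 ≤ Y) {f : 𝔼 → ℂ} (hfc : Continuous f) (hfs : HasCompactSupport f)
    (hf1 : ∀ x, ‖f x‖ ≤ 1) {T : Finset ℝ} {G : ℝ → Set 𝔼} (hGfin : ∀ t, volume (G t) ≠ ∞)
    (hlow : ∀ δ, 0 < δ → δ ≤ 1 → ∀ t ∈ T, ∀ x,
      ‖M.smoothMean δ t f x‖ ≤ C₀ * δ⁻¹ * nearMass (2 + M.R) f x)
    (hlev : ∀ j : ℕ, 1 ≤ j → ∑ t ∈ T, ∫ x in G t,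
      ‖𝓕⁻ (fun ξ => (M.mult ((1 / 2) ^ j) t ξ : ℂ) * 𝓕 f ξ) x‖ ≤ Y * ρ ^ j)
    {J : ℕ} (hJ : 1 ≤ J) : ∑ t ∈ T, ∫ x in G t, ‖sphericalMean t f x‖ ≤
      C₀ * 2 ^ J * (∑ t ∈ T, ∫ x in G t, nearMass (2 + M.R) f x) + Y * (ρ ^ J / (1 - ρ)) := by
  have hfi : Integrable f := hfc.integrable_of_hasCompactSupport hfs
  set L : ℝ := ∑ t ∈ T, volume.real (G t) with hL
  have hL0 : 0 ≤ L := Finset.sum_nonneg fun t _ => measureReal_nonneg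
  refine le_of_forall_pos_le_add fun ε hε => ?_
  -- Uniform convergence is enough because the sets have finite total measure L: the error of the
  -- last smooth mean integrates to at most ε, while the bounds on the pieces do not depend on their
  -- number K.
  obtain ⟨δ₀, hδ₀, hconv⟩ := M.tendsto_smoothMean hfc hfs (by positivity : 0 < ε / (1 + L))
  obtain ⟨K, hK⟩ := exists_pow_lt_of_lt_one hδ₀ (by norm_num : (1 / 2 : ℝ) < 1)
  have hKJ : (1 / 2 : ℝ) ^ (J + K) ≤ δ₀ :=
    (pow_le_pow_of_le_one (by norm_num) (by norm_num) (Nat.le_add_left K J)).trans hK.le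
  have hJ1 : (1 / 2 : ℝ) ^ J ≤ 1 := pow_le_one₀ (by norm_num) (by norm_num)
  set N : 𝔼 → ℝ := fun x => C₀ * 2 ^ J * nearMass (2 + M.R) f x with hN
  set F : ℝ → ℕ → 𝔼 → ℝ := fun t i x =>
    ‖𝓕⁻ (fun ξ => (M.mult ((1 / 2) ^ (J + i)) t ξ : ℂ) * 𝓕 f ξ) x‖ with hF
  have hpt : ∀ t ∈ T, ∀ x, ‖sphericalMean t f x‖ ≤
      N x + ∑ i ∈ Finset.range K, F t i x + ε / (1 + L) := by
    intro t ht x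
    have h1 := hconv _ (by positivity) hKJ t x
    have h2 := M.norm_smoothMean_le_add_sum J K t hfi x
    have h3 := hlow ((1 / 2) ^ J) (by positivity) hJ1 t ht x
    have h4 := norm_sub_norm_le (sphericalMean t f x) (M.smoothMean ((1 / 2) ^ (J + K)) t f x)
    have e : ((1 / 2 : ℝ) ^ J)⁻¹ = 2 ^ J := by rw [one_div, inv_pow, inv_inv]
    rw [e] at h3
    simp only [hN, hF]
    linarith
  have hiN : ∀ t, IntegrableOn N (G t) := fun t => ((integrable_nearMass hfi).const_mul _).integrableOn
  have hiF : ∀ t, ∀ i ∈ Finset.range K, IntegrableOn (F t i) (G t) := fun t i _ =>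
    M.integrableOn_norm_fourierInv_mult (by positivity) t hfi (hGfin t)
  have hiS : ∀ t, IntegrableOn (fun x => ∑ i ∈ Finset.range K, F t i x) (G t) := fun t =>
    integrable_finsetSum _ (hiF t)
  have hiNS : ∀ t, IntegrableOn (fun x => N x + ∑ i ∈ Finset.range K, F t i x) (G t) := fun t =>
    (hiN t).add (hiS t)
  have hiC : ∀ t, IntegrableOn (fun _ : 𝔼 => ε / (1 + L)) (G t) := fun t =>
    integrableOn_const (hGfin t)
  have hiA : ∀ t, IntegrableOn (fun x => ‖sphericalMean t f x‖) (G t) := fun t =>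
    integrableOn_of_continuous_of_bound (((continuous_sphericalMean hfc).comp
      (by fun_prop : Continuous fun x : 𝔼 => (t, x))).norm)
      (fun x => by rw [norm_norm]; exact norm_sphericalMean_le hf1 t x) (hGfin t)
  have hgeom : ∑ i ∈ Finset.range K, ρ ^ (J + i) ≤ ρ ^ J / (1 - ρ) := by
    simp_rw [pow_add]
    rw [← Finset.mul_sum, div_eq_mul_inv]
    gcongr
    rw [← tsum_geometric_of_lt_one hρ0 hρ1]
    exact (summable_geometric_of_lt_one hρ0 hρ1).sum_le_tsum _ fun i _ => by positivity
  calc ∑ t ∈ T, ∫ x in G t, ‖sphericalMean t f x‖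
      ≤ ∑ t ∈ T, ((∫ x in G t, N x) + (∑ i ∈ Finset.range K, ∫ x in G t, F t i x) +
        ε / (1 + L) * volume.real (G t)) := by
        refine Finset.sum_le_sum fun t ht => ?_
        refine (integral_mono (hiA t) ((hiNS t).add (hiC t)) (hpt t ht)).trans_eq ?_
        have e1 := integral_add (hiNS t) (hiC t)
        have e2 := integral_add (hiN t) (hiS t)
        have e3 := integral_finsetSum (Finset.range K) (hiF t)
        rw [e2, e3] at e1
        refine e1.trans ?_
        rw [setIntegral_const, smul_eq_mul, mul_comm (volume.real (G t))]
    _ = (∑ t ∈ T, ∫ x in G t, N x) + (∑ i ∈ Finset.range K, ∑ t ∈ T, ∫ x in G t, F t i x) +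
        ε / (1 + L) * L := by
        rw [Finset.sum_add_distrib, Finset.sum_add_distrib, Finset.sum_comm, hL, Finset.mul_sum]
    _ ≤ C₀ * 2 ^ J * (∑ t ∈ T, ∫ x in G t, nearMass (2 + M.R) f x) +
        (∑ i ∈ Finset.range K, Y * ρ ^ (J + i)) + ε := by
        refine add_le_add (add_le_add (le_of_eq ?_) (Finset.sum_le_sum fun i _ =>
          hlev (J + i) (by omega))) ?_
        · rw [Finset.mul_sum]
          exact Finset.sum_congr rfl fun t _ => integral_const_mul _ _
        · rw [div_mul_eq_mul_div, div_le_iff₀ (by positivity)]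
          nlinarith
    _ ≤ _ := by
        rw [← Finset.mul_sum]
        gcongr

/-- The relations between the exponents. -/
lemma exponent_relations (hd : 2 ≤ d) {γ : ℝ} (hγ0 : 0 ≤ γ) (hγd : 2 * γ < ((d : ℝ) - 1) ^ 2)
    {θ a : ℝ} (hθ : θ = (((d : ℝ) - 1) / 2) / (((d : ℝ) - 1) / 2 + γ)) (ha : a = (d * θ - 1) / 2) :
    0 < θ ∧ 0 < a ∧ 1 / p4 d γ = 1 / 2 + 1 / 2 * (a / (1 + a)) ∧
      1 - 1 / q4 d γ = 1 - θ / 2 + θ / 2 * (a / (1 + a)) ∧ 1 / p4 d γ = d / q4 d γ ∧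
      (d : ℝ) + 1 ≤ q4 d γ := by
  have hd' : (2 : ℝ) ≤ d := by exact_mod_cast hd
  have hden : 0 < ((d : ℝ) - 1) / 2 + γ := by linarith
  have hθ0 : 0 < θ := by rw [hθ]; exact div_pos (by linarith) hden
  have hθ1 : θ ≤ 1 := by rw [hθ]; exact (div_le_one hden).2 (by linarith)
  have ha0 : 0 < a := by
    -- After clearing the denominator this is the hypothesis 2γ < (d-1)²; it is the summability over
    -- frequencies.
    have : 1 < d * θ := by
      rw [hθ, mul_div_assoc', one_lt_div hden]
      nlinarith
    rw [ha]; linarith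
  have hθinv : ((d : ℝ) - 1 + 2 * γ) * θ = d - 1 := by
    have h : θ * (((d : ℝ) - 1) / 2 + γ) = ((d : ℝ) - 1) / 2 := by
      rw [hθ, div_mul_cancel₀ _ hden.ne']
    linear_combination 2 * h
  -- Everything about q4 follows from this identity: with 1 + a = (dθ+1)/2 it says q4 = 2(1+a)/θ.
  have hq : q4 d γ * θ = d * θ + 1 := by
    rw [q4, div_mul_eq_mul_div, div_eq_iff (by linarith : (d : ℝ) - 1 ≠ 0)]
    linear_combination hθinv
  have hqd : (d : ℝ) + 1 ≤ q4 d γ := by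
    have : ((d : ℝ) + 1) * θ ≤ q4 d γ * θ := by rw [hq]; nlinarith
    exact le_of_mul_le_mul_right this hθ0
  have hp : 1 / p4 d γ = d / q4 d γ := by
    rw [p4, q4, one_div_div, div_div_eq_mul_div]
    congr 1
    ring
  have hqθ : q4 d γ = (d * θ + 1) / θ := by rw [eq_div_iff hθ0.ne', hq]
  have hdθ : 0 < d * θ + 1 := by positivity
  have h1a : 1 + a = (d * θ + 1) / 2 := by rw [ha]; ring
  refine ⟨hθ0, ha0, ?_, ?_, hp, hqd⟩
  · rw [hp, hqθ, h1a, ha]; field_simp; ring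
  · rw [hqθ, h1a, ha]; field_simp; ring

/-- The restricted estimate for continuous functions, in its linearized and dual form. -/
lemma exists_restricted_bound (hd : 2 ≤ d) {γ : ℝ} (hγ0 : 0 ≤ γ) (hγ1 : γ ≤ 1)
    (hγd : 2 * γ < ((d : ℝ) - 1) ^ 2) (A : ℝ≥0) : ∃ C : ℝ, 0 < C ∧ ∀ (E : Set ℝ), E ⊆ Icc 1 2 →
      assouadSup γ E ≤ A → ∀ (T : Finset ℝ), (T : Set ℝ) ⊆ E → ∀ (G : ℝ → Set 𝔼),
      (∀ t, MeasurableSet (G t)) → (∀ t, volume (G t) ≠ ∞) → (T : Set ℝ).PairwiseDisjoint G →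
      ∀ V W, 0 < V → 0 < W → ∑ t ∈ T, volume.real (G t) ≤ W → ∀ f : 𝔼 → ℂ, Continuous f →
      HasCompactSupport f → (∀ x, ‖f x‖ ≤ 1) → ∫ x, ‖f x‖ ≤ V →
      ∑ t ∈ T, ∫ x in G t, ‖sphericalMean t f x‖ ≤
        C * (V ^ (1 / p4 d γ) * W ^ (1 - 1 / q4 d γ)) := by
  obtain ⟨M⟩ := nonempty_mollifier d
  obtain ⟨X, hX, hlevel⟩ := exists_level_bound hd M hγ0 hγ1 A
  obtain ⟨C₀, hC₀, hlow⟩ := exists_norm_smoothMean_le hd M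
  have hd' : (2 : ℝ) ≤ d := by exact_mod_cast hd
  set θ : ℝ := (((d : ℝ) - 1) / 2) / (((d : ℝ) - 1) / 2 + γ) with hθ
  set a : ℝ := (d * θ - 1) / 2 with ha
  obtain ⟨hθ0, ha0, hα, hβ, hp, hqd⟩ := exponent_relations hd hγ0 hγd hθ ha
  have hq0 : 0 < q4 d γ := by linarith
  set ρ : ℝ := (1 / 2 : ℝ) ^ a with hρ
  have hρ0 : 0 < ρ := by positivity
  have hρ1 : ρ < 1 := Real.rpow_lt_one (by norm_num) (by norm_num) ha0
  have h1ρ := sub_pos.2 hρ1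
  -- Adding 1 gives B ≥ 1, so the three elementary low-frequency bounds share one constant.
  set B : ℝ := 1 + volume.real (closedBall (0 : 𝔼) (2 + M.R)) with hB
  have hB1 : 1 ≤ B := le_add_of_nonneg_right measureReal_nonneg
  have hvolB : volume.real (closedBall (0 : 𝔼) (2 + M.R)) ≤ B := by rw [hB]; linarith
  refine ⟨2 * (C₀ * B) + √X / (1 - ρ), by positivity, ?_⟩
  intro E hE hA T hT G hG hGfin hdisj V W hV hW hGW f hfc hfs hf1 hfV
  have hfi : Integrable f := hfc.integrable_of_hasCompactSupport hfs
  have hf2 : MemLp f 2 := hfc.memLp_of_hasCompactSupport hfs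
  have hI : ∫ x, ‖f x‖ ^ 2 ≤ V := by
    refine le_trans (integral_mono_of_nonneg (Filter.Eventually.of_forall fun x => by positivity)
      hfi.norm (Filter.Eventually.of_forall fun x => ?_)) hfV
    simpa [sq] using mul_le_of_le_one_left (norm_nonneg (f x)) (hf1 x)
  set H : ℝ := V ^ (1 / 2 : ℝ) * W ^ (1 - θ / 2) with hH
  have hH0 : 0 < H := by positivity
  have hlev : ∀ j : ℕ, 1 ≤ j → ∑ t ∈ T, ∫ x in G t,
      ‖𝓕⁻ (fun ξ => (M.mult ((1 / 2) ^ j) t ξ : ℂ) * 𝓕 f ξ) x‖ ≤ √X * H * ρ ^ j := by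
    intro j hj
    have hδ2 : (1 / 2 : ℝ) ^ j ≤ 1 / 2 := by
      simpa using pow_le_pow_of_le_one (by norm_num : (0 : ℝ) ≤ 1 / 2) (by norm_num) hj
    refine (hlevel E hE hA T hT G hG hGfin hdisj W hW hGW ((1 / 2) ^ j) (by positivity) hδ2 f hfi
      hf2).trans ((sqrt_level_eq (b := a) hX hI hV hW (by positivity) rfl).trans_eq ?_)
    rw [hρ, Real.rpow_pow_comm (by norm_num)]
    ring
  obtain ⟨hn1, hn2, hn3⟩ := sum_setIntegral_nearMass_le (r := 2 + M.R) hfi hf1 hG hGfin hdisj hfV hGW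
  have hhigh := fun (J : ℕ) (hJ : 1 ≤ J) => M.sum_setIntegral_sphericalMean_le hρ0.le hρ1
    (by positivity) hfc hfs hf1 hGfin (fun δ hδ hδ1 t ht x =>
      hlow δ t hδ hδ1 (hE (hT ht)).1 (hE (hT ht)).2 f hfi x) hlev hJ
  generalize ∑ t ∈ T, ∫ x in G t, nearMass (2 + M.R) f x = n at hn1 hn2 hn3 hhigh
  generalize ∑ t ∈ T, ∫ x in G t, ‖sphericalMean t f x‖ = S at hhigh ⊢
  clear hlev hlevel hlow
  have hfin : ∀ J : ℕ, 1 ≤ J → ∀ L, n ≤ B * L → S ≤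
      C₀ * B * (2 ^ J * L) + √X / (1 - ρ) * (ρ ^ J * H) := by
    intro J hJ L hL
    refine (hhigh J hJ).trans (add_le_add ?_ (le_of_eq (by ring)))
    calc C₀ * 2 ^ J * n ≤ C₀ * 2 ^ J * (B * L) := by gcongr
      _ = _ := by ring
  -- Z is the ratio VW/H. With it Y = Z^{a/(1+a)} H has exactly the exponents 1/p4 and 1 - 1/q4,
  -- which lie in [0,1] and have sum at least 1.
  refine le_of_forall_dyadic_bound (V := V) (W := W) (Z := V ^ (1 / 2 : ℝ) * W ^ (θ / 2)) (H := H)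
    (a := a) (c₁ := C₀ * B) (by positivity) hH0 ha0 (by positivity) (by positivity) ?_ ?_ ?_
    (fun J hJ => hfin J hJ _ (hn1.trans (le_mul_of_one_le_left (by positivity) hB1))) ?_ ?_
  · rw [hH, mul_mul_mul_comm, ← Real.rpow_add hV, ← Real.rpow_add hW]
    norm_num
  · rw [hH, Real.mul_rpow (by positivity) (by positivity), mul_mul_mul_comm, ← Real.rpow_mul hV.le,
      ← Real.rpow_mul hW.le, ← Real.rpow_add hV, ← Real.rpow_add hW, hα, hβ, add_comm (1 / 2 : ℝ),
      add_comm (1 - θ / 2)]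
  · rw [hp]
    refine min_le_rpow_mul_rpow hV hW (by positivity) ((div_le_one hq0).2 (by linarith)) ?_ ?_ ?_
    · rw [sub_nonneg, div_le_one hq0]; linarith
    · have : 0 ≤ 1 / q4 d γ := by positivity
      linarith
    · have : 1 / q4 d γ ≤ d / q4 d γ := by gcongr; linarith
      linarith
  · have := hfin 1 le_rfl V (hn2.trans (by gcongr))
    rwa [pow_one, pow_one] at this
  · have := hfin 1 le_rfl W (hn3.trans (by gcongr))
    rwa [pow_one, pow_one] at this

end Core
end SphericalMax

namespace SphericalMax

/-! ### From continuous functions to open sets. -/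

section OpenSets

open Metric

variable {d : ℕ}

local notation "𝔼" => EuclideanSpace ℝ (Fin d)

/-- The distribution of `x - t y` when `x` runs through `G t` and `y` through the sphere, summed over
the radii `t ∈ T`. -/
noncomputable def pushMeasure (T : Finset ℝ) (G : ℝ → Set 𝔼) : Measure 𝔼 :=
  ∑ t ∈ T, ((volume.restrict (G t)).prod (sphereMeasure d)).map
    fun q : 𝔼 × sphere (0 : 𝔼) 1 => q.1 - t • (q.2 : 𝔼)

/-- The restricted estimate, in its linearized and dual form. -/
def RestrictedWeakType (d : ℕ) (E : Set ℝ) (K : ℝ≥0∞) (α β : ℝ) : Prop :=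
  ∀ T : Finset ℝ, (T : Set ℝ) ⊆ E → ∀ G : ℝ → Set (EuclideanSpace ℝ (Fin d)),
    (∀ t, MeasurableSet (G t)) → (∀ t, volume (G t) ≠ ∞) → (T : Set ℝ).PairwiseDisjoint G →
    ∀ U : Set (EuclideanSpace ℝ (Fin d)), IsOpen U →
      pushMeasure T G U ≤ K * volume U ^ α * (∑ t ∈ T, volume (G t)) ^ β

variable [NeZero d]

lemma measurable_sub_smul_sphere (t : ℝ) :
    Measurable fun q : 𝔼 × sphere (0 : 𝔼) 1 => q.1 - t • (q.2 : 𝔼) :=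
  (by fun_prop : Continuous fun q : 𝔼 × sphere (0 : 𝔼) 1 => q.1 - t • (q.2 : 𝔼)).measurable

lemma lintegral_pushMeasure (T : Finset ℝ) (G : ℝ → Set 𝔼) {g : 𝔼 → ℝ≥0∞} (hg : Measurable g) :
    ∫⁻ z, g z ∂(pushMeasure T G) =
      ∑ t ∈ T, ∫⁻ x in G t, ∫⁻ y, g (x - t • (y : 𝔼)) ∂(sphereMeasure d) := by
  rw [pushMeasure, lintegral_finsetSum_measure]
  refine Finset.sum_congr rfl fun t _ => ?_
  rw [lintegral_map hg (measurable_sub_smul_sphere t)]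
  exact lintegral_prod _ (hg.comp (measurable_sub_smul_sphere t)).aemeasurable

lemma isFiniteMeasure_pushMeasure (T : Finset ℝ) {G : ℝ → Set 𝔼} (hG : ∀ t, volume (G t) ≠ ∞) :
    IsFiniteMeasure (pushMeasure T G) := by
  refine ⟨?_⟩
  have h := lintegral_pushMeasure T G (g := fun _ => 1) measurable_const
  simp only [lintegral_const, one_mul, measure_univ, Measure.restrict_apply_univ] at h
  rw [h]
  exact ENNReal.sum_lt_top.2 fun t _ => (hG t).lt_top

/-- The push-forward is a finite measure, so an open set is exhausted by compact ones from inside,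
and a Urysohn function between K and U is an admissible f. Null and infinite volumes are treated
apart, since the hypothesis takes only positive real V and W. -/
lemma restrictedWeakType_of_continuous {E : Set ℝ} {C α β : ℝ} (hC : 0 < C) (hα : 0 < α)
    (h : ∀ (T : Finset ℝ), (T : Set ℝ) ⊆ E → ∀ (G : ℝ → Set 𝔼),
      (∀ t, MeasurableSet (G t)) → (∀ t, volume (G t) ≠ ∞) → (T : Set ℝ).PairwiseDisjoint G →
      ∀ V W, 0 < V → 0 < W → ∑ t ∈ T, volume.real (G t) ≤ W → ∀ f : 𝔼 → ℂ, Continuous f →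
      HasCompactSupport f → (∀ x, ‖f x‖ ≤ 1) → ∫ x, ‖f x‖ ≤ V →
      ∑ t ∈ T, ∫ x in G t, ‖sphericalMean t f x‖ ≤ C * (V ^ α * W ^ β)) :
    RestrictedWeakType d E (ENNReal.ofReal C) α β := by
  intro T hT G hG hGfin hdisj U hU
  have hfm := isFiniteMeasure_pushMeasure T hGfin
  have hWfin : ∑ t ∈ T, volume (G t) ≠ ∞ := ENNReal.sum_ne_top.2 fun t _ => hGfin t
  rcases eq_or_ne (∑ t ∈ T, volume (G t)) 0 with hW0 | hW0
  · have hz : pushMeasure T G U = 0 := by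
      refine measure_mono_null (subset_univ U) ?_
      have h := lintegral_pushMeasure T G (g := fun _ => 1) measurable_const
      simp only [lintegral_const, one_mul, measure_univ, Measure.restrict_apply_univ] at h
      rw [h, hW0]
    rw [hz]
    exact zero_le
  rcases eq_or_ne (volume U) 0 with hU0 | hU0
  · rw [hU.measure_eq_zero_iff volume] at hU0
    simp [hU0]
  have hCpos : ENNReal.ofReal C ≠ 0 := by simpa using hC
  have hWβ : (∑ t ∈ T, volume (G t)) ^ β ≠ 0 := (ENNReal.rpow_pos (pos_iff_ne_zero.2 hW0) hWfin).ne'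
  rcases eq_or_ne (volume U) ∞ with hUt | hUt
  · rw [hUt, ENNReal.top_rpow_of_pos hα, ENNReal.mul_top hCpos, ENNReal.top_mul hWβ]
    exact le_top
  rw [hU.measure_eq_iSup_isCompact]
  refine iSup₂_le fun K hKU => iSup_le fun hK => ?_
  obtain ⟨φ, hφ1, hφ0, hφs, hφI⟩ := exists_continuous_one_zero_of_isCompact hK hU.isClosed_compl
    (disjoint_compl_right_iff_subset.2 hKU)
  set f : 𝔼 → ℂ := fun x => (φ x : ℂ) with hf
  have hfc : Continuous f := Complex.continuous_ofReal.comp φ.continuous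
  have hfs : HasCompactSupport f := hφs.comp_left Complex.ofReal_zero
  have hfn : ∀ x, ‖f x‖ = φ x := fun x => by
    rw [hf, Complex.norm_real, Real.norm_of_nonneg (hφI x).1]
  have hV : ∫ x, ‖f x‖ ≤ volume.real U := by
    calc ∫ x, ‖f x‖ ≤ ∫ x, U.indicator (fun _ => (1 : ℝ)) x := by
          refine integral_mono (hfc.integrable_of_hasCompactSupport hfs).norm
            ((integrable_indicator_iff hU.measurableSet).2 (integrableOn_const hUt)) fun x => ?_
          simp only [hfn]
          by_cases hx : x ∈ U
          · rw [indicator_of_mem hx]; exact (hφI x).2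
          · rw [indicator_of_notMem hx]; exact (hφ0 hx).le
      _ = volume.real U := by rw [integral_indicator hU.measurableSet]; simp
  have hVpos : 0 < volume.real U := ENNReal.toReal_pos hU0 hUt
  have hWreal : ∑ t ∈ T, volume.real (G t) = (∑ t ∈ T, volume (G t)).toReal :=
    (ENNReal.toReal_sum fun t _ => hGfin t).symm
  have hWpos : 0 < (∑ t ∈ T, volume (G t)).toReal := ENNReal.toReal_pos hW0 hWfin
  have hmain := h T hT G hG hGfin hdisj (volume.real U) _ hVpos hWpos hWreal.le f hfc hfs
    (fun x => by rw [hfn]; exact (hφI x).2) hV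
  have hiA : ∀ t, IntegrableOn (fun x => sphericalMean t f x) (G t) := fun t =>
    Measure.integrableOn_of_bounded (M := 1) (hGfin t) ((continuous_sphericalMean hfc).comp
      (by fun_prop : Continuous fun x : 𝔼 => (t, x))).aestronglyMeasurable
      (Filter.Eventually.of_forall fun x => norm_sphericalMean_le
        (fun x => by rw [hfn]; exact (hφI x).2) t x)
  -- There is no cancellation, as the bump is nonnegative.
  have hpt : ∀ t x, ∫⁻ y, ‖f (x - t • (y : 𝔼))‖ₑ ∂(sphereMeasure d) = ‖sphericalMean t f x‖ₑ := by
    intro t x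
    have hi : Integrable (fun y : sphere (0 : 𝔼) 1 => f (x - t • (y : 𝔼))) (sphereMeasure d) :=
      integrable_sphere_of_continuous (by fun_prop)
    rw [← ofReal_integral_norm_eq_lintegral_enorm hi, ← ofReal_norm]
    congr 1
    have e : sphericalMean t f x =
        ((∫ y : sphere (0 : 𝔼) 1, φ (x - t • (y : 𝔼)) ∂(sphereMeasure d) : ℝ) : ℂ) := by
      rw [sphericalMean, ← integral_complex_ofReal]
    rw [e, Complex.norm_real, Real.norm_of_nonneg (integral_nonneg fun y => (hφI _).1)]
    simp only [hfn]
  calc pushMeasure T G K = ∫⁻ z, K.indicator 1 z ∂(pushMeasure T G) := by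
        rw [lintegral_indicator_one hK.measurableSet]
    _ ≤ ∫⁻ z, ‖f z‖ₑ ∂(pushMeasure T G) := by
        refine lintegral_mono fun z => ?_
        by_cases hz : z ∈ K
        · rw [indicator_of_mem hz, ← ofReal_norm, hfn, hφ1 hz]; simp
        · rw [indicator_of_notMem hz]; exact zero_le
    _ = ∑ t ∈ T, ∫⁻ x in G t, ‖sphericalMean t f x‖ₑ := by
        rw [lintegral_pushMeasure T G hfc.enorm.measurable]
        simp only [hpt]
    _ = ENNReal.ofReal (∑ t ∈ T, ∫ x in G t, ‖sphericalMean t f x‖) := by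
        rw [ENNReal.ofReal_sum_of_nonneg fun t _ => integral_nonneg fun x => norm_nonneg _]
        exact Finset.sum_congr rfl fun t _ => (ofReal_integral_norm_eq_lintegral_enorm (hiA t)).symm
    _ ≤ ENNReal.ofReal (C * (volume.real U ^ α * (∑ t ∈ T, volume (G t)).toReal ^ β)) :=
        ENNReal.ofReal_le_ofReal hmain
    _ = _ := by
        rw [ENNReal.ofReal_mul hC.le, ENNReal.ofReal_mul (by positivity),
          ← ENNReal.ofReal_rpow_of_pos hVpos, ← ENNReal.ofReal_rpow_of_pos hWpos,
          ENNReal.ofReal_toReal hWfin, measureReal_def, ENNReal.ofReal_toReal hUt, mul_assoc]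

end OpenSets

/-! ### From the dual form to weak type for sums over open sets. -/

section WeakType

open Metric

variable {d : ℕ} [NeZero d]

local notation "𝔼" => EuclideanSpace ℝ (Fin d)

/-- The maximal function of the upper integrals of a nonnegative function. -/
noncomputable def upperMaximal (E : Set ℝ) (h : 𝔼 → ℝ≥0∞) (x : 𝔼) : ℝ≥0∞ :=
  ⨆ t ∈ E, ∫⁻ y, h (x - t • (y : 𝔼)) ∂(sphereMeasure d)

lemma upperMaximal_mono {E : Set ℝ} {h g : 𝔼 → ℝ≥0∞} (hg : h ≤ g) :
    upperMaximal E h ≤ upperMaximal E g := fun _ =>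
  iSup₂_mono fun _ _ => lintegral_mono fun _ => hg _

/-- Fatou's lemma. Its consequence, openness of superlevel sets, replaces any measurability argument
for a supremum over uncountably many radii. -/
lemma lowerSemicontinuous_lintegral_sphere {g : 𝔼 → ℝ≥0∞} (hg : LowerSemicontinuous g) (t : ℝ) :
    LowerSemicontinuous fun x => ∫⁻ y, g (x - t • (y : 𝔼)) ∂(sphereMeasure d) := by
  rw [lowerSemicontinuous_iff_le_liminf]
  intro x
  refine le_trans (lintegral_mono fun y => ?_) (lintegral_liminf_le fun x' => ?_)
  · exact ((hg.comp (by fun_prop : Continuous fun x' : 𝔼 => x' - t • (y : 𝔼)))).le_liminf x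
  · exact hg.measurable.comp (by fun_prop)

/-- A finite cover of a set by open sets has a disjoint refinement. -/
lemma exists_disjoint_refinement {X : Type*} [MeasurableSpace X] {K : Set X} (hK : MeasurableSet K)
    {T : Finset ℝ} {O : ℝ → Set X} (hO : ∀ t, MeasurableSet (O t)) (hKO : K ⊆ ⋃ t ∈ T, O t) :
    ∃ G : ℝ → Set X, (∀ t, MeasurableSet (G t)) ∧ (∀ t, G t ⊆ K ∩ O t) ∧
      (T : Set ℝ).PairwiseDisjoint G ∧ ⋃ t ∈ T, G t = K := by
  refine ⟨fun t => (K ∩ O t) \ ⋃ t' ∈ T.filter (· < t), O t', fun t => ?_, fun t => sdiff_subset, ?_, ?_⟩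
  · exact (hK.inter (hO t)).diff (Finset.measurableSet_biUnion _ fun t' _ => hO t')
  · have key : ∀ s ∈ T, ∀ t, s < t → Disjoint ((K ∩ O s) \ ⋃ t' ∈ T.filter (· < s), O t')
        ((K ∩ O t) \ ⋃ t' ∈ T.filter (· < t), O t') := by
      intro s hs t hst
      rw [Set.disjoint_left]
      rintro x ⟨⟨_, hxs⟩, _⟩ ⟨_, hxt⟩
      exact hxt (mem_biUnion (Finset.mem_coe.2 (Finset.mem_filter.2 ⟨hs, hst⟩)) hxs)
    intro s hs t ht hst
    rcases lt_or_gt_of_ne hst with h | h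
    · exact key s hs t h
    · exact (key t ht s h).symm
  · classical
    refine Subset.antisymm (iUnion₂_subset fun t _ => sdiff_subset.trans inter_subset_left) ?_
    intro x hx
    have hne : (T.filter fun t => x ∈ O t).Nonempty := by
      obtain ⟨t, ht, hxt⟩ := mem_iUnion₂.1 (hKO hx)
      exact ⟨t, Finset.mem_filter.2 ⟨ht, hxt⟩⟩
    set t₀ := (T.filter fun t => x ∈ O t).min' hne with ht₀
    obtain ⟨hT₀, hO₀⟩ := Finset.mem_filter.1 (Finset.min'_mem _ hne)
    refine mem_biUnion (Finset.mem_coe.2 hT₀) ⟨⟨hx, hO₀⟩, fun hmem => ?_⟩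
    obtain ⟨t', ht', hxt'⟩ := mem_iUnion₂.1 hmem
    obtain ⟨h1, h2⟩ := Finset.mem_filter.1 ht'
    exact absurd (Finset.min'_le _ t' (Finset.mem_filter.2 ⟨h1, hxt'⟩)) (not_le.2 h2)

/-- The weak type estimate for sums of indicators of open sets. -/
lemma RestrictedWeakType.weak_type_tsum {E : Set ℝ} {K : ℝ≥0∞} {α q : ℝ} (hq : 0 < q)
    (hR : RestrictedWeakType d E K α (1 - 1 / q)) {ι : Type*} [Countable ι] (c : ι → ℝ≥0∞)
    {U : ι → Set 𝔼} (hU : ∀ i, IsOpen (U i)) {s : ℝ≥0∞} (hs : s ≠ ∞) :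
    s * volume {x | s < upperMaximal E (fun x => ∑' i, c i * (U i).indicator 1 x) x} ^ (1 / q) ≤
      K * ∑' i, c i * volume (U i) ^ α := by
  set g : 𝔼 → ℝ≥0∞ := fun x => ∑' i, c i * (U i).indicator 1 x with hg
  have hgl : LowerSemicontinuous g := by
    refine lowerSemicontinuous_tsum fun i => ?_
    have e : (fun x => c i * (U i).indicator (1 : 𝔼 → ℝ≥0∞) x) = (U i).indicator fun _ => c i := by
      ext x
      by_cases hx : x ∈ U i <;> simp [hx]
    rw [e]
    exact (hU i).lowerSemicontinuous_indicator zero_le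
  set O : ℝ → Set 𝔼 := fun t => {x | s < ∫⁻ y, g (x - t • (y : 𝔼)) ∂(sphereMeasure d)} with hO
  have hOo : ∀ t, IsOpen (O t) := fun t => (lowerSemicontinuous_lintegral_sphere hgl t).isOpen_preimage s
  have hset : {x | s < upperMaximal E g x} = ⋃ t ∈ E, O t := by
    ext x
    simp only [upperMaximal, mem_ofPred_eq, lt_iSup_iff, mem_iUnion, hO]
  have hopen : IsOpen {x | s < upperMaximal E g x} := by
    rw [hset]; exact isOpen_biUnion fun t _ => hOo t
  have hq1 : 0 < 1 / q := by positivity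
  -- On a compact subset finitely many radii suffice, and a disjoint refinement of the cover selects
  -- one radius per point: this undoes the linearization.
  have key : ∀ L ⊆ {x | s < upperMaximal E g x}, IsCompact L →
      s * volume L ^ (1 / q) ≤ K * ∑' i, c i * volume (U i) ^ α := by
    intro L hL hLc
    rcases eq_or_ne (volume L) 0 with hL0 | hL0
    · rw [hL0, ENNReal.zero_rpow_of_pos hq1, mul_zero]; exact zero_le
    have hLt : volume L ≠ ∞ := hLc.measure_lt_top.ne
    rw [hset] at hL
    obtain ⟨T, hTE, hTfin, hT⟩ := hLc.elim_finite_subcover_image (fun t _ => hOo t) hL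
    obtain ⟨T, rfl⟩ := hTfin.exists_finset_coe
    obtain ⟨G, hGm, hGK, hdisj, hGun⟩ := exists_disjoint_refinement hLc.measurableSet
      (fun t => (hOo t).measurableSet) hT
    have hGfin : ∀ t, volume (G t) ≠ ∞ := fun t =>
      ((measure_mono ((hGK t).trans inter_subset_left)).trans_lt hLt.lt_top).ne
    have hsum : ∑ t ∈ T, volume (G t) = volume L := by
      rw [← hGun, measure_biUnion_finset hdisj fun t _ => hGm t]
    have h1 : s * volume L ≤ K * (∑' i, c i * volume (U i) ^ α) * volume L ^ (1 - 1 / q) := by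
      calc s * volume L = ∑ t ∈ T, ∫⁻ _ in G t, s := by
            rw [← hsum, Finset.mul_sum]
            simp
        _ ≤ ∑ t ∈ T, ∫⁻ x in G t, ∫⁻ y, g (x - t • (y : 𝔼)) ∂(sphereMeasure d) :=
            Finset.sum_le_sum fun t _ => setLIntegral_mono' (hGm t) fun x hx => (hGK t hx).2.le
        _ = ∫⁻ z, g z ∂(pushMeasure T G) := (lintegral_pushMeasure T G hgl.measurable).symm
        _ = ∑' i, c i * pushMeasure T G (U i) := by
            rw [hg, lintegral_tsum fun i => ((measurable_one.indicator
              (hU i).measurableSet).const_mul (c i)).aemeasurable]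
            refine tsum_congr fun i => ?_
            rw [lintegral_const_mul _ (measurable_one.indicator (hU i).measurableSet),
              lintegral_indicator_one (hU i).measurableSet]
        _ ≤ ∑' i, c i * (K * volume (U i) ^ α * volume L ^ (1 - 1 / q)) := by
            refine ENNReal.tsum_le_tsum fun i => ?_
            gcongr
            rw [← hsum]
            exact hR T hTE G hGm hGfin hdisj (U i) (hU i)
        _ = _ := by
            rw [← ENNReal.tsum_mul_left, ← ENNReal.tsum_mul_right]
            refine tsum_congr fun i => ?_
            ring
    -- The power 1 - 1/q is cancelled, which is legitimate because L has positive finite volume;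
    -- this is why compact subsets come before the full set.
    have e1 : s * volume L = s * volume L ^ (1 / q) * volume L ^ (1 - 1 / q) := by
      rw [mul_assoc, ← ENNReal.rpow_add _ _ hL0 hLt]
      simp
    rw [e1] at h1
    refine (ENNReal.mul_le_mul_iff_left ?_ ?_).1 h1
    · exact (ENNReal.rpow_pos (pos_iff_ne_zero.2 hL0) hLt).ne'
    · exact ENNReal.rpow_ne_top_of_ne_zero hL0 hLt
  rcases eq_or_ne s 0 with rfl | hs0
  · simp
  -- Solved for v, the bound passes to the supremum over compact subsets.
  have hiff : ∀ v : ℝ≥0∞, s * v ^ (1 / q) ≤ K * ∑' i, c i * volume (U i) ^ α ↔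
      v ≤ ((K * ∑' i, c i * volume (U i) ^ α) / s) ^ q := fun v => by
    rw [mul_comm s, ← ENNReal.le_div_iff_mul_le (Or.inl hs0) (Or.inl hs),
      one_div, ENNReal.rpow_inv_le_iff hq]
  rw [hiff, hopen.measure_eq_iSup_isCompact]
  exact iSup₂_le fun L hL => iSup_le fun hLc => (hiff _).1 (key L hL hLc)

end WeakType
end SphericalMax

namespace SphericalMax

/-! ### From open sets to arbitrary functions by dyadic levels. -/

section Distribution

open Metric

variable {d : ℕ}

local notation "𝔼" => EuclideanSpace ℝ (Fin d)

/-- The Lorentz functional `∫_0^∞ |{h > s}|^α ds` of a nonnegative function. -/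
noncomputable def distIntegral (α : ℝ) (h : 𝔼 → ℝ≥0∞) : ℝ≥0∞ :=
  ∫⁻ r in Ioi (0 : ℝ), volume {x | ENNReal.ofReal r < h x} ^ α

lemma distIntegral_mono {α : ℝ} (hα : 0 ≤ α) {h g : 𝔼 → ℝ≥0∞} (hg : h ≤ g) :
    distIntegral α h ≤ distIntegral α g :=
  lintegral_mono fun _ => ENNReal.rpow_le_rpow (measure_mono fun x hx => lt_of_lt_of_le hx (hg x)) hα

lemma distIntegral_eq_zero {α : ℝ} (hα : 0 < α) {h : 𝔼 → ℝ≥0∞} (hh : volume {x | h x ≠ 0} = 0) :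
    distIntegral α h = 0 := by
  have e : ∀ r : ℝ, volume {x | ENNReal.ofReal r < h x} ^ α = 0 := fun r => by
    have h0 : volume {x | ENNReal.ofReal r < h x} = 0 :=
      measure_mono_null (fun x hx => (lt_of_le_of_lt zero_le hx).ne') hh
    rw [h0, ENNReal.zero_rpow_of_pos hα]
  simp [distIntegral, e]

/-- The coefficient 2^{k+1} is four times the length of (2^{k-1}, 2^k], an interval on which the
distribution function is at least its value at 2^k. This is the source of the 4 in the comparison
with the Lorentz functional. -/
lemma ofReal_zpow_succ_mul (k : ℤ) (v : ℝ≥0∞) : ENNReal.ofReal (2 ^ (k + 1)) * v =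
    4 * ∫⁻ _ in Ioc ((2 : ℝ) ^ (k - 1)) (2 ^ k), v := by
  rw [setLIntegral_const, Real.volume_Ioc]
  have e : (2 : ℝ) ^ (k + 1) = 4 * (2 ^ k - 2 ^ (k - 1)) := by
    rw [zpow_add_one₀ (by norm_num), zpow_sub_one₀ (by norm_num)]; ring
  rw [e, ENNReal.ofReal_mul (by norm_num)]
  simp only [ENNReal.ofReal_ofNat]
  ring

lemma tsum_dyadic_le_distIntegral {α : ℝ} (hα : 0 ≤ α) (h : 𝔼 → ℝ≥0∞) :
    ∑' k : ℤ, ENNReal.ofReal (2 ^ (k + 1)) * volume {x | ENNReal.ofReal (2 ^ k) < h x} ^ α ≤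
      4 * distIntegral α h := by
  simp only [ofReal_zpow_succ_mul]
  rw [ENNReal.tsum_mul_left]
  gcongr
  have hmono : Monotone fun k : ℤ => (2 : ℝ) ^ (k - 1) := fun a b hab =>
    zpow_le_zpow_right₀ (by norm_num) (by omega)
  have hdisj : Pairwise (Function.onFun Disjoint fun k : ℤ => Ioc ((2 : ℝ) ^ (k - 1)) (2 ^ k)) := by
    have := hmono.pairwise_disjoint_on_Ioc_succ
    simpa using this
  calc ∑' k : ℤ, ∫⁻ _ in Ioc ((2 : ℝ) ^ (k - 1)) (2 ^ k), volume {x | ENNReal.ofReal (2 ^ k) < h x} ^ α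
      ≤ ∑' k : ℤ, ∫⁻ r in Ioc ((2 : ℝ) ^ (k - 1)) (2 ^ k), volume {x | ENNReal.ofReal r < h x} ^ α := by
        refine ENNReal.tsum_le_tsum fun k => setLIntegral_mono' measurableSet_Ioc fun r hr => ?_
        exact ENNReal.rpow_le_rpow (measure_mono fun x hx =>
          lt_of_le_of_lt (ENNReal.ofReal_le_ofReal hr.2) hx) hα
    _ = ∫⁻ r in ⋃ k : ℤ, Ioc ((2 : ℝ) ^ (k - 1)) (2 ^ k), volume {x | ENNReal.ofReal r < h x} ^ α :=
        (lintegral_iUnion (fun k => measurableSet_Ioc) hdisj _).symm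
    _ ≤ distIntegral α h := by
        refine lintegral_mono_set (iUnion_subset fun k r hr => ?_)
        exact lt_trans (by positivity : (0 : ℝ) < 2 ^ (k - 1)) hr.1

/-- For r < h x one term suffices, the one with 2^k ≤ r < 2^{k+1}; letting r increase also covers
infinite values of h. -/
lemma le_tsum_dyadic (h : 𝔼 → ℝ≥0∞) {U : ℤ → Set 𝔼}
    (hU : ∀ k, {x | ENNReal.ofReal (2 ^ k) < h x} ⊆ U k) (x : 𝔼) :
    h x ≤ ∑' k : ℤ, ENNReal.ofReal (2 ^ (k + 1)) * (U k).indicator 1 x := by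
  refine le_of_forall_lt_imp_le_of_dense fun r hr => ?_
  rcases eq_or_ne r 0 with rfl | hr0
  · exact zero_le
  have hrt : r ≠ ∞ := (hr.trans_le le_top).ne
  obtain ⟨k, hk1, hk2⟩ := exists_mem_Ico_zpow (ENNReal.toReal_pos hr0 hrt) (one_lt_two : (1 : ℝ) < 2)
  have hxU : x ∈ U k := hU k (lt_of_le_of_lt
    ((ENNReal.ofReal_le_ofReal hk1).trans_eq (ENNReal.ofReal_toReal hrt)) hr)
  refine le_trans ?_ (ENNReal.le_tsum k)
  rw [indicator_of_mem hxU, Pi.one_apply, mul_one, ← ENNReal.ofReal_toReal hrt]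
  exact ENNReal.ofReal_le_ofReal hk2.le

variable [NeZero d]

/-- The weak type estimate for arbitrary nonnegative functions. -/
lemma RestrictedWeakType.weak_type {E : Set ℝ} {K : ℝ≥0∞} (hK0 : K ≠ 0) (hKt : K ≠ ∞) {α q : ℝ}
    (hα0 : 0 < α) (hα1 : α ≤ 1) (hq : 0 < q) (hR : RestrictedWeakType d E K α (1 - 1 / q))
    (h : 𝔼 → ℝ≥0∞) {s : ℝ≥0∞} (hs : s ≠ ∞) :
    s * volume {x | s < upperMaximal E h x} ^ (1 / q) ≤ K * (4 * distIntegral α h) := by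
  rw [mul_comm K, ← ENNReal.div_le_iff hK0 hKt]
  refine le_of_forall_gt_imp_ge_of_dense fun y hy => ?_
  have hε : y - 4 * distIntegral α h ≠ 0 := (tsub_pos_of_lt hy).ne'
  obtain ⟨ε, hε0, hεsum⟩ := ENNReal.exists_pos_sum_of_countable' hε ℤ
  have hc0 : ∀ k : ℤ, ENNReal.ofReal ((2 : ℝ) ^ (k + 1)) ≠ 0 := fun k => by
    rw [Ne, ENNReal.ofReal_eq_zero, not_le]; positivity
  have hη : ∀ k : ℤ, (ε k / ENNReal.ofReal (2 ^ (k + 1))) ^ (1 / α) ≠ 0 := fun k => by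
    rw [Ne, ENNReal.rpow_eq_zero_iff_of_pos (by positivity)]
    exact (ENNReal.div_pos (hε0 k).ne' ENNReal.ofReal_ne_top).ne'
  -- Outer regularity applies to the superlevel sets even if they are not measurable. The excess
  -- volume is tuned so that, by subadditivity of the power α ≤ 1, the k-th term grows by at most `ε
  -- k`.
  choose U hFU hUo hUvol using fun k : ℤ =>
    {x | ENNReal.ofReal (2 ^ k) < h x}.exists_isOpen_le_add (volume : Measure 𝔼) (hη k)
  have hsumU : ∑' k : ℤ, ENNReal.ofReal (2 ^ (k + 1)) * volume (U k) ^ α ≤ y := by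
    calc ∑' k : ℤ, ENNReal.ofReal (2 ^ (k + 1)) * volume (U k) ^ α
        ≤ ∑' k : ℤ, (ENNReal.ofReal (2 ^ (k + 1)) *
          volume {x | ENNReal.ofReal (2 ^ k) < h x} ^ α + ε k) := by
          refine ENNReal.tsum_le_tsum fun k => ?_
          have h1 : volume (U k) ^ α ≤ volume {x | ENNReal.ofReal (2 ^ k) < h x} ^ α +
              ε k / ENNReal.ofReal (2 ^ (k + 1)) := by
            refine (ENNReal.rpow_le_rpow (hUvol k) hα0.le).trans
              ((ENNReal.rpow_add_le_add_rpow _ _ hα0.le hα1).trans_eq ?_)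
            rw [← ENNReal.rpow_mul, one_div_mul_cancel hα0.ne', ENNReal.rpow_one]
          refine (mul_le_mul_right h1 _).trans_eq ?_
          rw [mul_add, ENNReal.mul_div_cancel (hc0 k) ENNReal.ofReal_ne_top]
      _ = _ + ∑' k, ε k := ENNReal.tsum_add
      _ ≤ 4 * distIntegral α h + (y - 4 * distIntegral α h) :=
          add_le_add (tsum_dyadic_le_distIntegral hα0.le h) hεsum.le
      _ = y := add_tsub_cancel_of_le hy.le
  rw [ENNReal.div_le_iff hK0 hKt, mul_comm y]
  calc s * volume {x | s < upperMaximal E h x} ^ (1 / q)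
      ≤ s * volume {x | s < upperMaximal E
          (fun x => ∑' k : ℤ, ENNReal.ofReal (2 ^ (k + 1)) * (U k).indicator 1 x) x} ^ (1 / q) := by
        gcongr
        exact upperMaximal_mono (le_tsum_dyadic h hFU) _
    _ ≤ K * ∑' k : ℤ, ENNReal.ofReal (2 ^ (k + 1)) * volume (U k) ^ α :=
        hR.weak_type_tsum hq _ hUo hs
    _ ≤ K * y := by gcongr

end Distribution
end SphericalMax

namespace SphericalMax

/-! ### Almost everywhere consequences of the weak type bound. -/

section Pointwise

open Metric

variable {d : ℕ}

local notation "𝔼" => EuclideanSpace ℝ (Fin d)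

/-- The weak type estimate for the maximal function of upper integrals. -/
def WeakType (d : ℕ) (E : Set ℝ) (B : ℝ≥0∞) (α q : ℝ) : Prop :=
  ∀ (h : EuclideanSpace ℝ (Fin d) → ℝ≥0∞) (s : ℝ≥0∞), s ≠ ∞ →
    s * volume {x | s < upperMaximal E h x} ^ (1 / q) ≤ B * distIntegral α h

variable {E : Set ℝ} {B : ℝ≥0∞} {α q : ℝ}

/-- The level s is fixed while the Lorentz functional tends to zero. Dividing by B + 1 rather than B
allows B = 0. -/
lemma WeakType.measure_eq_zero (hw : WeakType d E B α q) (hB : B ≠ ∞) (hq : 0 < q)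
    {s : ℝ≥0∞} (hs0 : s ≠ 0) (hst : s ≠ ∞) {S : Set 𝔼}
    (hS : ∀ ε : ℝ≥0∞, ε ≠ 0 → ∃ h : 𝔼 → ℝ≥0∞, distIntegral α h ≤ ε ∧
      S ⊆ {x | s < upperMaximal E h x}) : volume S = 0 := by
  have h0 : s * volume S ^ (1 / q) = 0 := by
    refine nonpos_iff_eq_zero.1 (le_of_forall_gt_imp_ge_of_dense fun y hy => ?_)
    have hB1 : B + 1 ≠ ∞ := by simp [hB]
    obtain ⟨h, hh, hSh⟩ := hS (y / (B + 1)) (ENNReal.div_pos hy.ne' hB1).ne'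
    calc s * volume S ^ (1 / q) ≤ s * volume {x | s < upperMaximal E h x} ^ (1 / q) := by
          gcongr
      _ ≤ B * distIntegral α h := hw h s hst
      _ ≤ (B + 1) * (y / (B + 1)) := by gcongr; exact le_self_add
      _ = y := ENNReal.mul_div_cancel (by simp) hB1
  have h1 := (mul_eq_zero.1 h0).resolve_left hs0
  exact (ENNReal.rpow_eq_zero_iff_of_pos (by positivity)).1 h1

/-- Small Lorentz functionals force small maximal functions along the sequence. -/
lemma WeakType.ae_exists_le (hw : WeakType d E B α q) (hB : B ≠ ∞) (hq : 0 < q)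
    {h : ℕ → 𝔼 → ℝ≥0∞} (hh : ∀ ε : ℝ≥0∞, ε ≠ 0 → ∃ n, distIntegral α (h n) ≤ ε) :
    ∀ᵐ x, ∀ s : ℝ≥0∞, s ≠ 0 → ∃ n, upperMaximal E (h n) x ≤ s := by
  have key : ∀ m : ℕ, ∀ᵐ x, ∃ n, upperMaximal E (h n) x ≤ (m + 1 : ℝ≥0∞)⁻¹ := by
    intro m
    refine hw.measure_eq_zero hB hq (s := (m + 1 : ℝ≥0∞)⁻¹) (by simp) (by simp) fun ε hε => ?_
    obtain ⟨n, hn⟩ := hh ε hε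
    refine ⟨h n, hn, fun x hx => ?_⟩
    by_contra hx'
    exact hx ⟨n, not_lt.1 hx'⟩
  filter_upwards [ae_all_iff.2 key] with x hx s hs
  obtain ⟨m, hm⟩ := ENNReal.exists_inv_nat_lt hs
  obtain ⟨n, hn⟩ := hx m
  exact ⟨n, hn.trans (le_trans (ENNReal.inv_le_inv.2 le_self_add) hm.le)⟩

/-- The set where the maximal function is infinite lies in every superlevel set; the levels s = n →
∞ show that it is null. -/
lemma WeakType.ae_lt_top (hw : WeakType d E B α q) (hB : B ≠ ∞) (hq : 0 < q)
    {h : 𝔼 → ℝ≥0∞} (hh : distIntegral α h ≠ ∞) : ∀ᵐ x, upperMaximal E h x < ∞ := by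
  have hBh : B * distIntegral α h ≠ ∞ := ENNReal.mul_ne_top hB hh
  have h0 : volume {x | ¬ upperMaximal E h x < ∞} ^ (1 / q) = 0 := by
    by_contra hne
    obtain ⟨n, hn⟩ := ENNReal.exists_nat_mul_gt hne hBh
    refine absurd (hw h n (ENNReal.natCast_ne_top n)) (not_le.2 (hn.trans_le ?_))
    gcongr
    intro hx
    rw [not_lt, top_le_iff] at hx
    simp only [hx, ENNReal.natCast_lt_top]
  exact (ENNReal.rpow_eq_zero_iff_of_pos (by positivity)).1 h0

variable [NeZero d]

lemma measurable_sub_smul (x : 𝔼) (t : ℝ) :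
    Measurable fun y : sphere (0 : 𝔼) 1 => x - t • (y : 𝔼) :=
  (by fun_prop : Continuous fun y : sphere (0 : 𝔼) 1 => x - t • (y : 𝔼)).measurable

/-- Almost every family of spheres misses a given null set almost everywhere. -/
lemma WeakType.ae_sphere (hw : WeakType d E B α q) (hB : B ≠ ∞) (hq : 0 < q) (hα : 0 < α)
    {P : 𝔼 → Prop} (hP : ∀ᵐ x, P x) :
    ∀ᵐ x, ∀ t ∈ E, ∀ᵐ y : sphere (0 : 𝔼) 1 ∂(sphereMeasure d), P (x - t • (y : 𝔼)) := by
  -- The indicator of a null set has zero Lorentz functional, so its maximal function vanishes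
  -- almost everywhere, for all radii at once. A measurable hull is taken so that a zero integral
  -- over the sphere means vanishing almost everywhere there.
  set Z : Set 𝔼 := toMeasurable volume {x | ¬ P x} with hZ
  have hZm : MeasurableSet Z := measurableSet_toMeasurable _ _
  have hZ0 : volume Z = 0 := by rw [hZ, measure_toMeasurable]; exact hP
  have hd0 : distIntegral α (Z.indicator (1 : 𝔼 → ℝ≥0∞)) = 0 := by
    refine distIntegral_eq_zero hα (measure_mono_null (fun x hx => ?_) hZ0)
    by_contra hxZ
    exact hx (indicator_of_notMem hxZ _)
  have := hw.ae_exists_le hB hq (h := fun _ => Z.indicator (1 : 𝔼 → ℝ≥0∞))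
    (fun ε _ => ⟨0, by rw [hd0]; exact zero_le⟩)
  filter_upwards [this] with x hx t ht
  have hz : upperMaximal E (Z.indicator (1 : 𝔼 → ℝ≥0∞)) x = 0 := by
    by_contra hne
    obtain ⟨s, hs0, hs⟩ := exists_between (pos_iff_ne_zero.2 hne)
    obtain ⟨_, h⟩ := hx s hs0.ne'
    exact absurd hs (not_lt.2 h)
  have hle : ∫⁻ y, Z.indicator (1 : 𝔼 → ℝ≥0∞) (x - t • (y : 𝔼)) ∂(sphereMeasure d) = 0 := by
    refine nonpos_iff_eq_zero.1 (le_trans ?_ hz.le)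
    exact le_iSup₂ (f := fun t _ => ∫⁻ y, Z.indicator (1 : 𝔼 → ℝ≥0∞) (x - t • (y : 𝔼))
      ∂(sphereMeasure d)) t ht
  have hm : Measurable fun y : sphere (0 : 𝔼) 1 => Z.indicator (1 : 𝔼 → ℝ≥0∞) (x - t • (y : 𝔼)) :=
    (measurable_one.indicator hZm).comp (measurable_sub_smul x t)
  filter_upwards [(lintegral_eq_zero_iff hm).1 hle] with y hy
  by_contra hPy
  have : x - t • (y : 𝔼) ∈ Z := subset_toMeasurable _ _ hPy
  simp [this] at hy

lemma enorm_sphericalMean_le (f : 𝔼 → ℂ) (t : ℝ) (x : 𝔼) :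
    ‖sphericalMean t f x‖ₑ ≤ ∫⁻ y, ‖f (x - t • (y : 𝔼))‖ₑ ∂(sphereMeasure d) :=
  enorm_integral_le_lintegral_enorm _

lemma maximalFunction_le (E : Set ℝ) (f : 𝔼 → ℂ) :
    maximalFunction E f ≤ upperMaximal E fun x => ‖f x‖ₑ := fun x =>
  iSup₂_mono fun t _ => enorm_sphericalMean_le f t x

/-- Spheres are null sets, so measurability of f does not restrict to them by itself; it comes from
comparing f with a measurable representative through `WeakType.ae_sphere`. Finiteness comes from the
maximal function. -/
lemma WeakType.ae_integrable (hw : WeakType d E B α q) (hB : B ≠ ∞) (hq : 0 < q) (hα : 0 < α)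
    {f : 𝔼 → ℂ} (hf : AEStronglyMeasurable f) (hfd : distIntegral α (fun x => ‖f x‖ₑ) ≠ ∞) :
    ∀ᵐ x, ∀ t ∈ E, Integrable (fun y : sphere (0 : 𝔼) 1 => f (x - t • (y : 𝔼))) (sphereMeasure d) := by
  filter_upwards [hw.ae_sphere hB hq hα hf.ae_eq_mk, hw.ae_lt_top hB hq hfd] with x hx hfin t ht
  refine ⟨⟨fun y => hf.mk f (x - t • (y : 𝔼)),
    hf.stronglyMeasurable_mk.comp_measurable (measurable_sub_smul x t), hx t ht⟩, ?_⟩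
  refine lt_of_le_of_lt ?_ hfin
  exact le_iSup₂ (f := fun t _ => ∫⁻ y, ‖f (x - t • (y : 𝔼))‖ₑ ∂(sphereMeasure d)) t ht

/-- Almost everywhere continuity in the radius passes to limits in the Lorentz functional. -/
lemma WeakType.ae_continuousOn_of_approx (hw : WeakType d E B α q) (hB : B ≠ ∞) (hq : 0 < q)
    (hα : 0 < α) {f : 𝔼 → ℂ} (hf : AEStronglyMeasurable f)
    (hfd : distIntegral α (fun x => ‖f x‖ₑ) ≠ ∞)
    (happ : ∀ ε : ℝ≥0∞, ε ≠ 0 → ∃ g : 𝔼 → ℂ, AEStronglyMeasurable g ∧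
      distIntegral α (fun x => ‖g x‖ₑ) ≠ ∞ ∧ distIntegral α (fun x => ‖f x - g x‖ₑ) ≤ ε ∧
      ∀ᵐ x, ContinuousOn (fun t => sphericalMean t g x) E) :
    ∀ᵐ x, ContinuousOn (fun t => sphericalMean t f x) E := by
  choose g hgm hgd hfg hgc using fun n : ℕ => happ (n + 1 : ℝ≥0∞)⁻¹ (by simp)
  have hsmall : ∀ ε : ℝ≥0∞, ε ≠ 0 → ∃ n, distIntegral α (fun x => ‖f x - g n x‖ₑ) ≤ ε := by
    intro ε hε
    obtain ⟨n, hn⟩ := ENNReal.exists_inv_nat_lt hε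
    exact ⟨n, (hfg n).trans (le_trans (ENNReal.inv_le_inv.2 le_self_add) hn.le)⟩
  filter_upwards [hw.ae_integrable hB hq hα hf hfd,
    ae_all_iff.2 fun n => hw.ae_integrable hB hq hα (hgm n) (hgd n), ae_all_iff.2 hgc,
    hw.ae_exists_le hB hq hsmall] with x hxf hxg hxc hxs
  -- At a fixed x, a small maximal function of f - g means that the means of f and g are uniformly
  -- close over t ∈ E.
  refine continuousOn_of_uniform_approx_of_continuousOn fun u hu => ?_
  obtain ⟨ε, hε, hεu⟩ := Metric.mem_uniformity_dist.1 hu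
  obtain ⟨n, hn⟩ := hxs (ENNReal.ofReal (ε / 2)) (by simpa using hε)
  refine ⟨fun t => sphericalMean t (g n) x, hxc n, fun t ht => hεu ?_⟩
  have e : sphericalMean t f x - sphericalMean t (g n) x = sphericalMean t (fun x => f x - g n x) x :=
    (integral_sub (hxf t ht) (hxg n t ht)).symm
  have h1 : ‖sphericalMean t f x - sphericalMean t (g n) x‖ₑ ≤ ENNReal.ofReal (ε / 2) := by
    rw [e]
    refine (enorm_sphericalMean_le _ t x).trans (le_trans ?_ hn)
    exact le_iSup₂ (f := fun t _ => ∫⁻ y, ‖f (x - t • (y : 𝔼)) - g n (x - t • (y : 𝔼))‖ₑ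
      ∂(sphereMeasure d)) t ht
  rw [dist_eq_norm]
  rw [← ofReal_norm, ENNReal.ofReal_le_ofReal_iff (by positivity)] at h1
  linarith

/-- Measurability of a single spherical mean. -/
lemma WeakType.aemeasurable_sphericalMean (hw : WeakType d E B α q) (hB : B ≠ ∞) (hq : 0 < q)
    (hα : 0 < α) {f : 𝔼 → ℂ} (hf : AEStronglyMeasurable f) {t : ℝ} (ht : t ∈ E) :
    AEMeasurable (fun x => ‖sphericalMean t f x‖ₑ) := by
  have hm : StronglyMeasurable fun x : 𝔼 =>
      ∫ y : sphere (0 : 𝔼) 1, hf.mk f (x - t • (y : 𝔼)) ∂(sphereMeasure d) :=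
    StronglyMeasurable.integral_prod_right
      (f := fun (x : 𝔼) (y : sphere (0 : 𝔼) 1) => hf.mk f (x - t • (y : 𝔼)))
      (hf.stronglyMeasurable_mk.comp_measurable (measurable_sub_smul_sphere t))
  refine ⟨fun x => ‖∫ y : sphere (0 : 𝔼) 1, hf.mk f (x - t • (y : 𝔼)) ∂(sphereMeasure d)‖ₑ,
    hm.measurable.enorm, ?_⟩
  filter_upwards [hw.ae_sphere hB hq hα hf.ae_eq_mk] with x hx
  rw [sphericalMean, integral_congr_ae (hx t ht)]

lemma iSup_enorm_eq_of_continuousOn {c : Set ℝ} (hcE : c ⊆ E) (hEc : E ⊆ closure c) {F : ℝ → ℂ}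
    (hF : ContinuousOn F E) : ⨆ t ∈ E, ‖F t‖ₑ = ⨆ t ∈ c, ‖F t‖ₑ := by
  refine le_antisymm (iSup₂_le fun t ht => ?_) (iSup_le fun t => iSup_le fun ht =>
    le_iSup₂ (f := fun t _ => ‖F t‖ₑ) t (hcE ht))
  have hc : ContinuousWithinAt (fun t => ‖F t‖ₑ) c t :=
    (continuous_enorm.continuousAt.comp_continuousWithinAt (hF t ht)).mono hcE
  have hne : (nhdsWithin t c).NeBot := mem_closure_iff_nhdsWithin_neBot.1 (hEc ht)
  refine le_of_tendsto hc ?_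
  filter_upwards [self_mem_nhdsWithin] with t' ht'
  exact le_iSup₂ (f := fun t _ => ‖F t‖ₑ) t' ht'

/-- Continuity on E reduces the supremum to a countable dense subset of E, for almost every x. -/
lemma WeakType.aemeasurable_maximalFunction (hw : WeakType d E B α q) (hB : B ≠ ∞) (hq : 0 < q)
    (hα : 0 < α) {f : 𝔼 → ℂ} (hf : AEStronglyMeasurable f)
    (hfc : ∀ᵐ x, ContinuousOn (fun t => sphericalMean t f x) E) :
    AEMeasurable (maximalFunction E f) := by
  obtain ⟨c, hcE, hc, hEc⟩ :=
    (TopologicalSpace.IsSeparable.of_separableSpace E).exists_countable_dense_subset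
  have h1 : AEMeasurable fun x => ⨆ t ∈ c, ‖sphericalMean t f x‖ₑ :=
    AEMeasurable.biSup c hc fun t ht => hw.aemeasurable_sphericalMean hB hq hα hf (hcE ht)
  refine h1.congr ?_
  filter_upwards [hfc] with x hx
  exact (iSup_enorm_eq_of_continuousOn hcE hEc hx).symm

end Pointwise
end SphericalMax

namespace SphericalMax

/-! ### Density of continuous functions for the Lorentz functional. -/

section Approximation

open Metric Filter Topology

variable {d : ℕ}

local notation "𝔼" => EuclideanSpace ℝ (Fin d)

lemma antitone_distribution {α : ℝ} (hα : 0 ≤ α) (h : 𝔼 → ℝ≥0∞) :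
    Antitone fun r : ℝ => volume {x | ENNReal.ofReal r < h x} ^ α := fun _ _ hab =>
  ENNReal.rpow_le_rpow (measure_mono fun _ hx => lt_of_le_of_lt (ENNReal.ofReal_le_ofReal hab) hx) hα

lemma ofReal_mul_distribution_le {α : ℝ} (hα : 0 ≤ α) (h : 𝔼 → ℝ≥0∞) (s : ℝ) :
    ENNReal.ofReal s * volume {x | ENNReal.ofReal s < h x} ^ α ≤ distIntegral α h := by
  calc ENNReal.ofReal s * volume {x | ENNReal.ofReal s < h x} ^ α
      = ∫⁻ _ in Ioc 0 s, volume {x | ENNReal.ofReal s < h x} ^ α := by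
        rw [setLIntegral_const, Real.volume_Ioc, sub_zero, mul_comm]
    _ ≤ ∫⁻ r in Ioc 0 s, volume {x | ENNReal.ofReal r < h x} ^ α :=
        setLIntegral_mono' measurableSet_Ioc fun r hr => antitone_distribution hα h hr.2
    _ ≤ distIntegral α h := lintegral_mono_set Ioc_subset_Ioi_self

/-- The Lorentz functional of a bounded function is controlled by its integral. -/
lemma distIntegral_le_of_bounded {α : ℝ} (hα : 0 < α) {h : 𝔼 → ℝ≥0∞} (hm : AEMeasurable h) {N : ℝ}
    (hN : ∀ x, h x ≤ ENNReal.ofReal N) :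
    distIntegral α h ≤ (∫⁻ x, h x) ^ α * ∫⁻ r in Ioc 0 N, ENNReal.ofReal (r ^ (-α)) := by
  have hpt : ∀ r ∈ Ioi (0 : ℝ), volume {x | ENNReal.ofReal r < h x} ^ α ≤
      (Ioc 0 N).indicator (fun r => (∫⁻ x, h x) ^ α * ENNReal.ofReal (r ^ (-α))) r := by
    intro r hr
    rw [mem_Ioi] at hr
    rcases le_or_gt r N with hrN | hrN
    · rw [indicator_of_mem (show r ∈ Ioc 0 N from ⟨hr, hrN⟩)]
      have h0 : ENNReal.ofReal r ≠ 0 := by simpa using hr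
      have hsub : {x | ENNReal.ofReal r < h x} ⊆ {x | ENNReal.ofReal r ≤ h x} :=
        fun x (hx : ENNReal.ofReal r < h x) => show ENNReal.ofReal r ≤ h x from hx.le
      have h1 : volume {x | ENNReal.ofReal r < h x} ≤ (∫⁻ x, h x) / ENNReal.ofReal r :=
        (measure_mono hsub).trans
          (meas_ge_le_lintegral_div hm h0 ENNReal.ofReal_ne_top)
      refine (ENNReal.rpow_le_rpow h1 hα.le).trans_eq ?_
      rw [ENNReal.div_rpow_of_nonneg _ _ hα.le, ENNReal.ofReal_rpow_of_pos hr, Real.rpow_neg hr.le,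
        ENNReal.ofReal_inv_of_pos (by positivity), div_eq_mul_inv]
    · have : {x | ENNReal.ofReal r < h x} = ∅ := by
        refine eq_empty_of_forall_notMem fun x hx => ?_
        exact absurd ((hN x).trans (ENNReal.ofReal_le_ofReal hrN.le)) (not_le.2 hx)
      rw [this, measure_empty, ENNReal.zero_rpow_of_pos hα]
      exact zero_le
  calc distIntegral α h ≤ ∫⁻ r in Ioi (0 : ℝ),
        (Ioc 0 N).indicator (fun r => (∫⁻ x, h x) ^ α * ENNReal.ofReal (r ^ (-α))) r :=
        setLIntegral_mono' measurableSet_Ioi hpt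
    _ ≤ ∫⁻ r in Ioc 0 N, (∫⁻ x, h x) ^ α * ENNReal.ofReal (r ^ (-α)) := by
        rw [← lintegral_indicator measurableSet_Ioc]
        exact setLIntegral_le_lintegral _ _
    _ = _ := lintegral_const_mul _ (by fun_prop)

/-- Here α < 1, that is p > 1, is needed: Chebyshev's bound r^{-α} for small levels must be
integrable at 0. -/
lemma lintegral_rpow_neg_ne_top {α : ℝ} (hα : α < 1) (N : ℝ) :
    ∫⁻ r in Ioc 0 N, ENNReal.ofReal (r ^ (-α)) ≠ ∞ := by
  have h := (intervalIntegral.intervalIntegrable_rpow' (a := 0) (b := N) (r := -α) (by linarith)).1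
  exact (Integrable.lintegral_lt_top h).ne

/-- Radial truncation of complex numbers. -/
noncomputable def truncate (N : ℝ) (z : ℂ) : ℂ := (N / max N ‖z‖) • z

lemma continuous_truncate {N : ℝ} (hN : 0 < N) : Continuous (truncate N) := by
  unfold truncate
  exact (continuous_const.div (by fun_prop) fun z => (lt_max_of_lt_left hN).ne').smul continuous_id

lemma norm_truncate_le {N : ℝ} (hN : 0 < N) (z : ℂ) : ‖truncate N z‖ ≤ N := by
  have h : 0 < max N ‖z‖ := lt_max_of_lt_left hN
  rw [truncate, norm_smul, Real.norm_of_nonneg (by positivity), div_mul_eq_mul_div, div_le_iff₀ h]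
  gcongr
  exact le_max_right _ _

/-- Truncation moves z by its distance to the disc of radius N, which is at most ‖w - z‖ because w
lies in that disc. -/
lemma norm_sub_truncate_le {N : ℝ} (hN : 0 < N) {w : ℂ} (hw : ‖w‖ ≤ N) (z : ℂ) :
    ‖w - truncate N z‖ ≤ 2 * ‖w - z‖ := by
  have h1 : ‖z - truncate N z‖ ≤ ‖w - z‖ := by
    rcases le_total ‖z‖ N with hz | hz
    · rw [truncate, max_eq_left hz, div_self hN.ne', one_smul, sub_self, norm_zero]
      exact norm_nonneg _
    · have hz0 : 0 < ‖z‖ := hN.trans_le hz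
      have e : z - truncate N z = (1 - N / ‖z‖) • z := by
        rw [truncate, max_eq_right hz, sub_smul, one_smul]
      rw [e, norm_smul, Real.norm_of_nonneg (sub_nonneg.2 ((div_le_one hz0).2 hz)), sub_mul,
        div_mul_cancel₀ _ hz0.ne', one_mul]
      have := norm_sub_norm_le z w
      rw [norm_sub_rev] at this
      linarith
  calc ‖w - truncate N z‖ = ‖(w - z) + (z - truncate N z)‖ := by congr 1; ring
    _ ≤ ‖w - z‖ + ‖z - truncate N z‖ := norm_add_le _ _
    _ ≤ _ := by linarith

/-- Bounded integrable functions are approximated by continuous functions of compact support. -/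
lemma exists_continuous_distIntegral_sub_le {α : ℝ} (hα0 : 0 < α) (hα1 : α < 1) {f : 𝔼 → ℂ}
    (hf : Integrable f) {N : ℝ} (hN : 0 < N) (hfN : ∀ x, ‖f x‖ ≤ N) {ε : ℝ≥0∞} (hε : ε ≠ 0) :
    ∃ g : 𝔼 → ℂ, Continuous g ∧ Integrable g ∧ distIntegral α (fun x => ‖g x‖ₑ) ≠ ∞ ∧
      distIntegral α (fun x => ‖f x - g x‖ₑ) ≤ ε := by
  set c : ℝ≥0∞ := ∫⁻ r in Ioc 0 (2 * N), ENNReal.ofReal (r ^ (-α)) with hc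
  have hct : c ≠ ∞ := lintegral_rpow_neg_ne_top hα1 _
  have hc1 : c + 1 ≠ ∞ := by simp [hct]
  -- Chosen so that (2η)^α (c + 1) = ε; the 2 is the loss from truncation, and c + 1 avoids division
  -- by zero.
  set η : ℝ≥0∞ := (ε / (c + 1)) ^ (1 / α) / 2 with hη
  have hη0 : η ≠ 0 := by
    refine (ENNReal.div_pos ?_ (by simp)).ne'
    rw [Ne, ENNReal.rpow_eq_zero_iff_of_pos (by positivity)]
    exact (ENNReal.div_pos hε hc1).ne'
  obtain ⟨g, hgs, hfg, hgc, -⟩ := hf.exists_hasCompactSupport_lintegral_sub_le hη0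
  have htc : Continuous fun x => truncate N (g x) := (continuous_truncate hN).comp hgc
  have ht0 : truncate N 0 = 0 := smul_zero _
  have hts : HasCompactSupport fun x => truncate N (g x) := hgs.comp_left ht0
  have hti : Integrable fun x => truncate N (g x) := htc.integrable_of_hasCompactSupport hts
  refine ⟨fun x => truncate N (g x), htc, hti, ?_, ?_⟩
  · refine ne_top_of_le_ne_top (ENNReal.mul_ne_top (ENNReal.rpow_ne_top_of_nonneg hα0.le ?_)
      (lintegral_rpow_neg_ne_top hα1 N)) (distIntegral_le_of_bounded hα0
        htc.enorm.measurable.aemeasurable fun x => ?_)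
    · exact hti.2.ne
    · rw [← ofReal_norm]
      exact ENNReal.ofReal_le_ofReal (norm_truncate_le hN _)
  · have hI : ∫⁻ x, ‖f x - truncate N (g x)‖ₑ ≤ 2 * η := by
      calc ∫⁻ x, ‖f x - truncate N (g x)‖ₑ ≤ ∫⁻ x, 2 * ‖f x - g x‖ₑ := by
            refine lintegral_mono fun x => ?_
            rw [← ofReal_norm, ← ofReal_norm, ← ENNReal.ofReal_ofNat, ← ENNReal.ofReal_mul (by norm_num)]
            exact ENNReal.ofReal_le_ofReal (norm_sub_truncate_le hN (hfN x) _)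
        _ = 2 * ∫⁻ x, ‖f x - g x‖ₑ := lintegral_const_mul' _ _ (by simp)
        _ ≤ 2 * η := by gcongr
    calc distIntegral α (fun x => ‖f x - truncate N (g x)‖ₑ)
        ≤ (∫⁻ x, ‖f x - truncate N (g x)‖ₑ) ^ α * c := by
          refine distIntegral_le_of_bounded hα0 (hf.1.sub hti.1).enorm fun x => ?_
          rw [← ofReal_norm]
          refine ENNReal.ofReal_le_ofReal ((norm_sub_le _ _).trans ?_)
          linarith [hfN x, norm_truncate_le hN (g x)]
      _ ≤ (2 * η) ^ α * (c + 1) := by gcongr; exact le_self_add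
      _ = ε := by
          rw [hη, ENNReal.mul_div_cancel (by simp) (by simp), ← ENNReal.rpow_mul,
            one_div_mul_cancel hα0.ne', ENNReal.rpow_one, ENNReal.div_mul_cancel (by simp) hc1]

/-- The part of a function where its modulus is neither small nor large. -/
noncomputable def middlePart (f : 𝔼 → ℂ) (n : ℕ) : 𝔼 → ℂ :=
  {x | ((n : ℝ) + 1)⁻¹ < ‖f x‖ ∧ ‖f x‖ ≤ n + 1}.indicator f

lemma norm_middlePart_le (f : 𝔼 → ℂ) (n : ℕ) (x : 𝔼) : ‖middlePart f n x‖ ≤ n + 1 := by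
  rw [middlePart, indicator]
  split_ifs with h
  · exact h.2
  · rw [norm_zero]; positivity

lemma nullMeasurableSet_middle {f : 𝔼 → ℂ} (hf : AEStronglyMeasurable f) (n : ℕ) :
    NullMeasurableSet {x | ((n : ℝ) + 1)⁻¹ < ‖f x‖ ∧ ‖f x‖ ≤ n + 1} volume :=
  (nullMeasurableSet_lt aemeasurable_const hf.norm.aemeasurable).inter
    (nullMeasurableSet_le hf.norm.aemeasurable aemeasurable_const)

/-- Bounded, and supported where ‖f‖ > 1/(n+1), a set of finite measure since the Lorentz functional
is finite. -/
lemma integrable_middlePart {α : ℝ} (hα : 0 < α) {f : 𝔼 → ℂ} (hf : AEStronglyMeasurable f)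
    (hfd : distIntegral α (fun x => ‖f x‖ₑ) ≠ ∞) (n : ℕ) : Integrable (middlePart f n) := by
  have hn : (0 : ℝ) < ((n : ℝ) + 1)⁻¹ := by positivity
  set A := {x | ((n : ℝ) + 1)⁻¹ < ‖f x‖ ∧ ‖f x‖ ≤ n + 1} with hA
  have hfin : volume A ≠ ∞ := by
    have h1 := ofReal_mul_distribution_le hα.le (fun x => ‖f x‖ₑ) (((n : ℝ) + 1)⁻¹)
    have h2 : volume {x | ENNReal.ofReal (((n : ℝ) + 1)⁻¹) < ‖f x‖ₑ} ≠ ∞ := by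
      intro htop
      rw [htop, ENNReal.top_rpow_of_pos hα, ENNReal.mul_top (by simpa using hn), top_le_iff] at h1
      exact hfd h1
    refine ne_top_of_le_ne_top h2 (measure_mono fun x hx => ?_)
    rw [mem_ofPred_eq, ← ofReal_norm]
    exact (ENNReal.ofReal_lt_ofReal_iff (hn.trans hx.1)).2 hx.1
  have hAm := nullMeasurableSet_middle hf n
  refine IntegrableOn.integrable_indicator₀ ?_ hAm
  have hfm : IsFiniteMeasure (volume.restrict A) := ⟨by simpa using hfin.lt_top⟩
  refine (integrable_const ((n : ℝ) + 1)).mono' hf.restrict ?_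
  filter_upwards [ae_restrict_mem₀ hAm] with x hx
  exact hx.2

lemma enorm_sub_middlePart_le (f : 𝔼 → ℂ) (n : ℕ) (x : 𝔼) : ‖f x - middlePart f n x‖ₑ ≤ ‖f x‖ₑ := by
  rw [middlePart, indicator]
  split_ifs with h
  · simp
  · simp

lemma enorm_middlePart_le (f : 𝔼 → ℂ) (n : ℕ) (x : 𝔼) : ‖middlePart f n x‖ₑ ≤ ‖f x‖ₑ := by
  rw [middlePart, indicator]
  split_ifs with h
  · simp
  · simp

/-- Dominated convergence in the level r. Once 1/(n+1) ≤ r, the remainder exceeds r only where ‖f‖ >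
n + 1, and the measure of that set tends to 0 by Chebyshev. -/
lemma tendsto_distIntegral_sub_middlePart {α : ℝ} (hα : 0 < α) {f : 𝔼 → ℂ}
    (hfd : distIntegral α (fun x => ‖f x‖ₑ) ≠ ∞) :
    Tendsto (fun n => distIntegral α (fun x => ‖f x - middlePart f n x‖ₑ)) atTop (𝓝 0) := by
  have h := tendsto_lintegral_of_dominated_convergence (μ := volume.restrict (Ioi (0 : ℝ)))
    (F := fun n r => volume {x | ENNReal.ofReal r < ‖f x - middlePart f n x‖ₑ} ^ α)
    (f := fun _ => 0) (fun r => volume {x | ENNReal.ofReal r < ‖f x‖ₑ} ^ α)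
    (fun n => (antitone_distribution hα.le _).measurable)
    (fun n => Eventually.of_forall fun r => ENNReal.rpow_le_rpow (measure_mono fun x hx =>
      lt_of_lt_of_le hx (enorm_sub_middlePart_le f n x)) hα.le) hfd ?_
  · rw [lintegral_zero] at h
    exact h
  · filter_upwards [ae_restrict_mem measurableSet_Ioi] with r hr
    rw [mem_Ioi] at hr
    have hlim : Tendsto (fun n : ℕ => distIntegral α (fun x => ‖f x‖ₑ) / ENNReal.ofReal ((n : ℝ) + 1))
        atTop (𝓝 0) := by
      have h1 : Tendsto (fun n : ℕ => ENNReal.ofReal ((n : ℝ) + 1)) atTop (𝓝 ∞) :=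
        ENNReal.tendsto_ofReal_atTop.comp
          (tendsto_atTop_add_const_right _ _ tendsto_natCast_atTop_atTop)
      simpa using ENNReal.Tendsto.const_div h1 (Or.inr hfd)
    refine tendsto_of_tendsto_of_tendsto_of_le_of_le' tendsto_const_nhds hlim
      (Eventually.of_forall fun _ => zero_le) ?_
    obtain ⟨n₀, hn₀⟩ := exists_nat_one_div_lt hr
    filter_upwards [eventually_ge_atTop n₀] with n hn
    have hnr : ((n : ℝ) + 1)⁻¹ ≤ r := by
      rw [← one_div]
      exact (Nat.one_div_le_one_div hn).trans hn₀.le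
    have hsub : {x | ENNReal.ofReal r < ‖f x - middlePart f n x‖ₑ} ⊆
        {x | ENNReal.ofReal ((n : ℝ) + 1) < ‖f x‖ₑ} := by
      intro x hx
      have hx1 : ENNReal.ofReal r < ‖f x‖ₑ := lt_of_lt_of_le hx (enorm_sub_middlePart_le f n x)
      have hrf : r < ‖f x‖ := by
        rw [← ofReal_norm] at hx1
        exact (ENNReal.ofReal_lt_ofReal_iff_of_nonneg hr.le).1 hx1
      have hnot : ¬ (((n : ℝ) + 1)⁻¹ < ‖f x‖ ∧ ‖f x‖ ≤ n + 1) := by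
        intro hmem
        have e : middlePart f n x = f x := by
          rw [middlePart, indicator_of_mem]
          exact hmem
        rw [mem_ofPred_eq, e, sub_self] at hx
        simp at hx
      rw [not_and, not_le] at hnot
      have hbig := hnot (hnr.trans_lt hrf)
      rw [mem_ofPred_eq, ← ofReal_norm]
      exact (ENNReal.ofReal_lt_ofReal_iff_of_nonneg (by positivity)).2 hbig
    refine (ENNReal.rpow_le_rpow (measure_mono hsub) hα.le).trans ?_
    rw [ENNReal.le_div_iff_mul_le (Or.inl (by simp; positivity)) (Or.inl ENNReal.ofReal_ne_top), mul_comm]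
    exact ofReal_mul_distribution_le hα.le (fun x => ‖f x‖ₑ) _

variable [NeZero d] {E : Set ℝ} {B : ℝ≥0∞} {α q : ℝ}

/-- For almost every center the spherical means depend continuously on the radius. -/
lemma WeakType.ae_continuousOn (hw : WeakType d E B α q) (hB : B ≠ ∞) (hq : 0 < q)
    (hα0 : 0 < α) (hα1 : α < 1) {f : 𝔼 → ℂ} (hf : AEStronglyMeasurable f)
    (hfd : distIntegral α (fun x => ‖f x‖ₑ) ≠ ∞) :
    ∀ᵐ x, ContinuousOn (fun t => sphericalMean t f x) E := by
  have hmid : ∀ n, distIntegral α (fun x => ‖middlePart f n x‖ₑ) ≠ ∞ := fun n =>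
    ne_top_of_le_ne_top hfd (distIntegral_mono hα0.le (enorm_middlePart_le f n))
  refine hw.ae_continuousOn_of_approx hB hq hα0 hf hfd fun ε hε => ?_
  obtain ⟨n, hn⟩ := ((tendsto_order.1 (tendsto_distIntegral_sub_middlePart hα0 hfd)).2 ε
    (pos_iff_ne_zero.2 hε)).exists
  have hi := integrable_middlePart hα0 hf hfd n
  refine ⟨middlePart f n, hi.1, hmid n, hn.le, ?_⟩
  -- A second approximation: the middle part reduced f to a bounded integrable function, which is
  -- now approximated by continuous ones, whose means are continuous in t at every x.
  refine hw.ae_continuousOn_of_approx hB hq hα0 hi.1 (hmid n) fun ε hε => ?_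
  obtain ⟨g, hgc, hgi, hgd, hfg⟩ := exists_continuous_distIntegral_sub_le hα0 hα1 hi
    (by positivity : (0 : ℝ) < n + 1) (norm_middlePart_le f n) hε
  refine ⟨g, hgi.1, hgd, hfg, Eventually.of_forall fun x => Continuous.continuousOn ?_⟩
  exact (continuous_sphericalMean hgc).comp (by fun_prop : Continuous fun t : ℝ => (t, x))

end Approximation
end SphericalMax

namespace SphericalMax

/-! ### Assembling the theorem. -/

section Main

/-- The weak type estimate holds with a constant that depends only on `d`, `γ` and `A`. -/
lemma exists_weakType {d : ℕ} [NeZero d] (hd : 2 ≤ d) {γ : ℝ} (hγ0 : 0 ≤ γ) (hγ1 : γ ≤ 1)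
    (hγd : 2 * γ < ((d : ℝ) - 1) ^ 2) (A : ℝ≥0) : ∃ C : ℝ, 0 < C ∧ ∀ E : Set ℝ, E ⊆ Icc 1 2 →
      assouadSup γ E ≤ A → WeakType d E (ENNReal.ofReal C) (1 / p4 d γ) (q4 d γ) := by
  obtain ⟨C, hC, hbound⟩ := exists_restricted_bound hd hγ0 hγ1 hγd A
  obtain ⟨-, -, -, -, hp, hqd⟩ := exponent_relations hd hγ0 hγd rfl rfl
  have hd' : (2 : ℝ) ≤ d := by exact_mod_cast hd
  have hq0 : 0 < q4 d γ := by linarith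
  have hα0 : 0 < 1 / p4 d γ := by rw [hp]; positivity
  have hα1 : 1 / p4 d γ ≤ 1 := by rw [hp, div_le_one hq0]; linarith
  refine ⟨C * 4, by positivity, fun E hE hA h s hs => ?_⟩
  have hR := restrictedWeakType_of_continuous hC hα0 (hbound E hE hA)
  refine (hR.weak_type (by simpa using hC) ENNReal.ofReal_ne_top hα0 hα1 hq0 h hs).trans_eq ?_
  rw [ENNReal.ofReal_mul hC.le, ENNReal.ofReal_ofNat, mul_assoc]

end Main
end SphericalMax

theorem proposition3p1 (d : ℕ) (γ : ℝ) (hγ0 : 0 ≤ γ) (hγ1 : γ ≤ 1)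
    (hd : 3 ≤ d ∨ (d = 2 ∧ γ < 1 / 2)) (A : ℝ≥0) :
    ∃ C : ℝ≥0, ∀ E : Set ℝ, E ⊆ Set.Icc 1 2 → SphericalMax.assouadSup γ E ≤ A →
      ∀ f : EuclideanSpace ℝ (Fin d) → ℂ, AEStronglyMeasurable f volume →
        SphericalMax.lorentzNormOne (SphericalMax.p4 d γ) f volume < ∞ →
          (∀ᵐ x : EuclideanSpace ℝ (Fin d), ∀ t ∈ E,
            Integrable (fun y : Metric.sphere (0 : EuclideanSpace ℝ (Fin d)) 1 =>
              f (x - t • (y : EuclideanSpace ℝ (Fin d)))) (SphericalMax.sphereMeasure d)) ∧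
          AEMeasurable (SphericalMax.maximalFunction E f) volume ∧
          SphericalMax.lorentzNormTop (SphericalMax.q4 d γ)
              (SphericalMax.maximalFunction E f) volume ≤
            C * SphericalMax.lorentzNormOne (SphericalMax.p4 d γ) f volume := by
  have hd2 : 2 ≤ d := by omega
  have : NeZero d := ⟨by omega⟩
  have hd' : (2 : ℝ) ≤ d := by exact_mod_cast hd2
  -- Both cases of the hypothesis enter only through this inequality: for d ≥ 3 the right side is at
  -- least 4 > 2γ, and for d = 2 it equals 1.
  have hγd : 2 * γ < ((d : ℝ) - 1) ^ 2 := by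
    rcases hd with h3 | ⟨rfl, hγ⟩
    · have : (3 : ℝ) ≤ d := by exact_mod_cast h3
      nlinarith
    · norm_num
      linarith
  obtain ⟨-, -, -, -, hp, hqd⟩ := SphericalMax.exponent_relations hd2 hγ0 hγd rfl rfl
  obtain ⟨C, hC, hweak⟩ := SphericalMax.exists_weakType hd2 hγ0 hγ1 hγd A
  have hq0 : 0 < SphericalMax.q4 d γ := by linarith
  have hα0 : 0 < 1 / SphericalMax.p4 d γ := by rw [hp]; positivity
  have hα1 : 1 / SphericalMax.p4 d γ < 1 := by rw [hp, div_lt_one hq0]; linarith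
  have hp0 : 0 < SphericalMax.p4 d γ := one_div_pos.1 hα0
  -- Division by p4 cancels the normalizing factor p in the Lorentz norm.
  refine ⟨(C / SphericalMax.p4 d γ).toNNReal, fun E hE hA f hf hfL => ?_⟩
  have hw := hweak E hE hA
  have hL : SphericalMax.lorentzNormOne (SphericalMax.p4 d γ) f volume =
      ENNReal.ofReal (SphericalMax.p4 d γ) *
        SphericalMax.distIntegral (1 / SphericalMax.p4 d γ) fun x => ‖f x‖ₑ := rfl
  have hfd : SphericalMax.distIntegral (1 / SphericalMax.p4 d γ) (fun x => ‖f x‖ₑ) ≠ ∞ := by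
    intro htop
    rw [hL, htop, ENNReal.mul_top (by simpa using hp0)] at hfL
    exact lt_irrefl _ hfL
  refine ⟨hw.ae_integrable ENNReal.ofReal_ne_top hq0 hα0 hf hfd,
    hw.aemeasurable_maximalFunction ENNReal.ofReal_ne_top hq0 hα0 hf
      (hw.ae_continuousOn ENNReal.ofReal_ne_top hq0 hα0 hα1 hf hfd), ?_⟩
  refine iSup₂_le fun s _ => ?_
  have e : ((C / SphericalMax.p4 d γ).toNNReal : ℝ≥0∞) * ENNReal.ofReal (SphericalMax.p4 d γ) =
      ENNReal.ofReal C := by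
    rw [← ENNReal.ofReal, ← ENNReal.ofReal_mul (by positivity), div_mul_cancel₀ _ hp0.ne']
  rw [hL, ← mul_assoc, e]
  refine le_trans ?_ (hw (fun x => ‖f x‖ₑ) (ENNReal.ofReal s) ENNReal.ofReal_ne_top)
  gcongr with x
  rw [enorm_eq_self]
  exact SphericalMax.maximalFunction_le E f x
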